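/- **Theorem (regret bound of EULER with greedy policies, EULER-GP).** Let $\mathcal M=(\mathcal S,\mathcal A,R,p,H)$ be a finite-horizon MDP with time-independent dynamics, $S=|\mathcal S|$ states, $A=|\mathcal A|$ actions, horizon $H\ge1$, transition probabilities $p(s'\mid s,a)$ and random rewards $R(s,a)\in[0,1]$ with mean $r(s,a)$. For a deterministic policy $\pi$ let $V^\pi_t(s)=\mathbb E[\sum_{t'=t}^H r(s_{t'},\pi(s_{t'},t'))\mid s_t=s]$, let $V_t^*=\max_\pi V_t^\pi$, and $V^*_{H+1}=0$. Let $K$ be the number of episodes, $\delta\in(0,1)$, $\delta'=\delta/9$, $\ell=\ln\frac{4SA\,KH}{\delta'}$. *Algorithm.* Let $n_{k}(s,a)$, $\hat r_{k}(s,a)$, $\hat p_{k}(\cdot\mid s,a)$, $\widehat{\mathrm{Var}}_k(R(s,a))$ be the visit count, empirical mean reward, empirical transition probabilities and sample variance of the rewards of $(s,a)$ over the first $k$ episodes (all estimates are $0$ without data), and $m=n_{k-1}(s,a)\vee 1$. Put $J=\frac{2H\ell}{3}$, $B_v=\sqrt{2\ell}$, $B_p=H\sqrt{2\ell}$, $\|V\|_{2,\hat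 p}=\sqrt{\sum_{s'}\hat p(s')V(s')^2}$ and, in episode $k$, with $\hat p=\hat p_{k-1}(\cdot\mid s,a)$, $$b^r(s,a)=\sqrt{\tfrac{2\widehat{\mathrm{Var}}_{k-1}(R(s,a))\,\ell}{m}}+\tfrac{14\,\ell}{3m},\qquad b^{pv}(s,a;V,W)=\sqrt{\tfrac{2\mathrm{Var}_{\hat p}(V)\,\ell}{m}}+\tfrac{2H\ell}{3m}+\tfrac{4J+B_p}{m}+\tfrac{B_v\|V-W\|_{2,\hat p}}{\sqrt m}.$$ Start from $\bar V^0_t(s)=H-(t-1)$ and $\underline V^0_t(s)=0$. In episode $k=1,\dots,K$, from an arbitrary initial state $s_1^k$ (which may depend on the past), at each step $t=1,\dots,H$ play $a_t^k=\pi_k(s_t^k,t)$, where $\pi_k$ is determined by the history up to the end of episode $k-1$ together with $s_1^k$ and is greedy (with any tie-breaking), $\pi_k(s,t)\in\arg\max_a\bar Q_t(s,a)$, for $$\bar Q_t(s,a)=\hat r_{k-1}(s,a)+b^r(s,a)+\hat p^{T}\bar V^{k-1}_{t+1}+b^{pv}(s,a;\bar V^{k-1}_{t+1},\underline V^{k-1}_{t+1}),$$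 and update, at the visited state only, $\bar V_t^k(s_t^k)=\min\{\bar V_t^{k-1}(s_t^k),\bar Q_t(s_t^k,a_t^k)\}$ and $\underline V_t^k(s_t^k)=\max\{\underline V_t^{k-1}(s_t^k),\underline Q_t(s_t^k,a_t^k)\}$, where $$\underline Q_t(s,a)=\hat r_{k-1}(s,a)-b^r(s,a)+\hat p^{T}\underline V^{k-1}_{t+1}-b^{pv}(s,a;\underline V^{k-1}_{t+1},\bar V^{k-1}_{t+1}).$$ *Conclusion.* Let $\mathcal G$ be an almost sure upper bound on the total reward collected within each episode, and let $$\mathbb Q^*=\max_{s,a,t}\big(\mathrm{Var}\,R(s,a)+\mathrm{Var}_{s'\sim p(\cdot\mid s,a)}V^*_{t+1}(s')\big),\qquad H_{\mathrm{eff}}=\min\{\mathbb Q^*,\mathcal G^2/H\}.$$ There are a universal constant $C>0$ and a universal exponent $d$ such that, with probability at least $1-\delta$, simultaneously for all $k\in\{1,\dots,K\}$, with $T=kH$, the regret $\mathrm{Regret}(k)=\sum_{j=1}^k\big(V_1^*(s_1^j)-V_1^{\pi_j}(s_1^j)\big)$ satisfies both $$\mathrm{Regret}(k)\le C\,\ell^{\,d}\Big(\sqrt{H_{\mathrm{eff}}\,SAT}+\sqrt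 S\,SAH^2(\sqrt S+\sqrt H)\Big)$$ and $$\mathrm{Regret}(k)\le C\,\ell^{\,d}\Big(\sqrt{HSAT}+\sqrt S\,SAH^2(\sqrt S+\sqrt H)\Big).$$ -/

import Mathlib

open MeasureTheory ProbabilityTheory

noncomputable section

/-- A finite-horizon Markov decision process with time-independent dynamics on the finite state
space `S` and action space `A`. `R s a` is the law of the random reward of the pair `(s, a)`, a
probability measure carried by `[0, 1]`; `p s a s'` is the probability of moving to `s'` from `s`
under the action `a`; `H` is the horizon. Time-steps in an episode are numbered `0, ..., H - 1`. -/
structure FiniteMDP (S A : Type*) [Fintype S] where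
  R : S → A → Measure ℝ
  R_prob : ∀ s a, IsProbabilityMeasure (R s a)
  R_mem : ∀ s a, ∀ᵐ x ∂(R s a), x ∈ Set.Icc (0 : ℝ) 1
  p : S → A → S → ℝ
  p_mem : ∀ s a, p s a ∈ stdSimplex ℝ S
  H : ℕ
  H_pos : 0 < H

/-- A deterministic policy: `pol t s` is the action taken at time-step `t` in state `s`. -/
abbrev DetPolicy (S A : Type*) := ℕ → S → A

/-- The expectation `pᵀ V` of `V` under the weights `p`. -/
def meanOf {S : Type*} [Fintype S] (p V : S → ℝ) : ℝ := ∑ x, p x * V x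

/-- The variance of `V` under the weights `p`. -/
def varOf {S : Type*} [Fintype S] (p V : S → ℝ) : ℝ := ∑ x, p x * (V x - meanOf p V) ^ 2

/-- The seminorm `‖V‖_{2,p}`, the square root of the expectation of `V ^ 2` under `p`. -/
def norm2Of {S : Type*} [Fintype S] (p V : S → ℝ) : ℝ := √(∑ x, p x * V x ^ 2)

namespace FiniteMDP

variable {S A : Type*} [Fintype S] [DecidableEq S]

/-- The expected reward `r(s, a)`. -/
def r (M : FiniteMDP S A) (s : S) (a : A) : ℝ := ∫ x, x ∂(M.R s a)

/-- The variance of the reward of `(s, a)`. -/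
def varR (M : FiniteMDP S A) (s : S) (a : A) : ℝ := Var[fun x : ℝ => x; M.R s a]

/-- `M.stateProb pol t s i s'` is the probability of being in `s'` at time-step `t + i` when the
policy `pol` is followed from state `s` at time-step `t`. -/
def stateProb (M : FiniteMDP S A) (pol : DetPolicy S A) (t : ℕ) (s : S) : ℕ → S → ℝ
  | 0, s' => if s' = s then 1 else 0
  | i + 1, s' => ∑ x, stateProb M pol t s i x * M.p x (pol (t + i) x) s'

/-- The value `V_t^π(s)`: the expected sum of `r(s_u, π(s_u, u))` over the time-steps
`u = t, ..., H - 1` when `pol` is followed from state `s` at time-step `t`. -/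
def value (M : FiniteMDP S A) (pol : DetPolicy S A) (t : ℕ) (s : S) : ℝ :=
  ∑ i ∈ Finset.range (M.H - t), ∑ s', M.stateProb pol t s i s' * M.r s' (pol (t + i) s')

/-- The optimal value `V_t^*(s)`, the maximum of `V_t^π(s)` over all deterministic policies. -/
def optValue (M : FiniteMDP S A) (t : ℕ) (s : S) : ℝ := ⨆ pol : DetPolicy S A, M.value pol t s

/-- `ℚ^*`, the maximum over `s`, `a` and the time-steps `t` of the variance of the reward of
`(s, a)` plus the variance of the optimal value of the next state at the next time-step. -/
def qStar (M : FiniteMDP S A) : ℝ :=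
  ⨆ x : S × A × Fin M.H, (M.varR x.1 x.2.1 + varOf (M.p x.1 x.2.1) (M.optValue (x.2.2 + 1)))

/-- The effective horizon `min {ℚ^*, G² / H}`. -/
def hEff (M : FiniteMDP S A) (G : ℝ) : ℝ := min M.qStar (G ^ 2 / M.H)

end FiniteMDP

/-- A realised sequence of interactions: the state, the action and the reward of time-step `t` of
episode `k` (both numbered from `0`). `state k H` is the state observed after the last action of
episode `k`. -/
structure History (S A : Type*) where
  state : ℕ → ℕ → S
  action : ℕ → ℕ → A
  reward : ℕ → ℕ → ℝ

namespace History

variable {S A : Type*} [DecidableEq S] [DecidableEq A]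

/-- The (episode, time-step) pairs of the first `k` episodes at which the pair `(s, a)` was
visited. -/
def visits (h : History S A) (H k : ℕ) (s : S) (a : A) : Finset (ℕ × ℕ) :=
  (Finset.range k ×ˢ Finset.range H).filter
    fun i => h.state i.1 i.2 = s ∧ h.action i.1 i.2 = a

/-- The number of visits of `(s, a)` in the first `k` episodes. -/
def count (h : History S A) (H k : ℕ) (s : S) (a : A) : ℕ := (h.visits H k s a).card

/-- The number of visits, or `1` if there was none. -/
def count1 (h : History S A) (H k : ℕ) (s : S) (a : A) : ℝ := max (h.count H k s a : ℝ) 1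

/-- The empirical mean reward after `k` episodes (`0` without data). -/
def rHat (h : History S A) (H k : ℕ) (s : S) (a : A) : ℝ :=
  (∑ i ∈ h.visits H k s a, h.reward i.1 i.2) / h.count H k s a

/-- The sample variance of the rewards of `(s, a)` after `k` episodes (`0` if there are fewer than
two samples). -/
def varHat (h : History S A) (H k : ℕ) (s : S) (a : A) : ℝ :=
  (∑ i ∈ h.visits H k s a, (h.reward i.1 i.2 - h.rHat H k s a) ^ 2) / ((h.count H k s a : ℝ) - 1)

/-- The empirical transition probabilities after `k` episodes (`0` without data). -/
def pHat (h : History S A) (H k : ℕ) (s : S) (a : A) (s' : S) : ℝ :=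
  (((h.visits H k s a).filter fun i => h.state i.1 (i.2 + 1) = s').card : ℝ) / h.count H k s a

end History

/-- The logarithmic factor `ln (4 S A T / δ')` of the algorithm, where `T = K H` and
`δ' = δ / 9`. -/
def logFactor (S A : Type*) [Fintype S] [Fintype A] (H K : ℕ) (δ : ℝ) : ℝ :=
  Real.log (4 * Fintype.card S * Fintype.card A * (K * H : ℕ) / (δ / 9))

/-! ### EULER with greedy policies -/

namespace EulerGP

variable {S A : Type*} [Fintype S] [DecidableEq S] [DecidableEq A]

/-- The reward bonus `b^r` after `k` episodes; `ℓ` is the logarithmic factor. -/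
def rewardBonus (H : ℕ) (ℓ : ℝ) (h : History S A) (k : ℕ) (s : S) (a : A) : ℝ :=
  √(2 * h.varHat H k s a * ℓ / h.count1 H k s a) + 14 * ℓ / (3 * h.count1 H k s a)

/-- The Bernstein confidence width `φ(p̂(· | s, a), V)` after `k` episodes. -/
def phi (H : ℕ) (ℓ : ℝ) (h : History S A) (k : ℕ) (s : S) (a : A) (V : S → ℝ) : ℝ :=
  √(2 * varOf (h.pHat H k s a) V * ℓ / h.count1 H k s a) + 2 * H * ℓ / (3 * h.count1 H k s a)

/-- The constant `J`. -/
def constJ (H : ℕ) (ℓ : ℝ) : ℝ := 2 * H * ℓ / 3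

/-- The constant `B_v`. -/
def constBv (ℓ : ℝ) : ℝ := √(2 * ℓ)

/-- The constant `B_p`. -/
def constBp (H : ℕ) (ℓ : ℝ) : ℝ := H * √(2 * ℓ)

/-- The transition bonus `b^{pv}` after `k` episodes for the value estimate `V`, where `W` is the
opposite (lower or upper) value estimate. -/
def transBonus (H : ℕ) (ℓ : ℝ) (h : History S A) (k : ℕ) (s : S) (a : A) (V W : S → ℝ) : ℝ :=
  phi H ℓ h k s a V + (4 * constJ H ℓ + constBp H ℓ) / h.count1 H k s a
    + constBv ℓ * norm2Of (h.pHat H k s a) (fun x => V x - W x) / √(h.count1 H k s a)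

/-- The optimistic `Q`-value built from the upper estimate `U` and the lower estimate `L` of the
optimal value at the next time-step. -/
def qUpper (H : ℕ) (ℓ : ℝ) (h : History S A) (k : ℕ) (U L : S → ℝ) (s : S) (a : A) : ℝ :=
  h.rHat H k s a + rewardBonus H ℓ h k s a + meanOf (h.pHat H k s a) U
    + transBonus H ℓ h k s a U L

/-- The pessimistic `Q`-value. -/
def qLower (H : ℕ) (ℓ : ℝ) (h : History S A) (k : ℕ) (U L : S → ℝ) (s : S) (a : A) : ℝ :=
  h.rHat H k s a - rewardBonus H ℓ h k s a + meanOf (h.pHat H k s a) L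
    - transBonus H ℓ h k s a L U

/-- The pair of value estimates (upper, lower) after `k` episodes, as functions of the time-step
and the state. They start at `H - t` and `0`. An episode changes them only at the visited pairs
`(t, s_t)`, by one greedy step that uses the estimates and the empirical model from before the
episode. -/
def estimates (H : ℕ) (ℓ : ℝ) (h : History S A) : ℕ → (ℕ → S → ℝ) × (ℕ → S → ℝ)
  | 0 => (fun t _ => (H : ℝ) - t, fun _ _ => 0)
  | k + 1 =>
    let U := (estimates H ℓ h k).1
    let L := (estimates H ℓ h k).2
    (fun t s => if t < H ∧ h.state k t = s then
        min (U t s) (qUpper H ℓ h k (U (t + 1)) (L (t + 1)) s (h.action k t)) else U t s,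
      fun t s => if t < H ∧ h.state k t = s then
        max (L t s) (qLower H ℓ h k (U (t + 1)) (L (t + 1)) s (h.action k t)) else L t s)

/-- The optimistic `Q`-function at time-step `t` of episode `k`: the estimates and the empirical
model are those available at the end of the previous episode. -/
def qBar (H : ℕ) (ℓ : ℝ) (h : History S A) (k t : ℕ) (s : S) (a : A) : ℝ :=
  qUpper H ℓ h k ((estimates H ℓ h k).1 (t + 1)) ((estimates H ℓ h k).2 (t + 1)) s a

end EulerGP

/-- An execution of `K` episodes of EULER with greedy policies, with confidence parameter `δ`, in
the process `M`, on a probability space `(Ω, P)`.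

`info k t` is the information available at time-step `t` of episode `k` before acting; it
contains all earlier states, actions and rewards and the current state, so `info k 0` is the
information at the end of the previous episode together with the initial state of episode `k`.
The initial states are arbitrary (they may depend on the past). The policy of episode `k` is
determined by `info k 0` and greedy with respect to the optimistic `Q`-function; ties are broken
in any such way. Given `info k t`, the reward has law `R(s, a)` and the next state has law
`p(· | s, a)`; no assumption is made on their joint law. -/
structure EulerGPRun {S A Ω : Type*} [Fintype S] [DecidableEq S] [Fintype A] [DecidableEq A]
    [mΩ : MeasurableSpace Ω] (M : FiniteMDP S A) (K : ℕ) (δ : ℝ) (P : Measure Ω) where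
  state : ℕ → ℕ → Ω → S
  reward : ℕ → ℕ → Ω → ℝ
  policy : ℕ → Ω → DetPolicy S A
  info : ℕ → ℕ → MeasurableSpace Ω
  info_le : ∀ k t, info k t ≤ mΩ
  info_step : ∀ k t, t < M.H → info k t ≤ info k (t + 1)
  info_next : ∀ k, info k M.H ≤ info (k + 1) 0
  state_meas : ∀ k < K, ∀ t ≤ M.H, Measurable[info k t, ⊤] (state k t)
  reward_meas : ∀ k < K, ∀ t < M.H, Measurable[info k (t + 1)] (reward k t)
  policy_meas : ∀ k < K, ∀ t < M.H, ∀ s, Measurable[info k 0, ⊤] (fun ω => policy k ω t s)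
  reward_law : ∀ k < K, ∀ t < M.H, ∀ B : Set ℝ, MeasurableSet B →
    P⟦reward k t ⁻¹' B | info k t⟧
      =ᵐ[P] fun ω => (M.R (state k t ω) (policy k ω t (state k t ω))).real B
  state_law : ∀ k < K, ∀ t < M.H, ∀ s' : S,
    P⟦state k (t + 1) ⁻¹' {s'} | info k t⟧
      =ᵐ[P] fun ω => M.p (state k t ω) (policy k ω t (state k t ω)) s'
  greedy : ∀ k < K, ∀ ω, ∀ t < M.H, ∀ s a,
    let h : History S A :=
      { state := fun j u => state j u ω
        action := fun j u => policy j ω u (state j u ω)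
        reward := fun j u => reward j u ω }
    EulerGP.qBar M.H (logFactor S A M.H K δ) h k t s a
      ≤ EulerGP.qBar M.H (logFactor S A M.H K δ) h k t s (policy k ω t s)

/-- The regret of the first `k` episodes: the sum over these episodes of the optimal value of the
initial state minus its value under the policy of the episode. -/
def EulerGPRun.regret {S A Ω : Type*} [Fintype S] [DecidableEq S] [Fintype A] [DecidableEq A]
    [MeasurableSpace Ω] {M : FiniteMDP S A} {K : ℕ} {δ : ℝ} {P : Measure Ω}
    (run : EulerGPRun M K δ P) (k : ℕ) (ω : Ω) : ℝ :=
  ∑ j ∈ Finset.range k,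
    (M.optValue 0 (run.state j 0 ω) - M.value (run.policy j ω) 0 (run.state j 0 ω))

/-- The lower order term `√S · S · A · H² · (√S + √H)`. -/
def lowerOrder (S A : Type*) [Fintype S] [Fintype A] (H : ℕ) : ℝ :=
  √(Fintype.card S : ℝ) * Fintype.card S * Fintype.card A * (H : ℝ) ^ 2
    * (√(Fintype.card S : ℝ) + √(H : ℝ))

end

noncomputable section

/-! ### Exponential inequalities -/

/-! On a good event the upper estimates dominate the optimal values, so the regret is at most the
sum over the episodes of the gap `U - V^π` at the initial states. The proof bounds such sums of
gaps.

Concentration. For increments with conditional mean zero and `|Y| ≤ 1`, the inequality `exp (λ Y - ψ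
Y²) ≤ 1 + λ Y` makes `exp (λ ∑ Y - ψ ∑ Y²)` a supermartingale, and a maximal inequality bounds it at
all times at once. A grid of about `√(K H ℓ)` slopes turns this into an empirical Bernstein
inequality whose constants fit inside the bonuses of the algorithm (`le_empirical_bernstein`).
Optimism and pessimism follow (`brackets_of_isAccurate`). The logarithm `ℓ` can pay for the grid
only if `K ≥ 9 H ℓ`; for smaller `K` the trivial bound `K H` is already of lower order.

Recursion. A step updates one state, by one backup with old estimates. Hence the old gap is the
decrease of the estimate (these decreases add up to at most `S H²`), plus a bonus, plus `1 + O(1 /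
H)` times the conditional mean of the next gap. Factors `1 + 7 / H` compound to a constant. The
martingale error is bounded relative to the sums of the gaps themselves and absorbed, so it costs no
`√T` (`PathBound.sum_le`). The squared widths `(U - L)²` obey the same kind of recursion, and their
sum is of lower order (`epSum_width_le`).

Variance. By Cauchy-Schwarz the bonuses add up to `√(S A)` times the square root of the variances of
the rewards and of `V*` along the path, up to logarithms. These are bounded by `ℚ* T` directly, or
by passing from `V*` to `V^π` and using a pathwise law of total variance (`epSum_varValAt_le`),
which gives `k G²` or `H T`. The passage costs `H²` times the sum `D` of the gaps, so that `D` is at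
most main terms plus a multiple of `√(S A H² D)`; solving for `D` finishes the proof
(`le_of_self_bounding`). -/

lemma exp_mul_sub_le_one_add {l : ℝ} (hl0 : 0 ≤ l) (hl1 : l < 1) {y : ℝ} (hy : |y| ≤ 1) :
    Real.exp (l * y - l ^ 2 / (2 * (1 - l)) * y ^ 2) ≤ 1 + l * y := by
  obtain ⟨hy1, hy2⟩ := abs_le.mp hy
  have hpos : 0 < 1 + l * y := by nlinarith
  rw [← Real.le_log_iff_exp_le hpos]
  have h1l : 0 < 1 - l := by linarith
  rcases le_total 0 y with h | h
  · have h2 : 0 ≤ l * y := mul_nonneg hl0 h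
    -- For `z = l y ≥ 0`: `log (1 + z) ≥ 2 z / (z + 2) ≥ z - z² / 2`.
    have h3 := Real.le_log_one_add_of_nonneg h2
    refine le_trans ?_ h3
    have h5 : (l * y) ^ 2 / 2 ≤ l ^ 2 / (2 * (1 - l)) * y ^ 2 := by
      rw [div_mul_eq_mul_div, div_le_div_iff₀ (by norm_num) (by positivity)]
      nlinarith [sq_nonneg (l * y), mul_nonneg hl0 (sq_nonneg (l * y))]
    have h6 : l * y - (l * y) ^ 2 / 2 ≤ 2 * (l * y) / (l * y + 2) := by
      rw [le_div_iff₀ (by positivity)]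
      nlinarith [pow_nonneg h2 3]
    linarith
  · set t := (1 + l * y)⁻¹ with ht
    have htpos : 0 < t := by positivity
    have ht1 : 1 ≤ t := by
      rw [ht]; exact (one_le_inv₀ hpos).2 (by nlinarith)
    -- With `t = 1 / (1 + z) ≥ 1`, the bound `log t ≤ sinh (log t)` reads `log (1 + z) ≥ z - z² / (2
    -- (1 + z))`, and `1 + z ≥ 1 - l`.
    have h3 : Real.log t ≤ (t - t⁻¹) / 2 := by
      rw [← Real.sinh_log htpos]
      exact Real.self_le_sinh_iff.2 (Real.log_nonneg ht1)
    have h4 : Real.log (1 + l * y) = - Real.log t := by rw [ht, Real.log_inv]; ring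
    have h5 : (t - t⁻¹) / 2 = -(l * y) + (l * y) ^ 2 / (2 * (1 + l * y)) := by
      rw [ht]; field_simp; ring
    have h6 : (l * y) ^ 2 / (2 * (1 + l * y)) ≤ l ^ 2 / (2 * (1 - l)) * y ^ 2 := by
      rw [div_mul_eq_mul_div, mul_pow]
      apply div_le_div_of_nonneg_left (by positivity) (by positivity)
      nlinarith
    rw [h4]; linarith

lemma exp_mul_sub_sq_le_one_add {l : ℝ} (hl0 : 0 ≤ l) (hl1 : l ≤ 1 / 2) {y : ℝ} (hy : |y| ≤ 1) :
    Real.exp (l * y - l ^ 2 * y ^ 2) ≤ 1 + l * y := by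
  refine le_trans (Real.exp_le_exp.2 ?_) (exp_mul_sub_le_one_add hl0 (by linarith) hy)
  have : l ^ 2 / (2 * (1 - l)) ≤ l ^ 2 := div_le_self (by positivity) (by linarith)
  nlinarith [mul_le_mul_of_nonneg_right this (sq_nonneg y)]

/-- The general lemma gives the curvature `1 / 4` at slope `1 / 2`. The smaller `1 / 5` is what
produces the constant `10 / 3` for deviations above `1 / 2`. It is nearly sharp: at `y = -1`, `-0.7`
is compared with `log (1 / 2) = -0.693...`. -/
lemma exp_half_mul_sub_le_one_add {y : ℝ} (hy : |y| ≤ 1) :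
    Real.exp (1 / 2 * y - 1 / 5 * y ^ 2) ≤ 1 + 1 / 2 * y := by
  obtain ⟨hy1, hy2⟩ := abs_le.mp hy
  have hpos : 0 < 1 + 1 / 2 * y := by nlinarith
  rw [← Real.le_log_iff_exp_le hpos]
  rcases le_total 0 y with h | h
  · have h2 : 0 ≤ 1 / 2 * y := by linarith
    have h3 := Real.le_log_one_add_of_nonneg h2
    refine le_trans ?_ h3
    rw [le_div_iff₀ (by positivity)]
    nlinarith [mul_nonneg h (sq_nonneg y), sq_nonneg y]
  · obtain ⟨q, hq⟩ : ∃ q : ℝ, q = - (1 / 2 * y) := ⟨_, rfl⟩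
    have hq0 : 0 ≤ q := by linarith
    have hq1 : q ≤ 1 / 2 := by linarith
    -- The margin at `y = -1` is so small that eight terms of the series are used; those beyond the
    -- second order are bounded by `q² (1 / 2) ^ i`.
    have h3 := Real.abs_log_sub_add_sum_range_le (x := q) (by rw [abs_of_nonneg hq0]; linarith) 8
    rw [abs_of_nonneg hq0] at h3
    have h4 := (abs_le.mp h3).1
    simp only [Finset.sum_range_succ, Finset.sum_range_zero] at h4
    have hp : ∀ i : ℕ, q ^ (i + 2) ≤ q ^ 2 * (1 / 2) ^ i := by
      intro i
      rw [pow_add, mul_comm]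
      exact mul_le_mul_of_nonneg_left (pow_le_pow_left₀ hq0 hq1 i) (sq_nonneg q)
    have h9 : q ^ 9 / (1 - q) ≤ 2 * q ^ 9 := by
      rw [div_le_iff₀ (by linarith)]
      nlinarith [pow_nonneg hq0 9]
    have e1 := hp 1
    have e2 := hp 2
    have e3 := hp 3
    have e4 := hp 4
    have e5 := hp 5
    have e6 := hp 6
    have e7 := hp 7
    norm_num at h4 h9 e1 e2 e3 e4 e5 e6 e7
    have h1q : 1 + 1 / 2 * y = 1 - q := by linarith
    have hyq : y = -(2 * q) := by linarith
    rw [h1q, hyq]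
    nlinarith [sq_nonneg q]

/-! ### A time-uniform bound for exponential supermartingales -/

section Ville

variable {Ω : Type*}

/-- The running product of the factors `X i`, frozen once it has reached the level `c`. -/
def stoppedProd (c : ℝ) (X : ℕ → Ω → ℝ) : ℕ → Ω → ℝ
  | 0 => fun _ => 1
  | j + 1 => fun ω => stoppedProd c X j ω +
      (if c ≤ stoppedProd c X j ω then 0 else stoppedProd c X j ω) * (X j ω - 1)

lemma stoppedProd_nonneg {c : ℝ} {X : ℕ → Ω → ℝ} (hX : ∀ i ω, 0 ≤ X i ω) (j : ℕ) (ω : Ω) :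
    0 ≤ stoppedProd c X j ω := by
  induction j with
  | zero => simp [stoppedProd]
  | succ j ih =>
    simp only [stoppedProd]
    split_ifs
    · simpa using ih
    · have := mul_nonneg ih (hX j ω)
      linarith

/-- Once the product reaches `c` the frozen process no longer moves. The maximal inequality thus
reduces to Markov's inequality at the final time. -/
lemma stoppedProd_eq_or_le (c : ℝ) (X : ℕ → Ω → ℝ) (j : ℕ) (ω : Ω) :
    (stoppedProd c X j ω = ∏ i ∈ Finset.range j, X i ω ∧
      ∀ i < j, ∏ i' ∈ Finset.range i, X i' ω < c) ∨ c ≤ stoppedProd c X j ω := by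
  induction j with
  | zero => left; simp [stoppedProd]
  | succ j ih =>
    by_cases hc : c ≤ stoppedProd c X j ω
    · right; simp [stoppedProd, hc]
    · rcases ih with ⟨h1, h2⟩ | h
      · left
        refine ⟨?_, fun i hi => ?_⟩
        · simp only [stoppedProd, if_neg hc]
          rw [Finset.prod_range_succ, ← h1]; ring
        · rcases Nat.lt_succ_iff_lt_or_eq.mp hi with hi | rfl
          · exact h2 i hi
          · rw [← h1]; exact not_le.mp hc
      · exact absurd h hc

lemma le_stoppedProd_of_exists {c : ℝ} {X : ℕ → Ω → ℝ} {n : ℕ} {ω : Ω}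
    (h : ∃ j ≤ n, c ≤ ∏ i ∈ Finset.range j, X i ω) : c ≤ stoppedProd c X n ω := by
  obtain ⟨j, hj, hcj⟩ := h
  rcases stoppedProd_eq_or_le c X n ω with ⟨h1, h2⟩ | h
  · rcases hj.lt_or_eq with hj | rfl
    · exact absurd hcj (not_le.mpr (h2 j hj))
    · rwa [h1]
  · exact h

variable [mΩ : MeasurableSpace Ω] {P : Measure Ω} [IsProbabilityMeasure P]

lemma integral_mul_eq_zero_of_condExp {m : MeasurableSpace Ω} (hm : m ≤ mΩ) {W Y : Ω → ℝ}
    (hW : Measurable[m] W) (hWY : Integrable (fun ω => W ω * Y ω) P) (hY : Integrable Y P)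
    (hc : P[Y | m] =ᵐ[P] 0) : ∫ ω, W ω * Y ω ∂P = 0 := by
  rw [← integral_condExp hm]
  have h1 := condExp_mul_of_stronglyMeasurable_left (μ := P) (m := m) (f := W) (g := Y)
    hW.stronglyMeasurable hWY hY
  rw [show (fun ω => W ω * Y ω) = W * Y from rfl, integral_congr_ae h1]
  have : W * P[Y | m] =ᵐ[P] 0 := by
    filter_upwards [hc] with ω h
    simp [h]
  rw [integral_congr_ae this]; simp

/-- A sequence with conditional means zero, bounded by one, satisfies a time-uniform exponential
bound that is normalised by the sum of its squares. -/
theorem measureReal_exists_lt_le_exp {F : ℕ → MeasurableSpace Ω} (hF : Monotone F)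
    (hle : ∀ i, F i ≤ mΩ) {Y : ℕ → Ω → ℝ} (hY : ∀ i, Measurable[F (i + 1)] (Y i))
    (hb : ∀ i, ∀ᵐ ω ∂P, |Y i ω| ≤ 1) (hc : ∀ i, P[Y i | F i] =ᵐ[P] 0) {l ψ : ℝ}
    (hψ : ∀ y : ℝ, |y| ≤ 1 → Real.exp (l * y - ψ * y ^ 2) ≤ 1 + l * y) (x : ℝ) (n : ℕ) :
    P.real {ω | ∃ j ≤ n, x < l * ∑ i ∈ Finset.range j, Y i ω
      - ψ * ∑ i ∈ Finset.range j, Y i ω ^ 2} ≤ Real.exp (-x) := by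
  set X : ℕ → Ω → ℝ := fun i ω => Real.exp (l * Y i ω - ψ * Y i ω ^ 2) with hX
  set c := Real.exp x with hcdef
  have hX0 : ∀ i ω, 0 ≤ X i ω := fun i ω => (Real.exp_pos _).le
  have hXm : ∀ i, Measurable[F (i + 1)] (X i) := by
    intro i
    have := hY i
    exact Real.measurable_exp.comp ((this.const_mul l).sub ((this.pow_const 2).const_mul ψ))
  have hYint : ∀ i, Integrable (Y i) P := fun i =>
    Integrable.of_bound ((hY i).mono (hle _) le_rfl).aestronglyMeasurable 1
      (by simpa [Real.norm_eq_abs] using hb i)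
  set N := stoppedProd c X with hN
  have hN0 : ∀ j ω, 0 ≤ N j ω := fun j ω => stoppedProd_nonneg hX0 j ω
  have hNm : ∀ j, Measurable[F j] (N j) := by
    intro j
    induction j with
    | zero => simp only [hN, stoppedProd]; exact measurable_const
    | succ j ih =>
      have ih' : Measurable[F (j + 1)] (N j) := ih.mono (hF (Nat.le_succ j)) le_rfl
      simp only [hN, stoppedProd]
      refine ih'.add (Measurable.mul ?_ ((hXm j).sub_const 1))
      exact Measurable.ite (ih' measurableSet_Ici) measurable_const ih'
  -- The increments of the frozen product are `W (X - 1)`. The weight `W` is bounded by `c`, which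
  -- gives all the integrability needed.
  set W : ℕ → Ω → ℝ := fun j ω => if c ≤ N j ω then 0 else N j ω with hW
  have hWm : ∀ j, Measurable[F j] (W j) := fun j =>
    Measurable.ite (hNm j measurableSet_Ici) measurable_const (hNm j)
  have hW0 : ∀ j ω, 0 ≤ W j ω := by
    intro j ω; simp only [hW]; split_ifs; exacts [le_rfl, hN0 j ω]
  have hWc : ∀ j ω, W j ω ≤ c := by
    intro j ω; simp only [hW]; split_ifs with h; exacts [(Real.exp_pos x).le, (not_le.mp h).le]
  have hWb : ∀ j, ∀ᵐ ω ∂P, ‖W j ω‖ ≤ c := fun j => Filter.Eventually.of_forall fun ω => by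
    rw [Real.norm_eq_abs, abs_of_nonneg (hW0 j ω)]; exact hWc j ω
  have hWmm : ∀ j, AEStronglyMeasurable (W j) P := fun j =>
    ((hWm j).mono (hle _) le_rfl).aestronglyMeasurable
  have hXb : ∀ j, ∀ᵐ ω ∂P, ‖X j ω - 1‖ ≤ |l| + 1 := by
    intro j
    filter_upwards [hb j] with ω h
    have h1 := hψ _ h
    have h2 := hX0 j ω
    have h3 : l * Y j ω ≤ |l| := (le_abs_self _).trans (by
      rw [abs_mul]; exact mul_le_of_le_one_right (abs_nonneg _) h)
    rw [Real.norm_eq_abs, abs_le]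
    constructor
    · have := abs_nonneg l; linarith
    · simp only [hX]; linarith
  have hWX : ∀ j, Integrable (fun ω => W j ω * (X j ω - 1)) P := fun j =>
    (Integrable.of_bound (((hXm j).mono (hle _) le_rfl).sub_const 1).aestronglyMeasurable _
      (hXb j)).bdd_mul (hWmm j) (hWb j)
  have hWY : ∀ j, Integrable (fun ω => W j ω * Y j ω) P := fun j =>
    (hYint j).bdd_mul (hWmm j) (hWb j)
  have hNint : ∀ j, Integrable (N j) P := by
    intro j
    induction j with
    | zero => simp only [hN, stoppedProd]; exact integrable_const _
    | succ j ih => exact ih.add (hWX j)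
  have hNle : ∀ j, ∫ ω, N j ω ∂P ≤ 1 := by
    intro j
    induction j with
    | zero => simp [hN, stoppedProd]
    | succ j ih =>
      have h1 : ∫ ω, N (j + 1) ω ∂P = ∫ ω, N j ω ∂P + ∫ ω, W j ω * (X j ω - 1) ∂P :=
        integral_add (hNint j) (hWX j)
      -- The hypothesis on `ψ` says `X - 1 ≤ l Y`, and `W Y` has integral zero.
      have h2 : ∫ ω, W j ω * (X j ω - 1) ∂P ≤ ∫ ω, l * (W j ω * Y j ω) ∂P := by
        apply integral_mono_ae (hWX j) ((hWY j).const_mul l)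
        filter_upwards [hb j] with ω h
        have h3 := hψ _ h
        have h4 := hW0 j ω
        calc W j ω * (X j ω - 1) ≤ W j ω * (l * Y j ω) :=
              mul_le_mul_of_nonneg_left (by simp only [hX]; linarith) h4
          _ = l * (W j ω * Y j ω) := by ring
      rw [integral_const_mul, integral_mul_eq_zero_of_condExp (hle j) (hWm j) (hWY j) (hYint j)
        (hc j)] at h2
      linarith
  have hsub : {ω | ∃ j ≤ n, x < l * ∑ i ∈ Finset.range j, Y i ω
      - ψ * ∑ i ∈ Finset.range j, Y i ω ^ 2} ⊆ {ω | c ≤ N n ω} := by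
    rintro ω ⟨j, hj, h⟩
    refine le_stoppedProd_of_exists ⟨j, hj, ?_⟩
    simp only [hX]
    rw [← Real.exp_sum, hcdef, Real.exp_le_exp, Finset.sum_sub_distrib, ← Finset.mul_sum,
      ← Finset.mul_sum]
    exact h.le
  have hM := mul_meas_ge_le_integral_of_nonneg
    (Filter.Eventually.of_forall (hN0 n)) (hNint n) c
  have hP : P.real {ω | c ≤ N n ω} ≤ Real.exp (-x) := by
    rw [Real.exp_neg, ← hcdef, ← one_div, le_div_iff₀' (Real.exp_pos x)]
    exact hM.trans (hNle n)
  exact (measureReal_mono hsub).trans hP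

end Ville

/-! ### From exponential bounds to an empirical Bernstein inequality -/

/-- With the slope `λ = u / (1 + u)` the curvature `λ² / (2 (1 - λ))` equals `λ u / 2`, and `1 / λ =
1 / u + 1`; divide by `λ`. -/
lemma le_of_grid_bound {n L s w u : ℝ} (hu : 0 < u)
    (h : u / (1 + u) * (n * s) ≤ (u / (1 + u)) ^ 2 / (2 * (1 - u / (1 + u))) * (n * w) + L) :
    n * s ≤ u / 2 * (n * w) + L / u + L := by
  have h1 : (u / (1 + u)) ^ 2 / (2 * (1 - u / (1 + u))) = u / (1 + u) * (u / 2) := by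
    have : (1 : ℝ) + u ≠ 0 := by positivity
    have h2 : 1 - u / (1 + u) = 1 / (1 + u) := by field_simp; ring
    rw [h2]; field_simp
  rw [h1] at h
  have h3 : L = u / (1 + u) * (L / u + L) := by field_simp
  have h4 : u / (1 + u) * (n * s) ≤ u / (1 + u) * (u / 2 * (n * w) + L / u + L) := by
    calc _ ≤ _ := h
      _ = u / (1 + u) * (u / 2 * (n * w)) + u / (1 + u) * (L / u + L) := by
          rw [← h3]; ring
      _ = _ := by ring
  exact le_of_mul_le_mul_left h4 (by positivity)

/-- The optimisation over the grid `u = j / N`. -/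
lemma le_sqrt_add_of_grid {n L s w : ℝ} {N : ℕ} (hn : 0 < n) (hL : 2 ≤ L)
    (hN : n * L ≤ (N : ℝ) ^ 2) (hw1 : w ≤ 1)
    (h1 : ∀ j ∈ Finset.Icc 1 N, ((j : ℝ) / N) / (1 + (j : ℝ) / N) * (n * s) ≤
      (((j : ℝ) / N) / (1 + (j : ℝ) / N)) ^ 2 / (2 * (1 - ((j : ℝ) / N) / (1 + (j : ℝ) / N)))
        * (n * w) + (L - 1)) :
    n * s ≤ 3 * L ∨ n * s ≤ √(2 * L * (n * w)) + L := by
  have hNpos : (0 : ℝ) < N := by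
    rcases Nat.eq_zero_or_pos N with h | h
    · subst h; norm_num at hN; nlinarith
    · exact_mod_cast h
  have hN1 : 1 ≤ N := by exact_mod_cast hNpos
  -- For a small second moment the ideal `u` lies beyond the grid, and its endpoint `u = 1` gives `3
  -- L`.
  by_cases hcase : n * w ≤ 2 * (L - 1)
  · left
    have := h1 N (Finset.mem_Icc.2 ⟨hN1, le_rfl⟩)
    rw [div_self hNpos.ne'] at this
    have := le_of_grid_bound one_pos this
    linarith
  · right
    push Not at hcase
    have hnw : 0 < n * w := by linarith
    -- The minimiser of `u n w / 2 + (L - 1) / u`, rounded up to the grid below.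
    set us := √(2 * (L - 1) / (n * w)) with hus
    have hus0 : 0 < us := Real.sqrt_pos.2 (div_pos (by linarith) hnw)
    have hus2 : us ^ 2 = 2 * (L - 1) / (n * w) :=
      Real.sq_sqrt (div_nonneg (by linarith) hnw.le)
    have hus1 : us < 1 := by
      have : us ^ 2 < 1 := by rw [hus2, div_lt_one hnw]; linarith
      nlinarith
    set j := ⌈us * N⌉₊ with hj
    have hj1 : 1 ≤ j := Nat.one_le_ceil_iff.2 (by positivity)
    have hjN : j ≤ N := Nat.ceil_le.2 (by nlinarith)
    have hjlow : us * N ≤ j := Nat.le_ceil _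
    have hjup : (j : ℝ) < us * N + 1 := Nat.ceil_lt_add_one (by positivity)
    have hb := le_of_grid_bound (by positivity) (h1 j (Finset.mem_Icc.2 ⟨hj1, hjN⟩))
    have hu1 : us ≤ (j : ℝ) / N := by rw [le_div_iff₀ hNpos]; exact hjlow
    have hu2 : (j : ℝ) / N ≤ us + 1 / N := by
      rw [div_le_iff₀ hNpos, add_mul, one_div_mul_cancel hNpos.ne']; exact hjup.le
    have h3 : (L - 1) / ((j : ℝ) / N) ≤ (L - 1) / us :=
      div_le_div_of_nonneg_left (by linarith) hus0 hu1
    set a := √(n * w) with ha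
    have ha0 : 0 < a := Real.sqrt_pos.2 hnw
    have ha2 : a ^ 2 = n * w := Real.sq_sqrt hnw.le
    set b := √(2 * (L - 1)) with hb'
    have hb0 : 0 < b := Real.sqrt_pos.2 (by linarith)
    have hb2 : b ^ 2 = 2 * (L - 1) := Real.sq_sqrt (by linarith)
    have husab : us = b / a := by rw [hus, Real.sqrt_div (by linarith)]
    have h4 : (L - 1) / us = b * a / 2 := by
      rw [husab]; field_simp; nlinarith
    have h5 : us / 2 * (n * w) = b * a / 2 := by
      rw [husab, ← ha2]; field_simp
    have h6 : (j : ℝ) / N / 2 * (n * w) ≤ b * a / 2 + a ^ 2 / (2 * N) := by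
      calc (j : ℝ) / N / 2 * (n * w) ≤ (us + 1 / N) / 2 * (n * w) := by gcongr
        _ = us / 2 * (n * w) + a ^ 2 / (2 * N) := by rw [ha2]; field_simp
        _ = _ := by rw [h5]
    set g := √(2 * L) with hg
    have hg0 : 0 < g := Real.sqrt_pos.2 (by linarith)
    have hg2 : g ^ 2 = 2 * L := Real.sq_sqrt (by linarith)
    have h7 : √(2 * L * (n * w)) = g * a := Real.sqrt_mul (by linarith) _
    have hbg : b ≤ g := Real.sqrt_le_sqrt (by linarith)
    -- The rounding error `a² / (2 N)` is paid by the difference between `√(2 L)` and `√(2 (L -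
    -- 1))`. This is why the grid bounds are assumed with `L - 1`.
    have h8 : 1 ≤ (g - b) * g := by
      have h11 : (g - b) * (g + b) = 2 := by linear_combination hg2 - hb2
      have h12 : (g - b) * b ≤ (g - b) * g := mul_le_mul_of_nonneg_left hbg (by linarith)
      linarith
    have h9 : a * g ≤ 2 * N := by
      have : (a * g) ^ 2 ≤ (2 * N) ^ 2 := by
        rw [mul_pow, ha2, hg2]
        have h11 : n * L * w ≤ n * L * 1 :=
          mul_le_mul_of_nonneg_left hw1 (mul_nonneg hn.le (by linarith))
        have h12 := sq_nonneg (N : ℝ)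
        linarith
      exact le_of_sq_le_sq this (by positivity)
    have h10 : a ^ 2 / (2 * N) ≤ a * (g - b) := by
      rw [div_le_iff₀ (by positivity)]
      have h11 : a * g * (a * (g - b)) ≤ 2 * N * (a * (g - b)) :=
        mul_le_mul_of_nonneg_right h9 (mul_nonneg ha0.le (by linarith))
      have h12 : a ^ 2 * 1 ≤ a ^ 2 * ((g - b) * g) := mul_le_mul_of_nonneg_left h8 (sq_nonneg a)
      linarith
    rw [h7]
    linarith [h3, h4, h6, h10, hb]

/-- Here `s` is the deviation of the mean and `v` the empirical variance, so `v + s²` is the mean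
square about the true mean; the term `s²` has to be removed. If `s < 1 / 2`, the grid gives `s ≤ 3
e` or `(s - e)² ≤ 2 e (v + s²)` with `e = L / n`, and the latter is solved for `s`. If `s ≥ 1 / 2`,
then `v + s² ≤ s`, and the bound at slope `1 / 2` leaves `3 n s / 10 ≤ L - 1`. -/
theorem le_empirical_bernstein {n L s v : ℝ} {N : ℕ} (hn : 0 < n) (hL : 2 ≤ L)
    (hN : n * L ≤ (N : ℝ) ^ 2) (hv : 0 ≤ v) (hw1 : v + s ^ 2 ≤ 1)
    (hvs : 1 / 2 ≤ s → v ≤ s * (1 - s))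
    (h1 : ∀ j ∈ Finset.Icc 1 N, ((j : ℝ) / N) / (1 + (j : ℝ) / N) * (n * s) ≤
      (((j : ℝ) / N) / (1 + (j : ℝ) / N)) ^ 2 / (2 * (1 - ((j : ℝ) / N) / (1 + (j : ℝ) / N)))
        * (n * (v + s ^ 2)) + (L - 1))
    (h2 : 1 / 2 * (n * s) ≤ 1 / 5 * (n * (v + s ^ 2)) + (L - 1)) :
    s ≤ √(2 * v * L / n) + 10 / 3 * (L / n) := by
  have hLn : 0 < L / n := div_pos (by linarith) hn
  have hsq := Real.sqrt_nonneg (2 * v * L / n)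
  by_cases hs : 1 / 2 ≤ s
  · have h3 := hvs hs
    have h4 : s ≤ 10 / 3 * (L / n) := by
      rw [mul_div_assoc', le_div_iff₀ hn]
      nlinarith [mul_le_mul_of_nonneg_left h3 hn.le]
    linarith
  · push Not at hs
    set e := L / n with he
    have hLe : L = n * e := by rw [he]; field_simp
    have ha2 : √(2 * v * L / n) ^ 2 = 2 * v * e := by
      rw [Real.sq_sqrt (by positivity), he]; ring
    set a := √(2 * v * L / n) with ha
    rcases le_sqrt_add_of_grid hn hL hN hw1 h1 with h | h
    · have : s ≤ 3 * e := by
        rw [he, mul_div_assoc', le_div_iff₀ hn]; linarith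
      linarith
    · by_contra hcon
      push Not at hcon
      have h3 : 2 * L * (n * (v + s ^ 2)) = (n) ^ 2 * (2 * e * (v + s ^ 2)) := by
        rw [hLe]; ring
      rw [h3, Real.sqrt_mul (by positivity), Real.sqrt_sq hn.le] at h
      have h4 : s - e ≤ √(2 * e * (v + s ^ 2)) := by
        have : n * s ≤ n * (√(2 * e * (v + s ^ 2)) + e) := by nlinarith
        have := le_of_mul_le_mul_left this hn
        linarith
      have h5 : 0 ≤ s - e := by linarith
      have h6 : (s - e) ^ 2 ≤ 2 * e * (v + s ^ 2) := by
        have := pow_le_pow_left₀ h5 h4 2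
        rwa [Real.sq_sqrt (by positivity)] at this
      -- If `s > a + 10 e / 3`, then `s - e - a ≥ 7 e / 3` and `s - e ≥ 7 s / 10`. The product is at
      -- least `49 e s / 30`, but at most `2 e s² < e s`.
      have h7 : (7 / 3) * e * (7 / 10 * s) ≤ (s - e - a) * (s - e + a) := by
        apply mul_le_mul <;> nlinarith
      have hspos : 0 < s := by linarith
      have h8 : 0 < e * s * (1 / 2 - s) :=
        mul_pos (mul_pos hLn hspos) (by linarith)
      have h9 : (s - e - a) * (s - e + a) = (s - e) ^ 2 - a ^ 2 := by ring
      have h10 := mul_pos hLn hspos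
      linarith

/-! ### Weighted means and variances -/

section Weights

variable {S : Type*} [Fintype S]

lemma meanOf_mono {p V W : S → ℝ} (hp : ∀ x, 0 ≤ p x) (h : ∀ x, V x ≤ W x) :
    meanOf p V ≤ meanOf p W :=
  Finset.sum_le_sum fun x _ => mul_le_mul_of_nonneg_left (h x) (hp x)

lemma meanOf_nonneg {p V : S → ℝ} (hp : ∀ x, 0 ≤ p x) (h : ∀ x, 0 ≤ V x) : 0 ≤ meanOf p V :=
  Finset.sum_nonneg fun x _ => mul_nonneg (hp x) (h x)

lemma meanOf_sub (p V W : S → ℝ) :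
    meanOf p (fun x => V x - W x) = meanOf p V - meanOf p W := by
  simp [meanOf, mul_sub]

lemma meanOf_const_mul (p V : S → ℝ) (c : ℝ) :
    meanOf p (fun x => c * V x) = c * meanOf p V := by
  simp only [meanOf, Finset.mul_sum]
  exact Finset.sum_congr rfl fun x _ => by ring

lemma meanOf_le {p V : S → ℝ} (hp : ∀ x, 0 ≤ p x) (hp1 : ∑ x, p x ≤ 1) {b : ℝ} (hb : 0 ≤ b)
    (h : ∀ x, V x ≤ b) : meanOf p V ≤ b := by
  calc meanOf p V ≤ meanOf p (fun _ => b) := meanOf_mono hp h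
    _ = (∑ x, p x) * b := by simp [meanOf, Finset.sum_mul]
    _ ≤ b := mul_le_of_le_one_left hb hp1

lemma varOf_nonneg {p : S → ℝ} (hp : ∀ x, 0 ≤ p x) (V : S → ℝ) : 0 ≤ varOf p V :=
  Finset.sum_nonneg fun x _ => mul_nonneg (hp x) (sq_nonneg _)

lemma varOf_eq_meanOf_sq_sub {p : S → ℝ} (hp : ∑ x, p x = 1) (V : S → ℝ) (c : ℝ) :
    varOf p V = meanOf p (fun x => (V x - c) ^ 2) - (meanOf p V - c) ^ 2 := by
  have h1 : meanOf p (fun x => (V x - c) ^ 2) =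
      varOf p V + 2 * (meanOf p V - c) * (meanOf p V - (∑ x, p x) * meanOf p V)
        + (∑ x, p x) * (meanOf p V - c) ^ 2 := by
    have : (meanOf p V - (∑ x, p x) * meanOf p V) = ∑ x, p x * (V x - meanOf p V) := by
      simp [mul_sub, Finset.sum_mul, meanOf]
    rw [this, varOf, Finset.mul_sum, Finset.sum_mul, ← Finset.sum_add_distrib,
      ← Finset.sum_add_distrib, meanOf]
    exact Finset.sum_congr rfl fun x _ => by ring
  rw [h1, hp]; ring

lemma varOf_eq {p : S → ℝ} (hp : ∑ x, p x = 1) (V : S → ℝ) :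
    varOf p V = meanOf p (fun x => V x ^ 2) - meanOf p V ^ 2 := by
  simpa using varOf_eq_meanOf_sq_sub hp V 0

lemma varOf_le_meanOf_sq {p : S → ℝ} (hp : ∑ x, p x = 1) (V : S → ℝ) (c : ℝ) :
    varOf p V ≤ meanOf p (fun x => (V x - c) ^ 2) := by
  rw [varOf_eq_meanOf_sq_sub hp V c]
  linarith [sq_nonneg (meanOf p V - c)]

/-- Minkowski's inequality, from the Euclidean norm of the vectors scaled by `√p`. -/
lemma sqrt_sum_mul_sq_add_le {p : S → ℝ} (hp : ∀ x, 0 ≤ p x) (V W : S → ℝ) :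
    √(∑ x, p x * (V x + W x) ^ 2) ≤ √(∑ x, p x * V x ^ 2) + √(∑ x, p x * W x ^ 2) := by
  have h := norm_add_le (WithLp.toLp 2 fun x => √(p x) * V x : EuclideanSpace ℝ S)
    (WithLp.toLp 2 fun x => √(p x) * W x)
  simp only [EuclideanSpace.norm_eq, PiLp.add_apply, Real.norm_eq_abs, sq_abs] at h
  have e : ∀ U : S → ℝ, ∑ x, (√(p x) * U x) ^ 2 = ∑ x, p x * U x ^ 2 := fun U =>
    Finset.sum_congr rfl fun x _ => by rw [mul_pow, Real.sq_sqrt (hp x)]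
  have e2 := e (fun x => V x + W x)
  simp only [mul_add] at e2
  rw [e V, e W, e2] at h
  exact h

lemma norm2Of_sq {p : S → ℝ} (hp : ∀ x, 0 ≤ p x) (V : S → ℝ) :
    norm2Of p V ^ 2 = meanOf p (fun x => V x ^ 2) :=
  Real.sq_sqrt (Finset.sum_nonneg fun x _ => mul_nonneg (hp x) (sq_nonneg _))

lemma sqrt_varOf_le_norm2Of {p : S → ℝ} (hp : ∑ x, p x = 1) (V : S → ℝ) :
    √(varOf p V) ≤ norm2Of p V := by
  have := varOf_le_meanOf_sq hp V 0
  simp only [sub_zero] at this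
  exact Real.sqrt_le_sqrt this

lemma norm2Of_mono {p V W : S → ℝ} (hp : ∀ x, 0 ≤ p x) (h : ∀ x, |V x| ≤ |W x|) :
    norm2Of p V ≤ norm2Of p W :=
  Real.sqrt_le_sqrt (Finset.sum_le_sum fun x _ =>
    mul_le_mul_of_nonneg_left (sq_le_sq.2 (h x)) (hp x))

/-- The standard deviation is a seminorm, dominated by `‖·‖_{2,p}`. -/
lemma sqrt_varOf_le_add_norm2Of {p : S → ℝ} (hp : ∀ x, 0 ≤ p x) (hp1 : ∑ x, p x = 1)
    (V W : S → ℝ) : √(varOf p V) ≤ √(varOf p W) + norm2Of p (fun x => V x - W x) := by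
  have h := sqrt_sum_mul_sq_add_le hp (fun x => W x - meanOf p W)
    (fun x => (V x - W x) - meanOf p (fun x => V x - W x))
  have e : (∑ x, p x * ((W x - meanOf p W) + ((V x - W x) - meanOf p (fun x => V x - W x))) ^ 2)
      = varOf p V := by
    rw [meanOf_sub]
    exact Finset.sum_congr rfl fun x _ => by ring
  rw [e] at h
  exact h.trans (add_le_add le_rfl (sqrt_varOf_le_norm2Of hp1 _))

lemma varOf_le_two_mul {p : S → ℝ} (hp : ∀ x, 0 ≤ p x) (hp1 : ∑ x, p x = 1) (V W : S → ℝ) :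
    varOf p V ≤ 2 * varOf p W + 2 * meanOf p (fun x => (V x - W x) ^ 2) := by
  have h1 := sqrt_varOf_le_add_norm2Of hp hp1 V W
  have h2 := Real.sq_sqrt (varOf_nonneg hp V)
  have h3 := Real.sq_sqrt (varOf_nonneg hp W)
  have h4 := norm2Of_sq hp (fun x => V x - W x)
  have h5 := pow_le_pow_left₀ (Real.sqrt_nonneg _) h1 2
  rw [← h4]
  nlinarith [sq_nonneg (√(varOf p W) - norm2Of p (fun x => V x - W x))]

end Weights

/-! ### Bellman equations -/

namespace FiniteMDP

variable {S A : Type*} [Fintype S]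

lemma p_nonneg (M : FiniteMDP S A) (s : S) (a : A) (x : S) : 0 ≤ M.p s a x := (M.p_mem s a).1 x

lemma p_sum (M : FiniteMDP S A) (s : S) (a : A) : ∑ x, M.p s a x = 1 := (M.p_mem s a).2

lemma p_le_one (M : FiniteMDP S A) (s : S) (a : A) (x : S) : M.p s a x ≤ 1 := by
  rw [← M.p_sum s a]
  exact Finset.single_le_sum (fun y _ => M.p_nonneg s a y) (Finset.mem_univ x)

lemma integrable_of_continuous (M : FiniteMDP S A) (s : S) (a : A) {f : ℝ → ℝ}
    (hf : Continuous f) : Integrable f (M.R s a) := by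
  have := M.R_prob s a
  obtain ⟨C, hC⟩ := (isCompact_Icc (a := (0 : ℝ)) (b := 1)).exists_bound_of_continuousOn
    hf.continuousOn
  refine Integrable.of_bound hf.aestronglyMeasurable C ?_
  filter_upwards [M.R_mem s a] with x hx using hC x hx

lemma r_nonneg (M : FiniteMDP S A) (s : S) (a : A) : 0 ≤ M.r s a := by
  apply integral_nonneg_of_ae
  filter_upwards [M.R_mem s a] with x hx using hx.1

lemma r_le_one (M : FiniteMDP S A) (s : S) (a : A) : M.r s a ≤ 1 := by
  have := M.R_prob s a
  calc M.r s a ≤ ∫ _, (1 : ℝ) ∂(M.R s a) := by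
        apply integral_mono_ae (M.integrable_of_continuous s a continuous_id)
          (integrable_const _)
        filter_upwards [M.R_mem s a] with x hx using hx.2
    _ = 1 := by simp

lemma varR_eq (M : FiniteMDP S A) (s : S) (a : A) :
    M.varR s a = ∫ x, (x - M.r s a) ^ 2 ∂(M.R s a) := by
  have := M.R_prob s a
  rw [varR, variance_eq_integral aemeasurable_id', r]

lemma varR_nonneg (M : FiniteMDP S A) (s : S) (a : A) : 0 ≤ M.varR s a := variance_nonneg _ _

lemma varR_le_integral_sq (M : FiniteMDP S A) (s : S) (a : A) :
    M.varR s a ≤ ∫ x, x ^ 2 ∂(M.R s a) := by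
  have := M.R_prob s a
  exact variance_le_expectation_sq aestronglyMeasurable_id

lemma integral_sq_le_one (M : FiniteMDP S A) (s : S) (a : A) : ∫ x, x ^ 2 ∂(M.R s a) ≤ 1 := by
  have := M.R_prob s a
  calc ∫ x, x ^ 2 ∂(M.R s a) ≤ ∫ _, (1 : ℝ) ∂(M.R s a) := by
        apply integral_mono_ae (M.integrable_of_continuous s a (continuous_pow 2))
          (integrable_const _)
        filter_upwards [M.R_mem s a] with x hx
        exact pow_le_one₀ hx.1 hx.2
    _ = 1 := by simp

lemma varR_le_one (M : FiniteMDP S A) (s : S) (a : A) : M.varR s a ≤ 1 :=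
  (M.varR_le_integral_sq s a).trans (M.integral_sq_le_one s a)

section Backward

/-- The optimal values by backward recursion, `n` time-steps before the end. -/
def backwardValue (M : FiniteMDP S A) : ℕ → S → ℝ
  | 0 => fun _ => 0
  | n + 1 => fun s => ⨆ a, (M.r s a + meanOf (M.p s a) (backwardValue M n))

variable [Finite A]

lemma le_backwardValue_succ (M : FiniteMDP S A) (n : ℕ) (s : S) (a : A) :
    M.r s a + meanOf (M.p s a) (M.backwardValue n) ≤ M.backwardValue (n + 1) s :=
  le_ciSup (f := fun a => M.r s a + meanOf (M.p s a) (M.backwardValue n))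
    (Set.finite_range _).bddAbove a

lemma exists_backwardValue_succ [Nonempty A] (M : FiniteMDP S A) (n : ℕ) (s : S) :
    ∃ a, M.r s a + meanOf (M.p s a) (M.backwardValue n) = M.backwardValue (n + 1) s :=
  exists_eq_ciSup_of_finite (f := fun a => M.r s a + meanOf (M.p s a) (M.backwardValue n))

end Backward

variable [DecidableEq S]

/-- The definition splits off the last transition; the Bellman equation needs the first one. -/
lemma stateProb_succ' (M : FiniteMDP S A) (pol : DetPolicy S A) (t : ℕ) (s : S) (i : ℕ) (s' : S) :
    M.stateProb pol t s (i + 1) s' =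
      ∑ x, M.p s (pol t s) x * M.stateProb pol (t + 1) x i s' := by
  induction i generalizing s' with
  | zero => simp [stateProb]
  | succ i ih =>
    rw [stateProb]
    simp_rw [ih, Finset.sum_mul]
    rw [Finset.sum_comm]
    refine Finset.sum_congr rfl fun x _ => ?_
    rw [stateProb, Finset.mul_sum]
    refine Finset.sum_congr rfl fun y _ => ?_
    rw [show t + (i + 1) = t + 1 + i by ring]; ring

lemma value_of_ge (M : FiniteMDP S A) (pol : DetPolicy S A) {t : ℕ} (h : M.H ≤ t) (s : S) :
    M.value pol t s = 0 := by
  simp [value, Nat.sub_eq_zero_of_le h]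

lemma value_of_lt (M : FiniteMDP S A) (pol : DetPolicy S A) {t : ℕ} (h : t < M.H) (s : S) :
    M.value pol t s = M.r s (pol t s) + meanOf (M.p s (pol t s)) (M.value pol (t + 1)) := by
  have h1 : M.H - t = (M.H - (t + 1)) + 1 := by omega
  rw [value, h1, Finset.sum_range_succ']
  rw [add_comm]
  congr 1
  · simp [stateProb]
  · simp only [meanOf, value, Finset.mul_sum]
    conv_rhs => rw [Finset.sum_comm]
    refine Finset.sum_congr rfl fun i _ => ?_
    simp_rw [stateProb_succ', Finset.sum_mul]
    conv_lhs => rw [Finset.sum_comm]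
    refine Finset.sum_congr rfl fun x _ => Finset.sum_congr rfl fun y _ => ?_
    rw [show t + (i + 1) = t + 1 + i by ring]; ring

lemma value_mem (M : FiniteMDP S A) (pol : DetPolicy S A) :
    ∀ t ≤ M.H, ∀ s, 0 ≤ M.value pol t s ∧ M.value pol t s ≤ (M.H : ℝ) - t := by
  intro t ht
  induction ht using Nat.decreasingInduction with
  | self => intro s; simp [value_of_ge]
  | of_succ t ht ih =>
    intro s
    rw [value_of_lt M pol ht]
    have h0 := M.r_nonneg s (pol t s)
    have h1 := M.r_le_one s (pol t s)
    have h2 := meanOf_nonneg (M.p_nonneg s (pol t s)) (fun x => (ih x).1)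
    have hb : (0 : ℝ) ≤ (M.H : ℝ) - ((t + 1 : ℕ) : ℝ) := by
      have : ((t + 1 : ℕ) : ℝ) ≤ M.H := by exact_mod_cast ht
      linarith
    have h3 := meanOf_le (M.p_nonneg s (pol t s)) (M.p_sum s (pol t s)).le hb (fun x => (ih x).2)
    push_cast at h3
    constructor <;> linarith

lemma value_nonneg (M : FiniteMDP S A) (pol : DetPolicy S A) (t : ℕ) (s : S) :
    0 ≤ M.value pol t s := by
  rcases le_total t M.H with h | h
  · exact (M.value_mem pol t h s).1
  · rw [M.value_of_ge pol h]

lemma value_le (M : FiniteMDP S A) (pol : DetPolicy S A) (t : ℕ) (s : S) :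
    M.value pol t s ≤ M.H := by
  rcases le_total t M.H with h | h
  · have := (M.value_mem pol t h s).2
    have h2 : (0 : ℝ) ≤ t := Nat.cast_nonneg t
    linarith
  · rw [M.value_of_ge pol h]; exact Nat.cast_nonneg _

lemma value_le_optValue (M : FiniteMDP S A) (pol : DetPolicy S A) (t : ℕ) (s : S) :
    M.value pol t s ≤ M.optValue t s :=
  le_ciSup (f := fun pol => M.value pol t s)
    ⟨M.H, by rintro _ ⟨pol, rfl⟩; exact M.value_le pol t s⟩ pol

section Nonempty

variable [Nonempty A]

lemma optValue_nonneg (M : FiniteMDP S A) (t : ℕ) (s : S) : 0 ≤ M.optValue t s :=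
  (M.value_nonneg (fun _ _ => Classical.arbitrary A) t s).trans (M.value_le_optValue _ t s)

lemma optValue_le (M : FiniteMDP S A) (t : ℕ) (s : S) : M.optValue t s ≤ M.H :=
  ciSup_le fun pol => M.value_le pol t s

lemma optValue_le_sub (M : FiniteMDP S A) {t : ℕ} (ht : t ≤ M.H) (s : S) :
    M.optValue t s ≤ (M.H : ℝ) - t :=
  ciSup_le fun pol => (M.value_mem pol t ht s).2

end Nonempty

variable [Finite A]

lemma value_le_backwardValue (M : FiniteMDP S A) (pol : DetPolicy S A) :
    ∀ t ≤ M.H, ∀ s, M.value pol t s ≤ M.backwardValue (M.H - t) s := by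
  intro t ht
  induction ht using Nat.decreasingInduction with
  | self => intro s; simp [value_of_ge, backwardValue]
  | of_succ t ht ih =>
    intro s
    rw [value_of_lt M pol ht, show M.H - t = M.H - (t + 1) + 1 by omega]
    exact (add_le_add le_rfl (meanOf_mono (M.p_nonneg _ _) ih)).trans
      (M.le_backwardValue_succ _ s (pol t s))

variable [Nonempty A]

/-- Choosing a maximising action at every stage gives one policy that is optimal for all time-steps
and states at once. Hence the supremum over policies satisfies the Bellman equations. -/
lemma exists_value_eq_backwardValue (M : FiniteMDP S A) :
    ∃ pol : DetPolicy S A, ∀ t ≤ M.H, ∀ s, M.value pol t s = M.backwardValue (M.H - t) s := by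
  choose act hact using fun n s => M.exists_backwardValue_succ n s
  refine ⟨fun t s => act (M.H - (t + 1)) s, fun t ht => ?_⟩
  induction ht using Nat.decreasingInduction with
  | self => intro s; simp [value_of_ge, backwardValue]
  | of_succ t ht ih =>
    intro s
    rw [value_of_lt M _ ht, show M.H - t = M.H - (t + 1) + 1 by omega, ← hact]
    congr 2
    exact funext ih

lemma optValue_eq_backwardValue (M : FiniteMDP S A) {t : ℕ} (ht : t ≤ M.H) (s : S) :
    M.optValue t s = M.backwardValue (M.H - t) s := by
  obtain ⟨pol, hpol⟩ := M.exists_value_eq_backwardValue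
  apply le_antisymm
  · exact ciSup_le fun pol => M.value_le_backwardValue pol t ht s
  · rw [← hpol t ht]; exact M.value_le_optValue pol t s

lemma le_optValue (M : FiniteMDP S A) {t : ℕ} (ht : t < M.H) (s : S) (a : A) :
    M.r s a + meanOf (M.p s a) (M.optValue (t + 1)) ≤ M.optValue t s := by
  rw [M.optValue_eq_backwardValue ht.le, show M.H - t = M.H - (t + 1) + 1 by omega,
    show M.optValue (t + 1) = M.backwardValue (M.H - (t + 1)) from
      funext (M.optValue_eq_backwardValue ht)]
  exact M.le_backwardValue_succ _ s a

lemma exists_optValue_eq (M : FiniteMDP S A) {t : ℕ} (ht : t < M.H) (s : S) :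
    ∃ a, M.r s a + meanOf (M.p s a) (M.optValue (t + 1)) = M.optValue t s := by
  rw [M.optValue_eq_backwardValue ht.le, show M.H - t = M.H - (t + 1) + 1 by omega,
    show M.optValue (t + 1) = M.backwardValue (M.H - (t + 1)) from
      funext (M.optValue_eq_backwardValue ht)]
  exact M.exists_backwardValue_succ _ s

end FiniteMDP

/-! ### The filtration of a run and its martingale differences. -/

namespace EulerGPRun

variable {S A Ω : Type*} [Fintype S] [DecidableEq S] [Fintype A] [DecidableEq A]
  [mΩ : MeasurableSpace Ω] {M : FiniteMDP S A} {K : ℕ} {δ : ℝ} {P : Measure Ω}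

/-- The action taken at time-step `t` of episode `k`. -/
def action (run : EulerGPRun M K δ P) (k t : ℕ) (ω : Ω) : A :=
  run.policy k ω t (run.state k t ω)

/-- The realised history. -/
def hist (run : EulerGPRun M K δ P) (ω : Ω) : History S A where
  state := fun j u => run.state j u ω
  action := fun j u => run.action j u ω
  reward := fun j u => run.reward j u ω

/-- The filtration of the run, indexed by the total number of elapsed time-steps. -/
@[reducible]
def flat (run : EulerGPRun M K δ P) (i : ℕ) : MeasurableSpace Ω := run.info (i / M.H) (i % M.H)

lemma info_mono_step (run : EulerGPRun M K δ P) (k : ℕ) {t t' : ℕ} (h : t ≤ t') (h' : t' ≤ M.H) :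
    run.info k t ≤ run.info k t' := by
  induction t', h using Nat.le_induction with
  | base => exact le_rfl
  | succ n _ ih => exact (ih (by omega)).trans (run.info_step k n (by omega))

lemma info_mono_episode (run : EulerGPRun M K δ P) {j k : ℕ} (h : j < k) {t : ℕ} (ht : t ≤ M.H) :
    run.info j t ≤ run.info k 0 := by
  have h1 : ∀ i, run.info i 0 ≤ run.info (i + 1) 0 := fun i =>
    (run.info_mono_step i (Nat.zero_le _) le_rfl).trans (run.info_next i)
  exact ((run.info_mono_step j ht le_rfl).trans (run.info_next j)).trans
    (monotone_nat_of_le_succ h1 h)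

lemma flat_apply (run : EulerGPRun M K δ P) (k : ℕ) {t : ℕ} (ht : t < M.H) :
    run.flat (k * M.H + t) = run.info k t := by
  rw [flat, Nat.mul_comm, Nat.mul_add_div M.H_pos, Nat.div_eq_of_lt ht, Nat.mul_add_mod,
    Nat.mod_eq_of_lt ht, Nat.add_zero]

/-- At `t + 1 = H` the flat index already points to the start of the next episode, which may carry
more information. -/
lemma info_le_flat_succ (run : EulerGPRun M K δ P) (k : ℕ) {t : ℕ} (ht : t < M.H) :
    run.info k (t + 1) ≤ run.flat (k * M.H + t + 1) := by
  rcases Nat.lt_or_ge (t + 1) M.H with h | h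
  · rw [add_assoc, run.flat_apply k h]
  · have h1 : t + 1 = M.H := by omega
    rw [add_assoc, h1, show k * M.H + M.H = (k + 1) * M.H + 0 by ring, run.flat_apply _ M.H_pos]
    exact run.info_next k

lemma flat_mono (run : EulerGPRun M K δ P) : Monotone run.flat := by
  apply monotone_nat_of_le_succ
  intro i
  have h1 := Nat.mod_lt i M.H_pos
  have h2 : i / M.H * M.H + i % M.H = i := Nat.div_add_mod' i M.H
  have h3 := run.info_le_flat_succ (i / M.H) h1
  rw [h2] at h3
  exact (run.info_step _ _ h1).trans h3

lemma sum_range_mul (f : ℕ → ℝ) (k H : ℕ) :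
    ∑ i ∈ Finset.range (k * H), f i =
      ∑ j ∈ Finset.range k, ∑ t ∈ Finset.range H, f (j * H + t) := by
  induction k with
  | zero => simp
  | succ k ih => rw [Nat.succ_mul, Finset.sum_range_add, ih, Finset.sum_range_succ]

/-- An integrable increment of time-step `t` of episode `k` with conditional mean zero. -/
def IsDiff (run : EulerGPRun M K δ P) (k t : ℕ) (Y : Ω → ℝ) : Prop :=
  Measurable[run.info k (t + 1)] Y ∧ Integrable Y P ∧ P[Y | run.info k t] =ᵐ[P] 0

lemma IsDiff.neg {run : EulerGPRun M K δ P} {k t : ℕ} {Y : Ω → ℝ} (h : run.IsDiff k t Y) :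
    run.IsDiff k t (fun ω => -Y ω) := by
  refine ⟨h.1.neg, h.2.1.neg, ?_⟩
  have h1 := condExp_neg (μ := P) Y (run.info k t)
  filter_upwards [h1, h.2.2] with ω h2 h3
  rw [show (fun ω => -Y ω) = -Y from rfl, h2]
  simp [h3]

lemma IsDiff.mul_left {run : EulerGPRun M K δ P} {k t : ℕ} (ht : t < M.H) {Y : Ω → ℝ}
    (h : run.IsDiff k t Y) {w : Ω → ℝ} (hw : Measurable[run.info k t] w) {C : ℝ}
    (hC : ∀ ω, |w ω| ≤ C) : run.IsDiff k t (fun ω => w ω * Y ω) := by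
  have hint : Integrable (fun ω => w ω * Y ω) P := h.2.1.bdd_mul
    (hw.mono (run.info_le k t) le_rfl).aestronglyMeasurable
    (Filter.Eventually.of_forall fun ω => by simpa [Real.norm_eq_abs] using hC ω)
  refine ⟨(hw.mono (run.info_step k t ht) le_rfl).mul h.1, hint, ?_⟩
  have h1 := condExp_mul_of_stronglyMeasurable_left (μ := P) hw.stronglyMeasurable hint h.2.1
  filter_upwards [h1, h.2.2] with ω h2 h3
  rw [show (fun ω => w ω * Y ω) = w * Y from rfl, h2]
  simp [h3]

lemma IsDiff.sum {run : EulerGPRun M K δ P} {k t : ℕ} {ι : Type*} {s : Finset ι} {Y : ι → Ω → ℝ}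
    (h : ∀ i ∈ s, run.IsDiff k t (Y i)) : run.IsDiff k t (fun ω => ∑ i ∈ s, Y i ω) := by
  refine ⟨Finset.measurable_sum s fun i hi => (h i hi).1,
    integrable_finsetSum s fun i hi => (h i hi).2.1, ?_⟩
  have h1 := condExp_finsetSum (fun i hi => (h i hi).2.1) (run.info k t)
  have h2 : ∀ᵐ ω ∂P, ∀ i ∈ s, (P[Y i | run.info k t]) ω = 0 :=
    (Finset.eventually_all s).2 fun i hi => (h i hi).2.2
  filter_upwards [h1, h2] with ω h3 h4
  have e : (fun ω => ∑ i ∈ s, Y i ω) = ∑ i ∈ s, Y i := by ext; simp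
  rw [e, h3, Finset.sum_apply]
  exact Finset.sum_eq_zero h4

lemma measurable_state (run : EulerGPRun M K δ P) {k t : ℕ} (hk : k < K) (ht : t ≤ M.H) {β : Type*}
    [MeasurableSpace β] (g : S → β) : Measurable[run.info k t] (fun ω => g (run.state k t ω)) :=
  (measurable_from_top (f := g)).comp (run.state_meas k hk t ht)

lemma measurableSet_state_eq (run : EulerGPRun M K δ P) {k t : ℕ} (hk : k < K) (ht : t ≤ M.H)
    (s : S) : MeasurableSet[run.info k t] {ω | run.state k t ω = s} :=
  run.state_meas k hk t ht (MeasurableSpace.measurableSet_top (s := {s}))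

lemma measurableSet_policy_eq (run : EulerGPRun M K δ P) {k t : ℕ} (hk : k < K) (ht : t < M.H)
    (s : S) (a : A) : MeasurableSet[run.info k 0] {ω | run.policy k ω t s = a} :=
  run.policy_meas k hk t ht s (MeasurableSpace.measurableSet_top (s := {a}))

lemma measurableSet_action_eq (run : EulerGPRun M K δ P) {k t : ℕ} (hk : k < K) (ht : t < M.H)
    (a : A) : MeasurableSet[run.info k t] {ω | run.action k t ω = a} := by
  have : {ω | run.action k t ω = a} =
      ⋃ s, ({ω | run.state k t ω = s} ∩ {ω | run.policy k ω t s = a}) := by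
    ext ω; simp [action]
  rw [this]
  exact MeasurableSet.iUnion fun s => (run.measurableSet_state_eq hk ht.le s).inter
    (run.info_mono_step k (Nat.zero_le t) ht.le _ (run.measurableSet_policy_eq hk ht s a))

lemma measurableSet_pair_eq (run : EulerGPRun M K δ P) {k t : ℕ} (hk : k < K) (ht : t < M.H)
    (s : S) (a : A) :
    MeasurableSet[run.info k t] {ω | run.state k t ω = s ∧ run.action k t ω = a} :=
  (run.measurableSet_state_eq hk ht.le s).inter (run.measurableSet_action_eq hk ht a)

lemma measurable_pair (run : EulerGPRun M K δ P) {k t : ℕ} (hk : k < K) (ht : t < M.H)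
    (g : S → A → ℝ) :
    Measurable[run.info k t] (fun ω => g (run.state k t ω) (run.action k t ω)) := by
  have : (fun ω => g (run.state k t ω) (run.action k t ω)) = fun ω => ∑ s, ∑ a,
      ({ω | run.state k t ω = s ∧ run.action k t ω = a}.indicator (fun _ => g s a)) ω := by
    ext ω
    simp [Set.indicator_apply, ite_and]
  rw [this]
  exact Finset.measurable_sum _ fun s _ => Finset.measurable_sum _ fun a _ =>
    measurable_const.indicator (run.measurableSet_pair_eq hk ht s a)

variable [IsProbabilityMeasure P]

lemma isDiff_state_eq (run : EulerGPRun M K δ P) {k t : ℕ} (hk : k < K) (ht : t < M.H) (x : S) :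
    run.IsDiff k t (fun ω => (if run.state k (t + 1) ω = x then (1 : ℝ) else 0)
      - M.p (run.state k t ω) (run.action k t ω) x) := by
  have hm1 : Measurable[run.info k (t + 1)]
      (fun ω => if run.state k (t + 1) ω = x then (1 : ℝ) else 0) :=
    run.measurable_state hk ht (fun y => if y = x then (1 : ℝ) else 0)
  have hm2 := run.measurable_pair hk ht (fun s a => M.p s a x)
  have hi1 : Integrable (fun ω => if run.state k (t + 1) ω = x then (1 : ℝ) else 0) P :=
    Integrable.of_bound (hm1.mono (run.info_le _ _) le_rfl).aestronglyMeasurable 1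
      (Filter.Eventually.of_forall fun ω => by split_ifs <;> simp)
  have hi2 : Integrable (fun ω => M.p (run.state k t ω) (run.action k t ω) x) P :=
    Integrable.of_bound (hm2.mono (run.info_le _ _) le_rfl).aestronglyMeasurable 1
      (Filter.Eventually.of_forall fun ω => by
        rw [Real.norm_eq_abs, abs_of_nonneg (M.p_nonneg _ _ _)]; exact M.p_le_one _ _ _)
  refine ⟨hm1.sub (hm2.mono (run.info_step k t ht) le_rfl), hi1.sub hi2, ?_⟩
  have h1 := condExp_sub hi1 hi2 (run.info k t)
  have h2 := run.state_law k hk t ht x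
  have h3 : (run.state k (t + 1) ⁻¹' {x}).indicator (fun _ => (1 : ℝ)) =
      fun ω => if run.state k (t + 1) ω = x then (1 : ℝ) else 0 := by
    ext ω; by_cases h : run.state k (t + 1) ω = x <;> simp [Set.indicator, h]
  rw [h3] at h2
  have h4 := condExp_of_stronglyMeasurable (run.info_le k t) hm2.stronglyMeasurable hi2
  filter_upwards [h1, h2] with ω h5 h6
  refine h5.trans ?_
  rw [Pi.sub_apply, h6, h4]
  simp [action]

/-- The centred value of a predictable function of the next state. -/
lemma isDiff_state (run : EulerGPRun M K δ P) {k t : ℕ} (hk : k < K) (ht : t < M.H)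
    {f : Ω → S → ℝ} (hf : ∀ x, Measurable[run.info k t] (fun ω => f ω x)) {C : ℝ}
    (hC : ∀ ω x, |f ω x| ≤ C) :
    run.IsDiff k t (fun ω => f ω (run.state k (t + 1) ω)
      - meanOf (M.p (run.state k t ω) (run.action k t ω)) (f ω)) := by
  have h := IsDiff.sum (s := Finset.univ) (Y := fun x ω => f ω x *
    ((if run.state k (t + 1) ω = x then (1 : ℝ) else 0)
      - M.p (run.state k t ω) (run.action k t ω) x))
    fun x _ => (run.isDiff_state_eq hk ht x).mul_left ht (hf x) (fun ω => hC ω x)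
  convert h using 2 with ω
  simp only [mul_sub, Finset.sum_sub_distrib, meanOf]
  congr 1
  · simp
  · exact Finset.sum_congr rfl fun x _ => mul_comm _ _

lemma reward_mem (run : EulerGPRun M K δ P) {k t : ℕ} (hk : k < K) (ht : t < M.H) :
    ∀ᵐ ω ∂P, run.reward k t ω ∈ Set.Icc (0 : ℝ) 1 := by
  have h := run.reward_law k hk t ht (Set.Icc 0 1) measurableSet_Icc
  have hms : MeasurableSet (run.reward k t ⁻¹' Set.Icc (0 : ℝ) 1) :=
    run.info_le _ _ _ (run.reward_meas k hk t ht measurableSet_Icc)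
  have h1 : ∫ ω, (run.reward k t ⁻¹' Set.Icc (0 : ℝ) 1).indicator (fun _ => (1 : ℝ)) ω ∂P = 1 := by
    rw [← integral_condExp (run.info_le k t), integral_congr_ae h]
    have : ∀ ω, (M.R (run.state k t ω) (run.policy k ω t (run.state k t ω))).real
        (Set.Icc 0 1) = 1 := by
      intro ω
      have := M.R_prob (run.state k t ω) (run.policy k ω t (run.state k t ω))
      have h2 := M.R_mem (run.state k t ω) (run.policy k ω t (run.state k t ω))
      rw [measureReal_def, (prob_compl_eq_zero_iff measurableSet_Icc).1 h2]; rfl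
    simp [this]
  rw [integral_indicator_const _ hms] at h1
  have h2 : P (run.reward k t ⁻¹' Set.Icc (0 : ℝ) 1) = 1 := by
    rw [measureReal_def] at h1
    simp only [smul_eq_mul, mul_one] at h1
    rw [← ENNReal.ofReal_toReal (measure_ne_top P _), h1, ENNReal.ofReal_one]
  exact (prob_compl_eq_zero_iff hms).2 h2

/-- `reward_law` speaks of probabilities of events only. On an event of `info k t` where the current
pair is `(s, a)`, it identifies the restricted law of the reward as a multiple of `R(s, a)`, so that
functions of the reward can be integrated. -/
lemma setIntegral_reward (run : EulerGPRun M K δ P) {k t : ℕ} (hk : k < K) (ht : t < M.H)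
    {φ : ℝ → ℝ} (hφ : Continuous φ) (s : S) (a : A) {B : Set Ω}
    (hB : MeasurableSet[run.info k t] B) :
    ∫ ω in B ∩ {ω | run.state k t ω = s ∧ run.action k t ω = a}, φ (run.reward k t ω) ∂P =
      P.real (B ∩ {ω | run.state k t ω = s ∧ run.action k t ω = a}) * ∫ x, φ x ∂(M.R s a) := by
  set D := B ∩ {ω | run.state k t ω = s ∧ run.action k t ω = a} with hD
  have hDm : MeasurableSet[run.info k t] D := hB.inter (run.measurableSet_pair_eq hk ht s a)
  have hRm : Measurable (run.reward k t) := (run.reward_meas k hk t ht).mono (run.info_le _ _) le_rfl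
  have hmap : (P.restrict D).map (run.reward k t) = P D • M.R s a := by
    have := M.R_prob s a
    ext E hE
    rw [Measure.map_apply hRm hE, Measure.restrict_apply (hRm hE), Measure.smul_apply, smul_eq_mul]
    have h1 : ∫ ω in D, (run.reward k t ⁻¹' E).indicator (fun _ => (1 : ℝ)) ω ∂P =
        P.real D * (M.R s a).real E := by
      rw [← setIntegral_condExp (run.info_le k t)
        ((integrable_const (1 : ℝ)).indicator (hRm hE)) hDm]
      rw [setIntegral_congr_ae (g := fun _ => (M.R s a).real E) (run.info_le _ _ _ hDm)]
      · simp
      · filter_upwards [run.reward_law k hk t ht E hE] with ω h hω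
        rw [h]
        obtain ⟨-, h2, h3⟩ := hω
        rw [← h3, ← h2]; rfl
    rw [setIntegral_indicator (hRm hE)] at h1
    simp only [integral_const, MeasurableSet.univ, measureReal_restrict_apply, Set.univ_inter,
      smul_eq_mul, mul_one] at h1
    rw [Set.inter_comm, ← ENNReal.toReal_eq_toReal_iff' (measure_ne_top _ _)
      (ENNReal.mul_ne_top (measure_ne_top _ _) (measure_ne_top _ _)), ENNReal.toReal_mul]
    exact h1
  rw [← integral_map (f := φ) hRm.aemeasurable hφ.aestronglyMeasurable, hmap,
    integral_smul_measure, smul_eq_mul, measureReal_def]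

/-- The centred value of a function of the reward. -/
lemma isDiff_reward (run : EulerGPRun M K δ P) {k t : ℕ} (hk : k < K) (ht : t < M.H)
    {φ : ℝ → ℝ} (hφ : Continuous φ) :
    run.IsDiff k t (fun ω => φ (run.reward k t ω)
      - ∫ x, φ x ∂(M.R (run.state k t ω) (run.action k t ω))) := by
  have hm1 : Measurable[run.info k (t + 1)] (fun ω => φ (run.reward k t ω)) :=
    hφ.measurable.comp (run.reward_meas k hk t ht)
  have hm2 := run.measurable_pair hk ht (fun s a => ∫ x, φ x ∂(M.R s a))
  obtain ⟨C, hC⟩ := (isCompact_Icc (a := (0 : ℝ)) (b := 1)).exists_bound_of_continuousOn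
    hφ.continuousOn
  have hi1 : Integrable (fun ω => φ (run.reward k t ω)) P := by
    refine Integrable.of_bound (hm1.mono (run.info_le _ _) le_rfl).aestronglyMeasurable C ?_
    filter_upwards [run.reward_mem hk ht] with ω hω using hC _ hω
  have hi2 : Integrable (fun ω => ∫ x, φ x ∂(M.R (run.state k t ω) (run.action k t ω))) P := by
    refine Integrable.of_bound (hm2.mono (run.info_le _ _) le_rfl).aestronglyMeasurable C
      (Filter.Eventually.of_forall fun ω => ?_)
    have := M.R_prob (run.state k t ω) (run.action k t ω)
    have h1 := norm_integral_le_of_norm_le_const (μ := M.R (run.state k t ω) (run.action k t ω))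
      (f := φ) (C := C)
      (by filter_upwards [M.R_mem (run.state k t ω) (run.action k t ω)] with x hx using hC x hx)
    simpa using h1
  refine ⟨hm1.sub (hm2.mono (run.info_step k t ht) le_rfl), hi1.sub hi2, ?_⟩
  have hkey : (fun ω => ∫ x, φ x ∂(M.R (run.state k t ω) (run.action k t ω))) =ᵐ[P]
      P[fun ω => φ (run.reward k t ω) | run.info k t] := by
    refine ae_eq_condExp_of_forall_setIntegral_eq (run.info_le k t) hi1
      (fun _ _ _ => hi2.integrableOn) (fun B hB _ => ?_) hm2.aestronglyMeasurable
    -- There are finitely many pairs, so the event splits into pieces on which the current pair is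
    -- constant.
    have hpart : ∀ g : Ω → ℝ, Integrable g P → ∫ ω in B, g ω ∂P = ∑ x : S × A,
        ∫ ω in B ∩ {ω | run.state k t ω = x.1 ∧ run.action k t ω = x.2}, g ω ∂P := by
      intro g hg
      have hU : B = ⋃ x : S × A,
          (B ∩ {ω | run.state k t ω = x.1 ∧ run.action k t ω = x.2}) := by
        ext ω; simp
      conv_lhs => rw [hU]
      rw [integral_iUnion_fintype (s := fun x : S × A =>
        B ∩ {ω | run.state k t ω = x.1 ∧ run.action k t ω = x.2}) (fun x => run.info_le k t _
        (hB.inter (run.measurableSet_pair_eq hk ht x.1 x.2))) ?_ (fun x => hg.integrableOn)]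
      intro x y hxy
      rw [Function.onFun, Set.disjoint_left]
      rintro ω ⟨-, h1, h2⟩ ⟨-, h3, h4⟩
      exact hxy (Prod.ext (h1.symm.trans h3) (h2.symm.trans h4))
    rw [hpart _ hi1, hpart _ hi2]
    refine Finset.sum_congr rfl fun x _ => ?_
    rw [run.setIntegral_reward hk ht hφ x.1 x.2 hB]
    rw [setIntegral_congr_fun (g := fun _ => ∫ y, φ y ∂(M.R x.1 x.2))
      (run.info_le k t _ (hB.inter (run.measurableSet_pair_eq hk ht x.1 x.2)))]
    · simp
    · rintro ω ⟨-, h1, h2⟩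
      simp only [h1, h2]
  have h1 := condExp_sub hi1 hi2 (run.info k t)
  have h4 := condExp_of_stronglyMeasurable (run.info_le k t) hm2.stronglyMeasurable hi2
  filter_upwards [h1, hkey] with ω h5 h6
  refine h5.trans ?_
  rw [Pi.sub_apply, h4, ← h6]
  simp

/-- The exponential bound for the increments of a run, at the ends of all episodes. -/
theorem measureReal_exists_lt_le_exp (run : EulerGPRun M K δ P) {Y : ℕ → ℕ → Ω → ℝ}
    (hY : ∀ k < K, ∀ t < M.H, run.IsDiff k t (Y k t))
    (hb : ∀ k < K, ∀ t < M.H, ∀ᵐ ω ∂P, |Y k t ω| ≤ 1) {l ψ : ℝ}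
    (hψ : ∀ y : ℝ, |y| ≤ 1 → Real.exp (l * y - ψ * y ^ 2) ≤ 1 + l * y) (x : ℝ) :
    P.real {ω | ∃ k ≤ K, x < l * ∑ j ∈ Finset.range k, ∑ t ∈ Finset.range M.H, Y j t ω
      - ψ * ∑ j ∈ Finset.range k, ∑ t ∈ Finset.range M.H, Y j t ω ^ 2} ≤ Real.exp (-x) := by
  -- The laws of the run are assumed for `k < K` only; beyond that the increments are continued by
  -- zero.
  set Y' : ℕ → Ω → ℝ := fun i => if i < K * M.H then Y (i / M.H) (i % M.H) else 0 with hY'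
  have hflat : ∀ i, i < K * M.H → i / M.H < K ∧ i % M.H < M.H ∧ i / M.H * M.H + i % M.H = i :=
    fun i hi => ⟨(Nat.div_lt_iff_lt_mul M.H_pos).2 hi, Nat.mod_lt i M.H_pos,
      Nat.div_add_mod' i M.H⟩
  have hmain := _root_.measureReal_exists_lt_le_exp (P := P) (F := run.flat) run.flat_mono
    (fun i => run.info_le _ _) (Y := Y') (fun i => ?_) (fun i => ?_) (fun i => ?_) hψ x (K * M.H)
  · refine (measureReal_mono ?_).trans hmain
    rintro ω ⟨k, hk, h⟩
    refine ⟨k * M.H, Nat.mul_le_mul_right _ hk, ?_⟩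
    have e : ∀ j ∈ Finset.range k, ∀ t ∈ Finset.range M.H, Y' (j * M.H + t) = Y j t := by
      intro j hj t ht
      have hj' := Finset.mem_range.1 hj
      have ht' := Finset.mem_range.1 ht
      have hlt : j * M.H + t < K * M.H := by
        calc j * M.H + t < j * M.H + M.H := by omega
          _ = (j + 1) * M.H := by ring
          _ ≤ K * M.H := Nat.mul_le_mul_right _ (by omega)
      simp only [hY', if_pos hlt]
      rw [Nat.mul_comm, Nat.mul_add_div M.H_pos, Nat.div_eq_of_lt ht', Nat.mul_add_mod,
        Nat.mod_eq_of_lt ht', Nat.add_zero]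
    rw [sum_range_mul, sum_range_mul]
    have e1 : ∑ j ∈ Finset.range k, ∑ t ∈ Finset.range M.H, Y' (j * M.H + t) ω =
        ∑ j ∈ Finset.range k, ∑ t ∈ Finset.range M.H, Y j t ω :=
      Finset.sum_congr rfl fun j hj => Finset.sum_congr rfl fun t ht => by rw [e j hj t ht]
    have e2 : ∑ j ∈ Finset.range k, ∑ t ∈ Finset.range M.H, Y' (j * M.H + t) ω ^ 2 =
        ∑ j ∈ Finset.range k, ∑ t ∈ Finset.range M.H, Y j t ω ^ 2 :=
      Finset.sum_congr rfl fun j hj => Finset.sum_congr rfl fun t ht => by rw [e j hj t ht]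
    rw [e1, e2]
    exact h
  · by_cases hi : i < K * M.H
    · obtain ⟨h1, h2, h3⟩ := hflat i hi
      simp only [hY', if_pos hi]
      refine (hY _ h1 _ h2).1.mono ?_ le_rfl
      have := run.info_le_flat_succ (i / M.H) h2
      rwa [h3] at this
    · simp only [hY', if_neg hi]; exact measurable_const
  · by_cases hi : i < K * M.H
    · obtain ⟨h1, h2, h3⟩ := hflat i hi
      simp only [hY', if_pos hi]
      exact hb _ h1 _ h2
    · simp only [hY', if_neg hi]; simp
  · by_cases hi : i < K * M.H
    · obtain ⟨h1, h2, h3⟩ := hflat i hi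
      simp only [hY', if_pos hi]
      exact (hY _ h1 _ h2).2.2
    · simp only [hY', if_neg hi, condExp_zero]; rfl

/-- A consequence in terms of dominating variables `V ≥ |Y|`. -/
theorem measureReal_exists_lt_add_le_exp (run : EulerGPRun M K δ P) {Y V : ℕ → ℕ → Ω → ℝ}
    (hY : ∀ k < K, ∀ t < M.H, run.IsDiff k t (Y k t))
    (hb : ∀ k < K, ∀ t < M.H, ∀ᵐ ω ∂P, |Y k t ω| ≤ 1 ∧ |Y k t ω| ≤ V k t ω) {l : ℝ}
    (hl0 : 0 < l) (hl1 : l ≤ 1 / 2) (x : ℝ) :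
    P.real {ω | ∃ k ≤ K, l * ∑ j ∈ Finset.range k, ∑ t ∈ Finset.range M.H, V j t ω + x / l
      < ∑ j ∈ Finset.range k, ∑ t ∈ Finset.range M.H, Y j t ω} ≤ Real.exp (-x) := by
  have h := run.measureReal_exists_lt_le_exp hY (fun k hk t ht => (hb k hk t ht).mono fun _ h => h.1)
    (l := l) (ψ := l ^ 2) (fun y hy => exp_mul_sub_sq_le_one_add hl0.le hl1 hy) x
  refine le_trans (ENNReal.toReal_mono (measure_ne_top _ _) (measure_mono_ae ?_)) h
  have hall : ∀ᵐ ω ∂P, ∀ k ∈ Finset.range K, ∀ t ∈ Finset.range M.H,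
      |Y k t ω| ≤ 1 ∧ |Y k t ω| ≤ V k t ω :=
    (Finset.eventually_all _).2 fun k hk => (Finset.eventually_all _).2 fun t ht =>
      hb k (Finset.mem_range.1 hk) t (Finset.mem_range.1 ht)
  filter_upwards [hall] with ω hω
  rintro ⟨k, hk, h⟩
  refine ⟨k, hk, ?_⟩
  -- As `|Y| ≤ 1`, squares are at most `|Y| ≤ V`: the quadratic compensator becomes an error
  -- relative to `∑ V`.
  have h2 : ∑ j ∈ Finset.range k, ∑ t ∈ Finset.range M.H, Y j t ω ^ 2 ≤
      ∑ j ∈ Finset.range k, ∑ t ∈ Finset.range M.H, V j t ω := by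
    refine Finset.sum_le_sum fun j hj => Finset.sum_le_sum fun t ht => ?_
    obtain ⟨h3, h4⟩ := hω j (Finset.mem_range.2 ((Finset.mem_range.1 hj).trans_le hk)) t ht
    calc Y j t ω ^ 2 = |Y j t ω| * |Y j t ω| := by rw [← sq_abs]; ring
      _ ≤ 1 * V j t ω := mul_le_mul h3 h4 (abs_nonneg _) zero_le_one
      _ = V j t ω := one_mul _
  have h5 := mul_lt_mul_of_pos_left h hl0
  rw [mul_add, mul_div_cancel₀ _ hl0.ne'] at h5
  have h6 := mul_le_mul_of_nonneg_left h2 (sq_nonneg l)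
  nlinarith

end EulerGPRun

/-! ### Sums over visits -/

namespace History

variable {S A : Type*} [DecidableEq S] [DecidableEq A]

lemma sum_visits (h : History S A) (H k : ℕ) (s : S) (a : A) (F : ℕ → ℕ → ℝ) :
    ∑ i ∈ h.visits H k s a, F i.1 i.2 = ∑ j ∈ Finset.range k, ∑ t ∈ Finset.range H,
      if h.state j t = s ∧ h.action j t = a then F j t else 0 := by
  rw [visits, Finset.sum_filter, Finset.sum_product]

lemma count_eq_sum (h : History S A) (H k : ℕ) (s : S) (a : A) :
    (h.count H k s a : ℝ) = ∑ j ∈ Finset.range k, ∑ t ∈ Finset.range H,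
      if h.state j t = s ∧ h.action j t = a then 1 else 0 := by
  rw [← sum_visits, count]; simp

lemma pHat_eq_sum (h : History S A) (H k : ℕ) (s : S) (a : A) (s' : S) :
    h.pHat H k s a s' = (∑ j ∈ Finset.range k, ∑ t ∈ Finset.range H,
      if h.state j t = s ∧ h.action j t = a then (if h.state j (t + 1) = s' then (1 : ℝ) else 0)
        else 0) / h.count H k s a := by
  rw [← sum_visits h H k s a (fun j t => if h.state j (t + 1) = s' then (1 : ℝ) else 0), pHat]
  congr 1
  rw [Finset.sum_boole]

lemma rHat_eq_sum (h : History S A) (H k : ℕ) (s : S) (a : A) :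
    h.rHat H k s a = (∑ j ∈ Finset.range k, ∑ t ∈ Finset.range H,
      if h.state j t = s ∧ h.action j t = a then h.reward j t else 0) / h.count H k s a := by
  rw [rHat, sum_visits h H k s a h.reward]

lemma varHat_eq_sum (h : History S A) (H k : ℕ) (s : S) (a : A) :
    h.varHat H k s a = (∑ j ∈ Finset.range k, ∑ t ∈ Finset.range H,
      if h.state j t = s ∧ h.action j t = a then (h.reward j t - h.rHat H k s a) ^ 2 else 0)
        / ((h.count H k s a : ℝ) - 1) := by
  rw [varHat, sum_visits h H k s a (fun j t => (h.reward j t - h.rHat H k s a) ^ 2)]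

end History

/-! ### Measurability of the estimates and of the values -/

section Measurability

lemma measurable_apply_of_finite {Ω A : Type*} [MeasurableSpace Ω] [Fintype A] [DecidableEq A]
    {g : Ω → A → ℝ} {act : Ω → A} (hg : ∀ a, Measurable fun ω => g ω a)
    (ha : ∀ a, MeasurableSet {ω | act ω = a}) : Measurable fun ω => g ω (act ω) := by
  have : (fun ω => g ω (act ω)) = fun ω => ∑ a, if act ω = a then g ω a else 0 := by
    ext ω; simp
  rw [this]
  exact Finset.measurable_sum _ fun a _ => Measurable.ite (ha a) (hg a) measurable_const

variable {S A Ω : Type*} [MeasurableSpace Ω]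

lemma FiniteMDP.measurable_value [Fintype S] [DecidableEq S] [Fintype A] [DecidableEq A]
    (M : FiniteMDP S A) {pol : Ω → DetPolicy S A}
    (hpol : ∀ t < M.H, ∀ s a, MeasurableSet {ω | pol ω t s = a}) :
    ∀ t ≤ M.H, ∀ s, Measurable fun ω => M.value (pol ω) t s := by
  intro t ht
  induction ht using Nat.decreasingInduction with
  | self => intro s; simp [M.value_of_ge]
  | of_succ t ht ih =>
    intro s
    simp_rw [M.value_of_lt _ ht]
    refine measurable_apply_of_finite
      (g := fun ω a => M.r s a + meanOf (M.p s a) (M.value (pol ω) (t + 1)))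
      (fun a => measurable_const.add ?_) (hpol t ht s)
    exact Finset.measurable_sum _ fun x _ => (ih x).const_mul _

/-- The first `k` episodes of a random history are measurable. -/
structure MeasurableHist (H k : ℕ) (h : Ω → History S A) : Prop where
  state : ∀ j < k, ∀ t ≤ H, ∀ s, MeasurableSet {ω | (h ω).state j t = s}
  action : ∀ j < k, ∀ t < H, ∀ a, MeasurableSet {ω | (h ω).action j t = a}
  reward : ∀ j < k, ∀ t < H, Measurable fun ω => (h ω).reward j t

namespace MeasurableHist

variable {H k : ℕ} {h : Ω → History S A}

lemma mono (hh : MeasurableHist H k h) {k' : ℕ} (hk : k' ≤ k) : MeasurableHist H k' h :=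
  ⟨fun j hj => hh.state j (hj.trans_le hk), fun j hj => hh.action j (hj.trans_le hk),
    fun j hj => hh.reward j (hj.trans_le hk)⟩

variable [DecidableEq S] [DecidableEq A]

lemma sum_ite (hh : MeasurableHist H k h) (s : S) (a : A) {F : Ω → ℕ → ℕ → ℝ}
    (hF : ∀ j < k, ∀ t < H, Measurable fun ω => F ω j t) :
    Measurable fun ω => ∑ j ∈ Finset.range k, ∑ t ∈ Finset.range H,
      if (h ω).state j t = s ∧ (h ω).action j t = a then F ω j t else 0 := by
  refine Finset.measurable_sum _ fun j hj => Finset.measurable_sum _ fun t ht => ?_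
  rw [Finset.mem_range] at hj ht
  exact Measurable.ite ((hh.state j hj t ht.le s).inter (hh.action j hj t ht a)) (hF j hj t ht)
    measurable_const

lemma count (hh : MeasurableHist H k h) (s : S) (a : A) :
    Measurable fun ω => ((h ω).count H k s a : ℝ) := by
  simp_rw [History.count_eq_sum]
  exact hh.sum_ite s a fun _ _ _ _ => measurable_const

lemma count1 (hh : MeasurableHist H k h) (s : S) (a : A) :
    Measurable fun ω => (h ω).count1 H k s a :=
  (hh.count s a).max measurable_const

lemma rHat (hh : MeasurableHist H k h) (s : S) (a : A) :
    Measurable fun ω => (h ω).rHat H k s a := by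
  simp_rw [History.rHat_eq_sum]
  exact (hh.sum_ite s a hh.reward).div (hh.count s a)

lemma varHat (hh : MeasurableHist H k h) (s : S) (a : A) :
    Measurable fun ω => (h ω).varHat H k s a := by
  simp_rw [History.varHat_eq_sum]
  exact (hh.sum_ite s a fun j hj t ht =>
    ((hh.reward j hj t ht).sub (hh.rHat s a)).pow_const 2).div ((hh.count s a).sub_const 1)

lemma pHat (hh : MeasurableHist H k h) (s : S) (a : A) (s' : S) :
    Measurable fun ω => (h ω).pHat H k s a s' := by
  simp_rw [History.pHat_eq_sum]
  exact (hh.sum_ite s a fun j hj t ht =>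
    Measurable.ite (hh.state j hj (t + 1) ht s') measurable_const measurable_const).div
    (hh.count s a)

lemma rewardBonus (hh : MeasurableHist H k h) (ℓ : ℝ) (s : S) (a : A) :
    Measurable fun ω => EulerGP.rewardBonus H ℓ (h ω) k s a := by
  have h1 := hh.varHat s a
  have h2 := hh.count1 s a
  unfold EulerGP.rewardBonus
  fun_prop

variable [Fintype S] {U L : Ω → S → ℝ}

lemma meanOf_pHat (hh : MeasurableHist H k h) (hU : ∀ s, Measurable fun ω => U ω s) (s : S)
    (a : A) : Measurable fun ω => meanOf ((h ω).pHat H k s a) (U ω) :=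
  Finset.measurable_sum _ fun x _ => (hh.pHat s a x).mul (hU x)

lemma transBonus (hh : MeasurableHist H k h) (hU : ∀ s, Measurable fun ω => U ω s)
    (hL : ∀ s, Measurable fun ω => L ω s) (ℓ : ℝ) (s : S) (a : A) :
    Measurable fun ω => EulerGP.transBonus H ℓ (h ω) k s a (U ω) (L ω) := by
  have h1 : Measurable fun ω => varOf ((h ω).pHat H k s a) (U ω) :=
    Finset.measurable_sum _ fun x _ => (hh.pHat s a x).mul
      (((hU x).sub (hh.meanOf_pHat hU s a)).pow_const 2)
  have h2 := hh.count1 s a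
  have h3 : Measurable fun ω => norm2Of ((h ω).pHat H k s a) (fun x => U ω x - L ω x) :=
    (Finset.measurable_sum _ fun x _ => (hh.pHat s a x).mul
      (((hU x).sub (hL x)).pow_const 2)).sqrt
  unfold EulerGP.transBonus EulerGP.phi
  fun_prop

lemma qUpper (hh : MeasurableHist H k h) (hU : ∀ s, Measurable fun ω => U ω s)
    (hL : ∀ s, Measurable fun ω => L ω s) (ℓ : ℝ) (s : S) (a : A) :
    Measurable fun ω => EulerGP.qUpper H ℓ (h ω) k (U ω) (L ω) s a :=
  (((hh.rHat s a).add (hh.rewardBonus ℓ s a)).add (hh.meanOf_pHat hU s a)).add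
    (hh.transBonus hU hL ℓ s a)

lemma qLower (hh : MeasurableHist H k h) (hU : ∀ s, Measurable fun ω => U ω s)
    (hL : ∀ s, Measurable fun ω => L ω s) (ℓ : ℝ) (s : S) (a : A) :
    Measurable fun ω => EulerGP.qLower H ℓ (h ω) k (U ω) (L ω) s a :=
  (((hh.rHat s a).sub (hh.rewardBonus ℓ s a)).add (hh.meanOf_pHat hL s a)).sub
    (hh.transBonus hL hU ℓ s a)

lemma estimates [Fintype A] (ℓ : ℝ) {k : ℕ} (hh : MeasurableHist H k h) (t : ℕ) (s : S) :
    Measurable (fun ω => (EulerGP.estimates H ℓ (h ω) k).1 t s) ∧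
      Measurable (fun ω => (EulerGP.estimates H ℓ (h ω) k).2 t s) := by
  induction k generalizing t s with
  | zero => exact ⟨measurable_const, measurable_const⟩
  | succ k ih =>
    have hk := hh.mono (Nat.le_succ k)
    have hU := fun t s => (ih hk t s).1
    have hL := fun t s => (ih hk t s).2
    by_cases ht : t < H
    · simp only [EulerGP.estimates, ht, true_and]
      have hs := hh.state k (Nat.lt_succ_self k) t ht.le s
      have ha := hh.action k (Nat.lt_succ_self k) t ht
      constructor
      · exact Measurable.ite hs ((hU t s).min (measurable_apply_of_finite
          (fun a => hk.qUpper (hU (t + 1)) (hL (t + 1)) ℓ s a) ha)) (hU t s)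
      · exact Measurable.ite hs ((hL t s).max (measurable_apply_of_finite
          (fun a => hk.qLower (hU (t + 1)) (hL (t + 1)) ℓ s a) ha)) (hL t s)
    · simp only [EulerGP.estimates, ht, false_and, if_false]
      exact ⟨hU t s, hL t s⟩

end MeasurableHist

end Measurability

namespace EulerGPRun

variable {S A Ω : Type*} [Fintype S] [DecidableEq S] [Fintype A] [DecidableEq A]
  [mΩ : MeasurableSpace Ω] {M : FiniteMDP S A} {K : ℕ} {δ : ℝ} {P : Measure Ω}

/-- The upper estimates before episode `k`. -/
def upper (run : EulerGPRun M K δ P) (k t : ℕ) (s : S) (ω : Ω) : ℝ :=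
  (EulerGP.estimates M.H (logFactor S A M.H K δ) (run.hist ω) k).1 t s

/-- The lower estimates before episode `k`. -/
def lower (run : EulerGPRun M K δ P) (k t : ℕ) (s : S) (ω : Ω) : ℝ :=
  (EulerGP.estimates M.H (logFactor S A M.H K δ) (run.hist ω) k).2 t s

/-- Measurability with respect to `info k 0`, not merely the ambient σ-algebra, makes the estimates
predictable throughout episode `k`, so that they may enter the martingale bounds. -/
lemma measurableHist (run : EulerGPRun M K δ P) {k : ℕ} (hk : k ≤ K) :
    @MeasurableHist S A Ω (run.info k 0) M.H k run.hist := by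
  refine @MeasurableHist.mk S A Ω (run.info k 0) M.H k run.hist ?_ ?_ ?_
  · exact fun j hj t ht s => run.info_mono_episode hj ht _
      (run.measurableSet_state_eq (hj.trans_le hk) ht s)
  · exact fun j hj t ht a => run.info_mono_episode hj ht.le _
      (run.measurableSet_action_eq (hj.trans_le hk) ht a)
  · exact fun j hj t ht => (run.reward_meas j (hj.trans_le hk) t ht).mono
      (run.info_mono_episode hj ht) le_rfl

lemma measurable_upper (run : EulerGPRun M K δ P) {k : ℕ} (hk : k ≤ K) (t : ℕ) (s : S) :
    Measurable[run.info k 0] (run.upper k t s) :=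
  (@MeasurableHist.estimates S A Ω (run.info k 0) M.H run.hist _ _ _ _ _ k
    (run.measurableHist hk) t s).1

lemma measurable_lower (run : EulerGPRun M K δ P) {k : ℕ} (hk : k ≤ K) (t : ℕ) (s : S) :
    Measurable[run.info k 0] (run.lower k t s) :=
  (@MeasurableHist.estimates S A Ω (run.info k 0) M.H run.hist _ _ _ _ _ k
    (run.measurableHist hk) t s).2

lemma measurable_value (run : EulerGPRun M K δ P) {k : ℕ} (hk : k < K) {t : ℕ} (ht : t ≤ M.H)
    (s : S) : Measurable[run.info k 0] (fun ω => M.value (run.policy k ω) t s) :=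
  @FiniteMDP.measurable_value S A Ω (run.info k 0) _ _ _ _ M (run.policy k)
    (fun _ ht s a => run.measurableSet_policy_eq hk ht s a) t ht s

end EulerGPRun

/-! ### The empirical model -/

namespace History

variable {S A : Type*} [DecidableEq S] [DecidableEq A]

lemma one_le_count1 (h : History S A) (H k : ℕ) (s : S) (a : A) : 1 ≤ h.count1 H k s a :=
  le_max_right _ _

lemma count1_pos (h : History S A) (H k : ℕ) (s : S) (a : A) : 0 < h.count1 H k s a :=
  one_pos.trans_le (h.one_le_count1 H k s a)

lemma count1_of_pos (h : History S A) {H k : ℕ} {s : S} {a : A} (hn : 0 < h.count H k s a) :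
    h.count1 H k s a = h.count H k s a :=
  max_eq_left (by exact_mod_cast hn)

lemma pHat_nonneg (h : History S A) (H k : ℕ) (s : S) (a : A) (s' : S) :
    0 ≤ h.pHat H k s a s' := by
  unfold pHat; positivity

lemma pHat_of_count_eq_zero (h : History S A) {H k : ℕ} {s : S} {a : A}
    (hn : h.count H k s a = 0) : h.pHat H k s a = fun _ => 0 := by
  ext s'; simp [pHat, hn]

lemma sum_pHat_mul [Fintype S] (h : History S A) (H k : ℕ) (s : S) (a : A) (V : S → ℝ) :
    meanOf (h.pHat H k s a) V = (∑ j ∈ Finset.range k, ∑ t ∈ Finset.range H,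
      if h.state j t = s ∧ h.action j t = a then V (h.state j (t + 1)) else 0)
        / h.count H k s a := by
  simp only [meanOf, pHat_eq_sum, div_mul_eq_mul_div, ← Finset.sum_div, Finset.sum_mul]
  congr 1
  rw [Finset.sum_comm]
  refine Finset.sum_congr rfl fun j _ => ?_
  rw [Finset.sum_comm]
  refine Finset.sum_congr rfl fun t _ => ?_
  split_ifs <;> simp

lemma pHat_sum [Fintype S] (h : History S A) {H k : ℕ} {s : S} {a : A}
    (hn : 0 < h.count H k s a) : ∑ x, h.pHat H k s a x = 1 := by
  have h1 := h.sum_pHat_mul H k s a (fun _ => 1)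
  rw [← count_eq_sum, div_self (by exact_mod_cast hn.ne')] at h1
  simpa [meanOf] using h1

/-- Without data `p̂` is zero rather than a probability vector, and all terms vanish. -/
lemma sqrt_varOf_pHat_le [Fintype S] (h : History S A) (H k : ℕ) (s : S) (a : A) (V W : S → ℝ) :
    √(varOf (h.pHat H k s a) V) ≤ √(varOf (h.pHat H k s a) W)
      + norm2Of (h.pHat H k s a) (fun x => V x - W x) := by
  rcases Nat.eq_zero_or_pos (h.count H k s a) with hn | hn
  · simp [h.pHat_of_count_eq_zero hn, varOf, norm2Of]
  · exact sqrt_varOf_le_add_norm2Of (h.pHat_nonneg H k s a) (h.pHat_sum hn) V W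

end History

/-! ### Optimism and pessimism -/

namespace EulerGP

variable {S A : Type*} [Fintype S] [DecidableEq S] [DecidableEq A]

/-- The empirical model after `k` episodes is close to the process `M`, as measured by the mean
rewards and by the means of the optimal values. -/
structure IsAccurate (M : FiniteMDP S A) (ℓ : ℝ) (h : History S A) (k : ℕ) : Prop where
  reward : ∀ s a, |h.rHat M.H k s a - M.r s a| ≤ rewardBonus M.H ℓ h k s a
  trans : ∀ s a, ∀ t < M.H,
    |meanOf (h.pHat M.H k s a) (M.optValue (t + 1)) - meanOf (M.p s a) (M.optValue (t + 1))| ≤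
      √(2 * varOf (h.pHat M.H k s a) (M.optValue (t + 1)) * ℓ / h.count1 M.H k s a)
        + 10 / 3 * (M.H * ℓ / h.count1 M.H k s a)

lemma sqrt_two_mul_div {v ℓ n : ℝ} (hv : 0 ≤ v) (hℓ : 0 ≤ ℓ) :
    √(2 * v * ℓ / n) = √(2 * ℓ) / √n * √v := by
  rw [show 2 * v * ℓ / n = (2 * ℓ) / n * v by ring, Real.sqrt_mul' _ hv,
    Real.sqrt_div (by positivity)]

/-- The Bernstein width involves the unknown `V`, the bonus the known `U`. Since the standard
deviation is a seminorm and `‖V - U‖ ≤ ‖U - L‖`, the `B_v` term pays for the exchange. The additive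
constants match exactly: `φ` and `4 J` contribute `2 / 3 + 8 / 3 = 10 / 3`. The `B_p` term is only
used as nonnegative. -/
lemma width_le_transBonus {H : ℕ} {ℓ : ℝ} (hℓ : 0 ≤ ℓ) (h : History S A) (k : ℕ) (s : S) (a : A)
    {V U L : S → ℝ} (hVU : ∀ x, |V x - U x| ≤ |U x - L x|) :
    √(2 * varOf (h.pHat H k s a) V * ℓ / h.count1 H k s a)
        + 10 / 3 * (H * ℓ / h.count1 H k s a) ≤ transBonus H ℓ h k s a U L := by
  have hp := h.pHat_nonneg H k s a
  have h1 := h.sqrt_varOf_pHat_le H k s a V U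
  have h2 : norm2Of (h.pHat H k s a) (fun x => V x - U x) ≤
      norm2Of (h.pHat H k s a) (fun x => U x - L x) := norm2Of_mono hp hVU
  have h3 := h.count1_pos H k s a
  unfold transBonus phi constBv constBp constJ
  rw [sqrt_two_mul_div (varOf_nonneg hp V) hℓ, sqrt_two_mul_div (varOf_nonneg hp U) hℓ]
  have h4 : √(2 * ℓ) / √(h.count1 H k s a) * √(varOf (h.pHat H k s a) V) ≤
      √(2 * ℓ) / √(h.count1 H k s a) * (√(varOf (h.pHat H k s a) U)
        + norm2Of (h.pHat H k s a) (fun x => U x - L x)) :=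
    mul_le_mul_of_nonneg_left (h1.trans (add_le_add le_rfl h2)) (by positivity)
  have h5 : 0 ≤ H * √(2 * ℓ) / h.count1 H k s a := by positivity
  have h6 : √(2 * ℓ) * norm2Of (h.pHat H k s a) (fun x => U x - L x) / √(h.count1 H k s a) =
      √(2 * ℓ) / √(h.count1 H k s a) * norm2Of (h.pHat H k s a) (fun x => U x - L x) := by ring
  have h7 : 2 * H * ℓ / (3 * h.count1 H k s a)
      + (4 * (2 * H * ℓ / 3) + H * √(2 * ℓ)) / h.count1 H k s a =
      10 / 3 * (H * ℓ / h.count1 H k s a) + H * √(2 * ℓ) / h.count1 H k s a := by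
    field_simp; ring
  rw [h6]
  linarith

/-- The order relations between the estimates and the optimal values. -/
structure Brackets (M : FiniteMDP S A) (ℓ : ℝ) (h : History S A) (k : ℕ) : Prop where
  lower_nonneg : ∀ t s, 0 ≤ (estimates M.H ℓ h k).2 t s
  lower_le : ∀ t ≤ M.H, ∀ s, (estimates M.H ℓ h k).2 t s ≤ M.optValue t s
  le_upper : ∀ t ≤ M.H, ∀ s, M.optValue t s ≤ (estimates M.H ℓ h k).1 t s
  upper_le : ∀ t s, (estimates M.H ℓ h k).1 t s ≤ (M.H : ℝ) - t

lemma optimal_le_qUpper {M : FiniteMDP S A} {ℓ : ℝ} (hℓ : 0 ≤ ℓ) {h : History S A} {k t : ℕ}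
    (hacc : IsAccurate M ℓ h k) (ht : t < M.H) {U L : S → ℝ}
    (hL : ∀ x, L x ≤ M.optValue (t + 1) x) (hU : ∀ x, M.optValue (t + 1) x ≤ U x) (s : S) (a : A) :
    M.r s a + meanOf (M.p s a) (M.optValue (t + 1)) ≤ qUpper M.H ℓ h k U L s a := by
  have h1 := (abs_le.mp (hacc.reward s a)).1
  have h2 := (abs_le.mp (hacc.trans s a t ht)).1
  have h3 := width_le_transBonus (H := M.H) hℓ h k s a (V := M.optValue (t + 1)) (U := U) (L := L)
    (fun x => by
      rw [abs_sub_comm, abs_of_nonneg (by linarith [hU x]),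
        abs_of_nonneg (by linarith [hU x, hL x])]
      linarith [hL x])
  have h4 := meanOf_mono (h.pHat_nonneg M.H k s a) hU
  unfold qUpper
  linarith

lemma qLower_le_optimal {M : FiniteMDP S A} {ℓ : ℝ} (hℓ : 0 ≤ ℓ) {h : History S A} {k t : ℕ}
    (hacc : IsAccurate M ℓ h k) (ht : t < M.H) {U L : S → ℝ}
    (hL : ∀ x, L x ≤ M.optValue (t + 1) x) (hU : ∀ x, M.optValue (t + 1) x ≤ U x) (s : S) (a : A) :
    qLower M.H ℓ h k U L s a ≤ M.r s a + meanOf (M.p s a) (M.optValue (t + 1)) := by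
  have h1 := (abs_le.mp (hacc.reward s a)).2
  have h2 := (abs_le.mp (hacc.trans s a t ht)).2
  have h3 := width_le_transBonus (H := M.H) hℓ h k s a (V := M.optValue (t + 1)) (U := L) (L := U)
    (fun x => by
      rw [abs_of_nonneg (by linarith [hL x]), abs_sub_comm,
        abs_of_nonneg (by linarith [hU x, hL x])]
      linarith [hU x])
  have h4 := meanOf_mono (h.pHat_nonneg M.H k s a) hL
  unfold qLower
  linarith

/-- The induction runs over episodes alone: a backup uses only estimates from before the episode, so
no backward induction over time is needed. The pessimistic backup of any action is below `V*`. The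
optimistic backup of the greedy action dominates that of an optimal action, hence `V*`. -/
theorem brackets_of_isAccurate [Finite A] [Nonempty A] {M : FiniteMDP S A} {ℓ : ℝ} (hℓ : 0 ≤ ℓ)
    {h : History S A} {K : ℕ} (hacc : ∀ k < K, IsAccurate M ℓ h k)
    (hgreedy : ∀ k < K, ∀ t < M.H, ∀ a,
      qBar M.H ℓ h k t (h.state k t) a ≤ qBar M.H ℓ h k t (h.state k t) (h.action k t)) :
    ∀ k ≤ K, Brackets M ℓ h k := by
  intro k hk
  induction k with
  | zero =>
    refine ⟨fun t s => le_rfl, fun t _ s => M.optValue_nonneg t s,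
      fun t ht s => M.optValue_le_sub ht s, fun t s => le_rfl⟩
  | succ k ih =>
    have hb := ih (by omega)
    have ha := hacc k (by omega)
    refine ⟨fun t s => ?_, fun t ht s => ?_, fun t ht s => ?_, fun t s => ?_⟩
    · simp only [estimates]
      split_ifs
      · exact le_max_of_le_left (hb.lower_nonneg t s)
      · exact hb.lower_nonneg t s
    · simp only [estimates]
      split_ifs with hc
      · refine max_le (hb.lower_le t ht s) ((qLower_le_optimal hℓ ha hc.1
          (hb.lower_le _ hc.1) (hb.le_upper _ hc.1) s _).trans (M.le_optValue hc.1 s _))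
      · exact hb.lower_le t ht s
    · simp only [estimates]
      split_ifs with hc
      · refine le_min (hb.le_upper t ht s) ?_
        obtain ⟨a, haa⟩ := M.exists_optValue_eq hc.1 s
        rw [← haa]
        refine (optimal_le_qUpper hℓ ha hc.1 (hb.lower_le _ hc.1) (hb.le_upper _ hc.1) s a).trans ?_
        have := hgreedy k (by omega) t hc.1 a
        rw [hc.2] at this
        exact this
      · exact hb.le_upper t ht s
    · simp only [estimates]
      split_ifs
      · exact min_le_of_left_le (hb.upper_le t s)
      · exact hb.upper_le t s

end EulerGP

/-! ### Empirical Bernstein bounds for the model -/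

/-- The slopes of the exponential bounds used for the empirical Bernstein inequality. -/
def gridSlope (N j : ℕ) : ℝ := if j = 0 then 1 / 2 else ((j : ℝ) / N) / (1 + (j : ℝ) / N)

/-- The coefficients of the quadratic terms that belong to `gridSlope`. -/
def gridCurv (N j : ℕ) : ℝ :=
  if j = 0 then 1 / 5 else gridSlope N j ^ 2 / (2 * (1 - gridSlope N j))

lemma exp_grid_le (N j : ℕ) {y : ℝ} (hy : |y| ≤ 1) :
    Real.exp (gridSlope N j * y - gridCurv N j * y ^ 2) ≤ 1 + gridSlope N j * y := by
  by_cases hj : j = 0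
  · simp only [gridSlope, gridCurv, hj, if_true]
    exact exp_half_mul_sub_le_one_add hy
  · have h1 : gridSlope N j = ((j : ℝ) / N) / (1 + (j : ℝ) / N) := by simp [gridSlope, hj]
    have h2 : gridCurv N j = gridSlope N j ^ 2 / (2 * (1 - gridSlope N j)) := by
      simp [gridCurv, hj]
    rw [h2]
    have h3 : (0 : ℝ) ≤ (j : ℝ) / N := by positivity
    apply exp_mul_sub_le_one_add _ _ hy
    · rw [h1]; positivity
    · rw [h1, div_lt_one (by positivity)]; linarith

/-- The exponential bounds of the grid for a sum `T` with sum of squares `Q`. -/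
def GridBound (N : ℕ) (L T Q : ℝ) : Prop :=
  ∀ j ∈ Finset.range (N + 1), gridSlope N j * T - gridCurv N j * Q ≤ L - 1

section FinsetBernstein

variable {ι : Type*} {B : Finset ι} {X : ι → ℝ} {μ L : ℝ} {N : ℕ}

/-- The empirical variance of `X` over `B`. -/
def empVar (B : Finset ι) (X : ι → ℝ) : ℝ :=
  (∑ i ∈ B, (X i - (∑ i ∈ B, X i) / B.card) ^ 2) / B.card

lemma card_mul_empVar_add (hB : 0 < B.card) (X : ι → ℝ) (μ : ℝ) :
    B.card * (empVar B X + ((∑ i ∈ B, X i) / B.card - μ) ^ 2) = ∑ i ∈ B, (X i - μ) ^ 2 := by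
  have hn : (B.card : ℝ) ≠ 0 := by exact_mod_cast hB.ne'
  set m := (∑ i ∈ B, X i) / B.card with hm
  have h0 : ∑ i ∈ B, (X i - m) = 0 := by
    rw [Finset.sum_sub_distrib, Finset.sum_const, nsmul_eq_mul, hm, mul_div_cancel₀ _ hn, sub_self]
  have h1 : ∀ i, (X i - μ) ^ 2 = (X i - m) ^ 2 + (2 * (m - μ) * (X i - m) + (m - μ) ^ 2) :=
    fun i => by ring
  simp_rw [h1]
  rw [Finset.sum_add_distrib, Finset.sum_add_distrib, ← Finset.mul_sum, h0, Finset.sum_const,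
    nsmul_eq_mul, mul_zero, zero_add, mul_add, empVar, ← hm, mul_div_cancel₀ _ hn]

lemma empVar_nonneg (B : Finset ι) (X : ι → ℝ) : 0 ≤ empVar B X := by
  unfold empVar; positivity

lemma mean_sub_le_of_gridBound (hB : 0 < B.card) (hX : ∀ i ∈ B, X i ∈ Set.Icc (0 : ℝ) 1)
    (hμ : μ ∈ Set.Icc (0 : ℝ) 1) (hL : 2 ≤ L) (hN : B.card * L ≤ (N : ℝ) ^ 2)
    (h : GridBound N L (∑ i ∈ B, (X i - μ)) (∑ i ∈ B, (X i - μ) ^ 2)) :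
    (∑ i ∈ B, X i) / B.card - μ ≤ √(2 * empVar B X * L / B.card) + 10 / 3 * (L / B.card) := by
  have hn : (0 : ℝ) < B.card := by exact_mod_cast hB
  set m := (∑ i ∈ B, X i) / B.card with hm
  have hQ := card_mul_empVar_add hB X μ
  have hT : B.card * (m - μ) = ∑ i ∈ B, (X i - μ) := by
    rw [Finset.sum_sub_distrib, Finset.sum_const, nsmul_eq_mul, mul_sub, hm,
      mul_div_cancel₀ _ hn.ne']
  have hm0 : 0 ≤ m := div_nonneg (Finset.sum_nonneg fun i hi => (hX i hi).1) hn.le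
  have hm1 : m ≤ 1 := by
    rw [hm, div_le_one hn]
    calc ∑ i ∈ B, X i ≤ ∑ i ∈ B, (1 : ℝ) := Finset.sum_le_sum fun i hi => (hX i hi).2
      _ = B.card := by simp
  -- Because `X² ≤ X` on `[0, 1]`.
  have hv : empVar B X ≤ m * (1 - m) := by
    have h1 := card_mul_empVar_add hB X 0
    have h2 : ∑ i ∈ B, (X i - 0) ^ 2 ≤ ∑ i ∈ B, X i := Finset.sum_le_sum fun i hi => by
      have := hX i hi
      nlinarith [this.1, this.2]
    have h3 : ∑ i ∈ B, X i = B.card * m := by rw [hm, mul_div_cancel₀ _ hn.ne']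
    rw [h3, ← h1] at h2
    have := le_of_mul_le_mul_left h2 hn
    rw [← hm] at this
    nlinarith
  rw [← hT, ← hQ] at h
  refine le_empirical_bernstein hn hL hN (empVar_nonneg B X) ?_ ?_ ?_ ?_
  · have h1 : (B.card : ℝ) * (empVar B X + (m - μ) ^ 2) ≤ B.card * 1 := by
      rw [hQ]
      calc ∑ i ∈ B, (X i - μ) ^ 2 ≤ ∑ i ∈ B, (1 : ℝ) := Finset.sum_le_sum fun i hi => by
            have := hX i hi
            rw [sq_le_one_iff_abs_le_one, abs_le]
            constructor <;> linarith [this.1, this.2, hμ.1, hμ.2]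
        _ = B.card * 1 := by simp
    exact le_of_mul_le_mul_left h1 hn
  -- `x (1 - x)` decreases for `x ≥ 1 / 2`, and `1 / 2 ≤ m - μ ≤ m`.
  · intro hs
    have hμ0 := hμ.1
    nlinarith
  · intro j hj
    obtain ⟨hj1, hj2⟩ := Finset.mem_Icc.1 hj
    have := h j (Finset.mem_range.2 (by omega))
    simp only [gridCurv, gridSlope, if_neg (show j ≠ 0 by omega)] at this
    linarith
  · have := h 0 (Finset.mem_range.2 (by omega))
    simp only [gridCurv, gridSlope, if_true] at this
    linarith

/-- Lower deviations of `X` are upper deviations of `1 - X`, which has the same empirical variance.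
-/
lemma abs_mean_sub_le_of_gridBound (hB : 0 < B.card) (hX : ∀ i ∈ B, X i ∈ Set.Icc (0 : ℝ) 1)
    (hμ : μ ∈ Set.Icc (0 : ℝ) 1) (hL : 2 ≤ L) (hN : B.card * L ≤ (N : ℝ) ^ 2)
    (h : GridBound N L (∑ i ∈ B, (X i - μ)) (∑ i ∈ B, (X i - μ) ^ 2))
    (h' : GridBound N L (-∑ i ∈ B, (X i - μ)) (∑ i ∈ B, (X i - μ) ^ 2)) :
    |(∑ i ∈ B, X i) / B.card - μ| ≤ √(2 * empVar B X * L / B.card) + 10 / 3 * (L / B.card) := by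
  have hn : (B.card : ℝ) ≠ 0 := by exact_mod_cast hB.ne'
  have hmean : (∑ i ∈ B, (1 - X i)) / B.card = 1 - (∑ i ∈ B, X i) / B.card := by
    rw [Finset.sum_sub_distrib, sub_div]; simp [hn]
  have hvar : empVar B (fun i => 1 - X i) = empVar B X := by
    rw [empVar, empVar, hmean]
    congr 1
    exact Finset.sum_congr rfl fun i _ => by ring
  have hlow := mean_sub_le_of_gridBound (X := fun i => 1 - X i) (μ := 1 - μ) hB
    (fun i hi => ⟨by linarith [(hX i hi).2], by linarith [(hX i hi).1]⟩)
    ⟨by linarith [hμ.2], by linarith [hμ.1]⟩ hL hN (by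
      have e1 : ∑ i ∈ B, (1 - X i - (1 - μ)) = -∑ i ∈ B, (X i - μ) := by
        rw [← Finset.sum_neg_distrib]
        exact Finset.sum_congr rfl fun i _ => by ring
      have e2 : ∑ i ∈ B, (1 - X i - (1 - μ)) ^ 2 = ∑ i ∈ B, (X i - μ) ^ 2 :=
        Finset.sum_congr rfl fun i _ => by ring
      rw [e1, e2]; exact h')
  have hup := mean_sub_le_of_gridBound hB hX hμ hL hN h
  rw [hmean, hvar] at hlow
  rw [abs_le]
  constructor <;> linarith

end FinsetBernstein

namespace EulerGP

variable {S A : Type*} [Fintype S] [DecidableEq S] [DecidableEq A]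

/-- The bounds on the grid that imply `IsAccurate`, for sums over the first `k` episodes. -/
structure GridAccurate (M : FiniteMDP S A) (ℓ : ℝ) (N : ℕ) (h : History S A) (k : ℕ) : Prop where
  reward_mem : ∀ j < k, ∀ t < M.H, h.reward j t ∈ Set.Icc (0 : ℝ) 1
  reward : ∀ s a, GridBound N ℓ (∑ i ∈ h.visits M.H k s a, (h.reward i.1 i.2 - M.r s a))
    (∑ i ∈ h.visits M.H k s a, (h.reward i.1 i.2 - M.r s a) ^ 2)
  reward_neg : ∀ s a, GridBound N ℓ (-∑ i ∈ h.visits M.H k s a, (h.reward i.1 i.2 - M.r s a))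
    (∑ i ∈ h.visits M.H k s a, (h.reward i.1 i.2 - M.r s a) ^ 2)
  trans : ∀ s a, ∀ t < M.H, GridBound N ℓ
    (∑ i ∈ h.visits M.H k s a, (M.optValue (t + 1) (h.state i.1 (i.2 + 1)) / M.H
      - meanOf (M.p s a) (M.optValue (t + 1)) / M.H))
    (∑ i ∈ h.visits M.H k s a, (M.optValue (t + 1) (h.state i.1 (i.2 + 1)) / M.H
      - meanOf (M.p s a) (M.optValue (t + 1)) / M.H) ^ 2)
  trans_neg : ∀ s a, ∀ t < M.H, GridBound N ℓ
    (-∑ i ∈ h.visits M.H k s a, (M.optValue (t + 1) (h.state i.1 (i.2 + 1)) / M.H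
      - meanOf (M.p s a) (M.optValue (t + 1)) / M.H))
    (∑ i ∈ h.visits M.H k s a, (M.optValue (t + 1) (h.state i.1 (i.2 + 1)) / M.H
      - meanOf (M.p s a) (M.optValue (t + 1)) / M.H) ^ 2)

end EulerGP

lemma History.count_le {S A : Type*} [DecidableEq S] [DecidableEq A] (h : History S A)
    (H k : ℕ) (s : S) (a : A) : h.count H k s a ≤ k * H := by
  unfold History.count History.visits
  refine (Finset.card_filter_le _ _).trans ?_
  simp

namespace EulerGP

variable {S A : Type*} [Fintype S] [DecidableEq S] [DecidableEq A]

/-- Rewards and `V* / H` lie in `[0, 1]`, so the empirical Bernstein inequality applies to both.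
Without data the estimates are `0` and the divisor is `1`; then the additive terms alone exceed the
ranges `1` and `H`, since `ℓ ≥ 2`. -/
lemma GridAccurate.isAccurate [Nonempty A] {M : FiniteMDP S A} {ℓ : ℝ} {N : ℕ}
    {h : History S A} {k : ℕ} (hg : GridAccurate M ℓ N h k) (hℓ : 2 ≤ ℓ)
    (hN : (k * M.H : ℕ) * ℓ ≤ (N : ℝ) ^ 2) : IsAccurate M ℓ h k := by
  have hcard : ∀ s a, (h.count M.H k s a : ℝ) * ℓ ≤ (N : ℝ) ^ 2 := fun s a =>
    le_trans (mul_le_mul_of_nonneg_right (by exact_mod_cast h.count_le M.H k s a)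
      (by linarith)) hN
  have hHpos : (0 : ℝ) < M.H := by exact_mod_cast M.H_pos
  constructor
  · intro s a
    rcases Nat.eq_zero_or_pos (h.count M.H k s a) with hn | hn
    · have h1 : h.rHat M.H k s a = 0 := by simp [History.rHat, hn]
      have h2 : h.count1 M.H k s a = 1 := by simp [History.count1, hn]
      rw [h1, zero_sub, abs_neg, abs_of_nonneg (M.r_nonneg s a), rewardBonus, h2]
      have h3 := M.r_le_one s a
      have h4 := Real.sqrt_nonneg (2 * h.varHat M.H k s a * ℓ / 1)
      linarith
    · have hmain := abs_mean_sub_le_of_gridBound (B := h.visits M.H k s a)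
        (X := fun i => h.reward i.1 i.2) hn (fun i hi => ?_)
        ⟨M.r_nonneg s a, M.r_le_one s a⟩ hℓ (hcard s a) (hg.reward s a) (hg.reward_neg s a)
      · have hn' : (0 : ℝ) < h.count M.H k s a := by exact_mod_cast hn
        refine hmain.trans ?_
        rw [rewardBonus, h.count1_of_pos hn]
        change √(2 * empVar _ _ * ℓ / (h.count M.H k s a : ℝ))
          + 10 / 3 * (ℓ / (h.count M.H k s a : ℝ)) ≤ _
        -- The sample variance divides by `n - 1`, so it is the larger one; for `n = 1` both are
        -- `0`.
        have hv : empVar (h.visits M.H k s a) (fun i => h.reward i.1 i.2) ≤ h.varHat M.H k s a := by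
          rcases Nat.lt_or_ge 1 (h.count M.H k s a) with h1 | h1
          · have h1' : (1 : ℝ) < h.count M.H k s a := by exact_mod_cast h1
            exact div_le_div_of_nonneg_left (Finset.sum_nonneg fun _ _ => sq_nonneg _)
              (sub_pos.2 h1') (sub_le_self _ zero_le_one)
          · have h2 : h.count M.H k s a = 1 := by omega
            obtain ⟨i, hi⟩ := Finset.card_eq_one.1 h2
            simp [History.varHat, h2, empVar, hi]
        have h5 : 10 / 3 * (ℓ / (h.count M.H k s a : ℝ)) ≤
            14 * ℓ / (3 * (h.count M.H k s a : ℝ)) := by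
          have : 14 * ℓ / (3 * (h.count M.H k s a : ℝ)) =
            14 / 3 * (ℓ / (h.count M.H k s a : ℝ)) := by field_simp
          rw [this]
          have : 0 ≤ ℓ / (h.count M.H k s a : ℝ) := by positivity
          linarith
        refine add_le_add (Real.sqrt_le_sqrt ?_) h5
        gcongr
      · obtain ⟨h1, -⟩ := Finset.mem_filter.1 hi
        obtain ⟨h2, h3⟩ := Finset.mem_product.1 h1
        exact hg.reward_mem _ (Finset.mem_range.1 h2) _ (Finset.mem_range.1 h3)
  · intro s a t ht
    set V := M.optValue (t + 1) with hV
    have hV0 : ∀ x, 0 ≤ V x := M.optValue_nonneg (t + 1)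
    have hV1 : ∀ x, V x ≤ M.H := M.optValue_le (t + 1)
    have hpV0 := meanOf_nonneg (M.p_nonneg s a) hV0
    have hpV1 := meanOf_le (M.p_nonneg s a) (M.p_sum s a).le hHpos.le hV1
    rcases Nat.eq_zero_or_pos (h.count M.H k s a) with hn | hn
    · have h2 : h.count1 M.H k s a = 1 := by simp [History.count1, hn]
      rw [h2, h.pHat_of_count_eq_zero hn]
      simp only [meanOf, zero_mul, Finset.sum_const_zero, zero_sub, abs_neg]
      change |meanOf (M.p s a) V| ≤ _
      rw [abs_of_nonneg hpV0]
      have h4 := Real.sqrt_nonneg (2 * varOf (fun _ => 0) V * ℓ / 1)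
      nlinarith
    · have hn' : (0 : ℝ) < h.count M.H k s a := by exact_mod_cast hn
      have hmain := abs_mean_sub_le_of_gridBound (B := h.visits M.H k s a)
        (X := fun i => V (h.state i.1 (i.2 + 1)) / M.H)
        (μ := meanOf (M.p s a) V / M.H) hn
        (fun i _ => ⟨div_nonneg (hV0 _) hHpos.le, (div_le_one hHpos).2 (hV1 _)⟩)
        ⟨div_nonneg hpV0 hHpos.le, (div_le_one hHpos).2 hpV1⟩ hℓ (hcard s a)
        (hg.trans s a t ht) (hg.trans_neg s a t ht)
      rw [h.count1_of_pos hn]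
      have hmean : ∀ W : S → ℝ, (∑ i ∈ h.visits M.H k s a, W (h.state i.1 (i.2 + 1)))
          / ((h.visits M.H k s a).card : ℝ) = meanOf (h.pHat M.H k s a) W := by
        intro W
        rw [h.sum_pHat_mul, ← h.sum_visits M.H k s a (fun j t => W (h.state j (t + 1)))]
        rfl
      have e1 : (∑ i ∈ h.visits M.H k s a, V (h.state i.1 (i.2 + 1)) / M.H)
          / ((h.visits M.H k s a).card : ℝ) = meanOf (h.pHat M.H k s a) V / M.H := by
        rw [← Finset.sum_div, div_right_comm, hmean V]
      have e2 : empVar (h.visits M.H k s a) (fun i => V (h.state i.1 (i.2 + 1)) / M.H) =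
          varOf (h.pHat M.H k s a) V / M.H ^ 2 := by
        unfold empVar
        rw [e1]
        have : varOf (h.pHat M.H k s a) V = meanOf (h.pHat M.H k s a)
          (fun x => (V x - meanOf (h.pHat M.H k s a) V) ^ 2) := rfl
        rw [this, ← hmean (fun x => (V x - meanOf (h.pHat M.H k s a) V) ^ 2), div_right_comm]
        congr 1
        rw [Finset.sum_div]
        exact Finset.sum_congr rfl fun i _ => by rw [← sub_div, div_pow]
      rw [e1, e2, ← sub_div, abs_div, abs_of_pos hHpos, div_le_iff₀ hHpos] at hmain
      refine hmain.trans (le_of_eq ?_)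
      change (√(2 * (varOf (h.pHat M.H k s a) V / M.H ^ 2) * ℓ / (h.count M.H k s a : ℝ))
          + 10 / 3 * (ℓ / (h.count M.H k s a : ℝ))) * M.H = _
      rw [show 2 * (varOf (h.pHat M.H k s a) V / M.H ^ 2) * ℓ / (h.count M.H k s a : ℝ) =
        (2 * varOf (h.pHat M.H k s a) V * ℓ / (h.count M.H k s a : ℝ)) / (M.H : ℝ) ^ 2 by
          field_simp, Real.sqrt_div' _ (by positivity), Real.sqrt_sq hHpos.le]
      field_simp

end EulerGP

namespace EulerGPRun

variable {S A Ω : Type*} [Fintype S] [DecidableEq S] [Fintype A] [DecidableEq A]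
  [mΩ : MeasurableSpace Ω] {M : FiniteMDP S A} {K : ℕ} {δ : ℝ} {P : Measure Ω}

/-- The indicator of a visit of `(s, a)`. -/
def visitInd (run : EulerGPRun M K δ P) (s : S) (a : A) (k t : ℕ) (ω : Ω) : ℝ :=
  if run.state k t ω = s ∧ run.action k t ω = a then 1 else 0

lemma measurable_visitInd (run : EulerGPRun M K δ P) (s : S) (a : A) {k t : ℕ} (hk : k < K)
    (ht : t < M.H) : Measurable[run.info k t] (run.visitInd s a k t) :=
  Measurable.ite (run.measurableSet_pair_eq hk ht s a) measurable_const measurable_const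

lemma abs_visitInd_le (run : EulerGPRun M K δ P) (s : S) (a : A) (k t : ℕ) (ω : Ω) :
    |run.visitInd s a k t ω| ≤ 1 := by
  unfold visitInd; split_ifs <;> simp

lemma sum_visits_eq (run : EulerGPRun M K δ P) (s : S) (a : A) (k : ℕ) (ω : Ω)
    (F : ℕ → ℕ → ℝ) :
    ∑ i ∈ (run.hist ω).visits M.H k s a, F i.1 i.2 = ∑ j ∈ Finset.range k,
      ∑ t ∈ Finset.range M.H, run.visitInd s a j t ω * F j t := by
  rw [History.sum_visits]
  refine Finset.sum_congr rfl fun j _ => Finset.sum_congr rfl fun t _ => ?_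
  simp only [visitInd, ite_mul, one_mul, zero_mul]
  rfl

lemma visitInd_mul_sq (run : EulerGPRun M K δ P) (s : S) (a : A) (k t : ℕ) (ω : Ω) (x : ℝ) :
    (run.visitInd s a k t ω * x) ^ 2 = run.visitInd s a k t ω * x ^ 2 := by
  unfold visitInd; split_ifs <;> simp

lemma abs_visitInd_mul_le {run : EulerGPRun M K δ P} {s : S} {a : A} {k t : ℕ} {ω : Ω} {x : ℝ}
    (hx : |x| ≤ 1) : |run.visitInd s a k t ω * x| ≤ 1 := by
  rw [abs_mul]
  exact mul_le_one₀ (run.abs_visitInd_le s a k t ω) (abs_nonneg _) hx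

lemma abs_sub_le_one {x y : ℝ} (hx : x ∈ Set.Icc (0 : ℝ) 1) (hy : y ∈ Set.Icc (0 : ℝ) 1) :
    |x - y| ≤ 1 := by
  rw [abs_le]; constructor <;> linarith [hx.1, hx.2, hy.1, hy.2]

variable [IsProbabilityMeasure P]

lemma measureReal_exists_not_gridBound_le (run : EulerGPRun M K δ P) {Y : ℕ → ℕ → Ω → ℝ}
    (hY : ∀ k < K, ∀ t < M.H, run.IsDiff k t (Y k t))
    (hb : ∀ k < K, ∀ t < M.H, ∀ᵐ ω ∂P, |Y k t ω| ≤ 1) (N : ℕ) (L : ℝ) :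
    P.real {ω | ∃ k ≤ K, ¬GridBound N L (∑ j ∈ Finset.range k, ∑ t ∈ Finset.range M.H, Y j t ω)
      (∑ j ∈ Finset.range k, ∑ t ∈ Finset.range M.H, Y j t ω ^ 2)} ≤
      (N + 1) * Real.exp (-(L - 1)) := by
  have hsub : {ω | ∃ k ≤ K, ¬GridBound N L
      (∑ j ∈ Finset.range k, ∑ t ∈ Finset.range M.H, Y j t ω)
      (∑ j ∈ Finset.range k, ∑ t ∈ Finset.range M.H, Y j t ω ^ 2)} ⊆
      ⋃ i ∈ Finset.range (N + 1), {ω | ∃ k ≤ K, L - 1 <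
        gridSlope N i * ∑ j ∈ Finset.range k, ∑ t ∈ Finset.range M.H, Y j t ω
        - gridCurv N i * ∑ j ∈ Finset.range k, ∑ t ∈ Finset.range M.H, Y j t ω ^ 2} := by
    rintro ω ⟨k, hk, h⟩
    unfold GridBound at h
    push Not at h
    obtain ⟨i, hi, h⟩ := h
    exact Set.mem_biUnion hi ⟨k, hk, h⟩
  refine (measureReal_mono hsub (measure_ne_top _ _)).trans ((measureReal_biUnion_finset_le _ _).trans ?_)
  refine (Finset.sum_le_sum fun i _ => run.measureReal_exists_lt_le_exp hY hb
    (fun y hy => exp_grid_le N i hy) (L - 1)).trans ?_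
  simp

lemma measureReal_exists_not_gridBound_two_sided_le (run : EulerGPRun M K δ P)
    {Y : ℕ → ℕ → Ω → ℝ} (hY : ∀ k < K, ∀ t < M.H, run.IsDiff k t (Y k t))
    (hb : ∀ k < K, ∀ t < M.H, ∀ᵐ ω ∂P, |Y k t ω| ≤ 1) (N : ℕ) (L : ℝ) :
    P.real {ω | ¬∀ k ≤ K,
      GridBound N L (∑ j ∈ Finset.range k, ∑ t ∈ Finset.range M.H, Y j t ω)
        (∑ j ∈ Finset.range k, ∑ t ∈ Finset.range M.H, Y j t ω ^ 2) ∧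
      GridBound N L (-∑ j ∈ Finset.range k, ∑ t ∈ Finset.range M.H, Y j t ω)
        (∑ j ∈ Finset.range k, ∑ t ∈ Finset.range M.H, Y j t ω ^ 2)} ≤
      2 * ((N + 1) * Real.exp (-(L - 1))) := by
  have h1 := run.measureReal_exists_not_gridBound_le hY hb N L
  have h2 := run.measureReal_exists_not_gridBound_le (Y := fun k t ω => -Y k t ω)
    (fun k hk t ht => (hY k hk t ht).neg)
    (fun k hk t ht => (hb k hk t ht).mono fun ω h => by rwa [abs_neg]) N L
  simp only [neg_sq, Finset.sum_neg_distrib] at h2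
  refine (measureReal_mono ?_).trans ((measureReal_union_le _ _).trans
    ((add_le_add h1 h2).trans_eq (two_mul _).symm))
  intro ω hω
  by_contra hcon
  simp only [Set.mem_union, Set.mem_ofPred_eq, not_or, not_exists, not_and, not_not] at hcon hω
  exact hω fun k hk => ⟨hcon.1 k hk, hcon.2 k hk⟩

/-- The centred function of the reward at the visits of a fixed pair. -/
lemma isDiff_visit_reward (run : EulerGPRun M K δ P) {φ : ℝ → ℝ} (hφ : Continuous φ) (s : S)
    (a : A) {k t : ℕ} (hk : k < K) (ht : t < M.H) :
    run.IsDiff k t (fun ω => run.visitInd s a k t ω *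
      (φ (run.reward k t ω) - ∫ x, φ x ∂(M.R s a))) := by
  have h := (run.isDiff_reward hk ht hφ).mul_left ht (run.measurable_visitInd s a hk ht)
    (run.abs_visitInd_le s a k t)
  convert h using 2 with ω
  unfold visitInd
  split_ifs with hc
  · rw [hc.1, hc.2]
  · simp

/-- The centred function of the next state at the visits of a fixed pair. -/
lemma isDiff_visit_state (run : EulerGPRun M K δ P) (f : S → ℝ) (s : S) (a : A) {k t : ℕ}
    (hk : k < K) (ht : t < M.H) :
    run.IsDiff k t (fun ω => run.visitInd s a k t ω *
      (f (run.state k (t + 1) ω) - meanOf (M.p s a) f)) := by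
  have h := (run.isDiff_state hk ht (f := fun _ => f) (fun x => measurable_const)
    (C := ∑ x, |f x|) (fun _ x => Finset.single_le_sum (f := fun x => |f x|)
      (fun _ _ => abs_nonneg _) (Finset.mem_univ x))).mul_left ht
    (run.measurable_visitInd s a hk ht) (run.abs_visitInd_le s a k t)
  convert h using 2 with ω
  unfold visitInd
  split_ifs with hc
  · rw [hc.1, hc.2]
  · simp

lemma ae_reward_mem (run : EulerGPRun M K δ P) :
    ∀ᵐ ω ∂P, ∀ k < K, ∀ t < M.H, run.reward k t ω ∈ Set.Icc (0 : ℝ) 1 := by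
  have : ∀ᵐ ω ∂P, ∀ k ∈ Finset.range K, ∀ t ∈ Finset.range M.H,
      run.reward k t ω ∈ Set.Icc (0 : ℝ) 1 :=
    (Finset.eventually_all _).2 fun k hk => (Finset.eventually_all _).2 fun t ht =>
      run.reward_mem (Finset.mem_range.1 hk) (Finset.mem_range.1 ht)
  simpa using this

/-- The union runs over the pairs for the rewards, over the pairs and time-steps for `V* / H`, over
two signs and over `N + 1` slopes. The number of visits costs nothing, as the bounds hold at the
ends of all episodes simultaneously. -/
theorem measureReal_not_gridAccurate_le [Nonempty A] (run : EulerGPRun M K δ P) (N : ℕ) (L : ℝ) :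
    P.real {ω | ¬∀ k ≤ K, EulerGP.GridAccurate M L N (run.hist ω) k} ≤
      (Fintype.card S * Fintype.card A + Fintype.card S * Fintype.card A * M.H)
        * (2 * ((N + 1) * Real.exp (-(L - 1)))) := by
  have hHpos : (0 : ℝ) < M.H := by exact_mod_cast M.H_pos
  set e := 2 * ((N + 1) * Real.exp (-(L - 1))) with he
  set B1 : S × A → Set Ω := fun x => {ω | ¬∀ k ≤ K,
      GridBound N L (∑ j ∈ Finset.range k, ∑ t ∈ Finset.range M.H,
        run.visitInd x.1 x.2 j t ω * (run.reward j t ω - M.r x.1 x.2))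
        (∑ j ∈ Finset.range k, ∑ t ∈ Finset.range M.H,
        (run.visitInd x.1 x.2 j t ω * (run.reward j t ω - M.r x.1 x.2)) ^ 2) ∧
      GridBound N L (-∑ j ∈ Finset.range k, ∑ t ∈ Finset.range M.H,
        run.visitInd x.1 x.2 j t ω * (run.reward j t ω - M.r x.1 x.2))
        (∑ j ∈ Finset.range k, ∑ t ∈ Finset.range M.H,
        (run.visitInd x.1 x.2 j t ω * (run.reward j t ω - M.r x.1 x.2)) ^ 2)} with hB1
  set f : ℕ → S → ℝ := fun τ y => M.optValue (τ + 1) y / M.H with hf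
  have hf01 : ∀ τ y, f τ y ∈ Set.Icc (0 : ℝ) 1 := fun τ y =>
    ⟨div_nonneg (M.optValue_nonneg _ y) hHpos.le, (div_le_one hHpos).2 (M.optValue_le _ y)⟩
  have hpf01 : ∀ τ s a, meanOf (M.p s a) (f τ) ∈ Set.Icc (0 : ℝ) 1 := fun τ s a =>
    ⟨meanOf_nonneg (M.p_nonneg s a) fun y => (hf01 τ y).1,
      meanOf_le (M.p_nonneg s a) (M.p_sum s a).le zero_le_one fun y => (hf01 τ y).2⟩
  set B2 : (S × A) × Fin M.H → Set Ω := fun x => {ω | ¬∀ k ≤ K,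
      GridBound N L (∑ j ∈ Finset.range k, ∑ t ∈ Finset.range M.H,
        run.visitInd x.1.1 x.1.2 j t ω * (f x.2 (run.state j (t + 1) ω)
          - meanOf (M.p x.1.1 x.1.2) (f x.2)))
        (∑ j ∈ Finset.range k, ∑ t ∈ Finset.range M.H,
        (run.visitInd x.1.1 x.1.2 j t ω * (f x.2 (run.state j (t + 1) ω)
          - meanOf (M.p x.1.1 x.1.2) (f x.2))) ^ 2) ∧
      GridBound N L (-∑ j ∈ Finset.range k, ∑ t ∈ Finset.range M.H,
        run.visitInd x.1.1 x.1.2 j t ω * (f x.2 (run.state j (t + 1) ω)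
          - meanOf (M.p x.1.1 x.1.2) (f x.2)))
        (∑ j ∈ Finset.range k, ∑ t ∈ Finset.range M.H,
        (run.visitInd x.1.1 x.1.2 j t ω * (f x.2 (run.state j (t + 1) ω)
          - meanOf (M.p x.1.1 x.1.2) (f x.2))) ^ 2)} with hB2
  have hP1 : ∀ x, P.real (B1 x) ≤ e := fun x =>
    run.measureReal_exists_not_gridBound_two_sided_le
      (fun k hk t ht => run.isDiff_visit_reward continuous_id x.1 x.2 hk ht)
      (fun k hk t ht => by
        filter_upwards [run.reward_mem hk ht] with ω hω
        exact abs_visitInd_mul_le (abs_sub_le_one hω ⟨M.r_nonneg _ _, M.r_le_one _ _⟩)) N L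
  have hP2 : ∀ x, P.real (B2 x) ≤ e := fun x =>
    run.measureReal_exists_not_gridBound_two_sided_le
      (fun k hk t ht => run.isDiff_visit_state (f x.2) x.1.1 x.1.2 hk ht)
      (fun k hk t ht => Filter.Eventually.of_forall fun ω =>
        abs_visitInd_mul_le (abs_sub_le_one (hf01 _ _) (hpf01 _ _ _))) N L
  have hsub : {ω | ¬∀ k ≤ K, EulerGP.GridAccurate M L N (run.hist ω) k} ≤ᵐ[P]
      ((⋃ x ∈ (Finset.univ : Finset (S × A)), B1 x) ∪
        ⋃ x ∈ (Finset.univ : Finset ((S × A) × Fin M.H)), B2 x : Set Ω) := by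
    filter_upwards [run.ae_reward_mem] with ω hω hbad
    by_contra hcon
    apply hbad
    have hcon' : ω ∉ ((⋃ x ∈ (Finset.univ : Finset (S × A)), B1 x) ∪
        ⋃ x ∈ (Finset.univ : Finset ((S × A) × Fin M.H)), B2 x : Set Ω) := hcon
    simp only [Set.mem_union, Set.mem_iUnion, Finset.mem_univ, exists_const, not_or, not_exists,
      hB1, hB2, Set.mem_ofPred_eq, not_not] at hcon'
    obtain ⟨h1, h2⟩ := hcon'
    intro k hk
    have e1 : ∀ s a t, meanOf (M.p s a) (M.optValue (t + 1)) / M.H = meanOf (M.p s a) (f t) := by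
      intro s a t
      simp only [hf, meanOf, Finset.sum_div, mul_div_assoc]
    refine ⟨fun j hj t ht => hω j (hj.trans_le hk) t ht, fun s a => ?_, fun s a => ?_,
      fun s a t ht => ?_, fun s a t ht => ?_⟩
    · exact (congrArg₂ (GridBound N L)
        (run.sum_visits_eq s a k ω (fun j t => run.reward j t ω - M.r s a))
        (run.sum_visits_eq s a k ω (fun j t => (run.reward j t ω - M.r s a) ^ 2))).mpr
        (by simpa only [visitInd_mul_sq] using (h1 (s, a) k hk).1)
    · exact (congrArg₂ (GridBound N L)
        (congrArg (-·) (run.sum_visits_eq s a k ω (fun j t => run.reward j t ω - M.r s a)))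
        (run.sum_visits_eq s a k ω (fun j t => (run.reward j t ω - M.r s a) ^ 2))).mpr
        (by simpa only [visitInd_mul_sq] using (h1 (s, a) k hk).2)
    · rw [e1]
      exact (congrArg₂ (GridBound N L)
        (run.sum_visits_eq s a k ω (fun j u => f t (run.state j (u + 1) ω) - meanOf (M.p s a) (f t)))
        (run.sum_visits_eq s a k ω (fun j u => (f t (run.state j (u + 1) ω) - meanOf (M.p s a) (f t)) ^ 2))).mpr
        (by simpa only [visitInd_mul_sq] using (h2 ((s, a), ⟨t, ht⟩) k hk).1)
    · rw [e1]
      exact (congrArg₂ (GridBound N L)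
        (congrArg (-·) (run.sum_visits_eq s a k ω (fun j u => f t (run.state j (u + 1) ω) - meanOf (M.p s a) (f t))))
        (run.sum_visits_eq s a k ω (fun j u => (f t (run.state j (u + 1) ω) - meanOf (M.p s a) (f t)) ^ 2))).mpr
        (by simpa only [visitInd_mul_sq] using (h2 ((s, a), ⟨t, ht⟩) k hk).2)
  have hfin := ENNReal.toReal_mono (measure_ne_top P _) (measure_mono_ae hsub)
  refine (show P.real _ ≤ P.real _ from hfin).trans ((measureReal_union_le _ _).trans ?_)
  rw [add_mul]
  refine add_le_add ?_ ?_
  · refine (measureReal_biUnion_finset_le _ _).trans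
      ((Finset.sum_le_sum fun x _ => hP1 x).trans_eq ?_)
    simp [Fintype.card_prod]
  · refine (measureReal_biUnion_finset_le _ _).trans
      ((Finset.sum_le_sum fun x _ => hP2 x).trans_eq ?_)
    simp [Fintype.card_prod]

end EulerGPRun

/-! ### Sums over episodes and time-steps -/

/-- The sum over the time-steps of the first `k` episodes. -/
def epSum (H k : ℕ) (F : ℕ → ℕ → ℝ) : ℝ := ∑ j ∈ Finset.range k, ∑ t ∈ Finset.range H, F j t

lemma epSum_add (H k : ℕ) (F G : ℕ → ℕ → ℝ) :
    epSum H k (fun j t => F j t + G j t) = epSum H k F + epSum H k G := by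
  simp [epSum, Finset.sum_add_distrib]

lemma epSum_sub (H k : ℕ) (F G : ℕ → ℕ → ℝ) :
    epSum H k (fun j t => F j t - G j t) = epSum H k F - epSum H k G := by
  simp [epSum, Finset.sum_sub_distrib]

lemma epSum_const_mul (H k : ℕ) (c : ℝ) (F : ℕ → ℕ → ℝ) :
    epSum H k (fun j t => c * F j t) = c * epSum H k F := by
  simp [epSum, Finset.mul_sum]

lemma epSum_mono {H k : ℕ} {F G : ℕ → ℕ → ℝ} (h : ∀ j < k, ∀ t < H, F j t ≤ G j t) :
    epSum H k F ≤ epSum H k G :=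
  Finset.sum_le_sum fun j hj => Finset.sum_le_sum fun t ht =>
    h j (Finset.mem_range.1 hj) t (Finset.mem_range.1 ht)

lemma epSum_congr {H k : ℕ} {F G : ℕ → ℕ → ℝ} (h : ∀ j < k, ∀ t < H, F j t = G j t) :
    epSum H k F = epSum H k G :=
  Finset.sum_congr rfl fun j hj => Finset.sum_congr rfl fun t ht =>
    h j (Finset.mem_range.1 hj) t (Finset.mem_range.1 ht)

lemma epSum_nonneg {H k : ℕ} {F : ℕ → ℕ → ℝ} (h : ∀ j < k, ∀ t < H, 0 ≤ F j t) :
    0 ≤ epSum H k F :=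
  Finset.sum_nonneg fun j hj => Finset.sum_nonneg fun t ht =>
    h j (Finset.mem_range.1 hj) t (Finset.mem_range.1 ht)

lemma epSum_const (H k : ℕ) (c : ℝ) : epSum H k (fun _ _ => c) = (k * H : ℕ) * c := by
  simp [epSum, mul_assoc]

lemma epSum_sqrt_mul_le {H k : ℕ} {F G : ℕ → ℕ → ℝ} (hF : ∀ j < k, ∀ t < H, 0 ≤ F j t)
    (hG : ∀ j < k, ∀ t < H, 0 ≤ G j t) :
    epSum H k (fun j t => √(F j t) * √(G j t)) ≤ √(epSum H k F) * √(epSum H k G) := by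
  have h := Real.sum_sqrt_mul_sqrt_le (Finset.range k ×ˢ Finset.range H)
    (f := fun i => max 0 (F i.1 i.2)) (g := fun i => max 0 (G i.1 i.2))
    (fun i => le_max_left _ _) (fun i => le_max_left _ _)
  simp only [Finset.sum_product] at h
  have e : ∀ F : ℕ → ℕ → ℝ, (∀ j < k, ∀ t < H, 0 ≤ F j t) →
      epSum H k (fun j t => max 0 (F j t)) = epSum H k F := fun F hF =>
    epSum_congr fun j hj t ht => max_eq_right (hF j hj t ht)
  rw [← e F hF, ← e G hG]
  refine le_trans (le_of_eq ?_) h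
  exact epSum_congr fun j hj t ht => by
    rw [max_eq_right (hF j hj t ht), max_eq_right (hG j hj t ht)]

/-- A two-sided deviation at the relative scale `1 / 8` gives a multiplicative bound. -/
lemma le_two_mul_add_of_sub_le {Z E x : ℝ} (hE : 0 ≤ E) (hx : 0 ≤ x)
    (h : Z - E ≤ 1 / 8 * (Z + E) + x / (1 / 8)) : Z ≤ 2 * E + 10 * x := by
  linarith

section UnionBound

variable {Ω : Type*} [MeasurableSpace Ω] {P : Measure Ω} [IsProbabilityMeasure P]

lemma measureReal_not_forall_le {ι : Type*} [Fintype ι] {p : ι → Ω → Prop} {e : ℝ}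
    (h : ∀ i, P.real {ω | ¬p i ω} ≤ e) : P.real {ω | ¬∀ i, p i ω} ≤ Fintype.card ι * e := by
  have hsub : {ω | ¬∀ i, p i ω} ⊆ ⋃ i ∈ (Finset.univ : Finset ι), {ω | ¬p i ω} := by
    intro ω hω
    obtain ⟨i, hi⟩ := not_forall.1 hω
    exact Set.mem_biUnion (Finset.mem_coe.2 (Finset.mem_univ i)) hi
  refine (measureReal_mono hsub (measure_ne_top _ _)).trans
    ((measureReal_biUnion_finset_le _ _).trans ?_)
  refine (Finset.sum_le_sum fun i _ => h i).trans_eq ?_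
  simp

lemma measureReal_not_and_le {p q : Ω → Prop} {a b : ℝ} (hp : P.real {ω | ¬p ω} ≤ a)
    (hq : P.real {ω | ¬q ω} ≤ b) : P.real {ω | ¬(p ω ∧ q ω)} ≤ a + b := by
  refine (measureReal_mono (s₂ := {ω | ¬p ω} ∪ {ω | ¬q ω}) fun ω hω => ?_).trans
    ((measureReal_union_le _ _).trans (add_le_add hp hq))
  exact not_and_or.1 hω

lemma measureReal_not_mono {p q : Ω → Prop} {a : ℝ} (h : ∀ ω, p ω → q ω)
    (hp : P.real {ω | ¬p ω} ≤ a) : P.real {ω | ¬q ω} ≤ a :=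
  (measureReal_mono (s₂ := {ω | ¬p ω}) fun ω (hω : ¬q ω) hpω => hω (h ω hpω)).trans hp

lemma measureReal_not_mono_ae {p q : Ω → Prop} {a : ℝ} (h : ∀ᵐ ω ∂P, p ω → q ω)
    (hp : P.real {ω | ¬p ω} ≤ a) : P.real {ω | ¬q ω} ≤ a := by
  refine le_trans (ENNReal.toReal_mono (measure_ne_top _ _) (measure_mono_ae ?_)) hp
  filter_upwards [h] with ω hω hq hp
  exact hq (hω hp)

end UnionBound

/-! ### Concentration along the path. -/

namespace EulerGPRun

variable {S A Ω : Type*} [Fintype S] [DecidableEq S] [Fintype A] [DecidableEq A]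
  [mΩ : MeasurableSpace Ω] {M : FiniteMDP S A} {K : ℕ} {δ : ℝ} {P : Measure Ω}

/-- The mean of `g j t` under the transition probabilities at time-step `t` of episode `j`. -/
def nextMean (run : EulerGPRun M K δ P) (ω : Ω) (g : ℕ → ℕ → S → ℝ) (j t : ℕ) : ℝ :=
  meanOf (M.p (run.state j t ω) (run.action j t ω)) (g j t)

/-- The value of `g j t` at the state that follows time-step `t` of episode `j`. -/
def nextVal (run : EulerGPRun M K δ P) (ω : Ω) (g : ℕ → ℕ → S → ℝ) (j t : ℕ) : ℝ :=
  g j t (run.state j (t + 1) ω)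

lemma nextMean_nonneg (run : EulerGPRun M K δ P) (ω : Ω) {g : ℕ → ℕ → S → ℝ} {j t : ℕ}
    (hg : ∀ x, 0 ≤ g j t x) : 0 ≤ run.nextMean ω g j t := meanOf_nonneg (M.p_nonneg _ _) hg

lemma nextMean_le (run : EulerGPRun M K δ P) (ω : Ω) {g : ℕ → ℕ → S → ℝ} {j t : ℕ} {B : ℝ}
    (hB : 0 ≤ B) (hg : ∀ x, g j t x ≤ B) : run.nextMean ω g j t ≤ B :=
  meanOf_le (M.p_nonneg _ _) (M.p_sum _ _).le hB hg

/-- The weights that turn a recursion with the factor `1 + 7 / H` into a telescoping sum. -/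
def pathWeight (H τ t : ℕ) : ℝ := if τ ≤ t then (1 + 7 / (H : ℝ)) ^ (t + 1) / 2187 else 0

/-- A factor `1 + 7 / H` per step costs at most `e⁷ ≤ 3⁷ = 2187` over an episode. -/
lemma pow_le_of_le {H n : ℕ} (hH : 0 < H) (hn : n ≤ H) : (1 + 7 / (H : ℝ)) ^ n ≤ 2187 := by
  have hH' : (0 : ℝ) < H := by exact_mod_cast hH
  have h1 : (1 : ℝ) ≤ 1 + 7 / (H : ℝ) := le_add_of_nonneg_right (by positivity)
  have h2 : 1 + 7 / (H : ℝ) ≤ Real.exp (7 / H) := by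
    rw [add_comm]; exact Real.add_one_le_exp _
  calc (1 + 7 / (H : ℝ)) ^ n ≤ (1 + 7 / (H : ℝ)) ^ H := pow_le_pow_right₀ h1 hn
    _ ≤ Real.exp (7 / H) ^ H := pow_le_pow_left₀ (by positivity) h2 H
    _ = Real.exp 1 ^ 7 := by
        rw [← Real.exp_nat_mul, ← Real.exp_nat_mul]; congr 1; push_cast; field_simp
    _ ≤ 3 ^ 7 := pow_le_pow_left₀ (Real.exp_pos 1).le (by linarith [Real.exp_one_lt_d9]) 7
    _ = 2187 := by norm_num

lemma pathWeight_mem {H : ℕ} (hH : 0 < H) (τ : ℕ) {t : ℕ} (ht : t < H) :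
    0 ≤ pathWeight H τ t ∧ pathWeight H τ t ≤ 1 := by
  unfold pathWeight
  split_ifs
  · exact ⟨by positivity, (div_le_one (by norm_num)).2 (pow_le_of_le hH ht)⟩
  · exact ⟨le_rfl, zero_le_one⟩

/-- Concentration of the values of a predictable function `g`, with `0 ≤ g ≤ B`, along the
path. -/
structure PathBound (run : EulerGPRun M K δ P) (x : ℝ) (ω : Ω) (g : ℕ → ℕ → S → ℝ) (B : ℝ) :
    Prop where
  diff : ∀ τ : Fin M.H, ∀ k ≤ K, epSum M.H k (fun j t => pathWeight M.H τ t *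
      (run.nextMean ω g j t - run.nextVal ω g j t)) ≤
    1 / (6 * 2187 * M.H) * epSum M.H k (fun j t => run.nextMean ω g j t + run.nextVal ω g j t)
      + 6 * 2187 * M.H * (B * x)
  mean : ∀ k ≤ K, epSum M.H k (run.nextMean ω g) ≤ 2 * epSum M.H k (run.nextVal ω g)
    + 10 * (B * x)

variable [IsProbabilityMeasure P]

/-- Upper deviations of the conditional means from the observed values. -/
lemma measureReal_not_nextMean_sub_le (run : EulerGPRun M K δ P) {g : Ω → ℕ → ℕ → S → ℝ}
    (hg : ∀ k < K, ∀ t < M.H, ∀ y, Measurable[run.info k t] fun ω => g ω k t y) {B : ℝ}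
    (hB : 0 < B) (hg0 : ∀ ω k t y, 0 ≤ g ω k t y) (hgB : ∀ ω k t y, g ω k t y ≤ B)
    {w : ℕ → ℝ} (hw : ∀ t < M.H, 0 ≤ w t ∧ w t ≤ 1) {l : ℝ} (hl0 : 0 < l) (hl1 : l ≤ 1 / 2)
    (x : ℝ) :
    P.real {ω | ¬∀ k ≤ K, epSum M.H k (fun j t => w t *
      (run.nextMean ω (g ω) j t - run.nextVal ω (g ω) j t)) ≤
      l * epSum M.H k (fun j t => run.nextMean ω (g ω) j t + run.nextVal ω (g ω) j t)
        + B * x / l} ≤ Real.exp (-x) := by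
  have h := run.measureReal_exists_lt_add_le_exp
    (Y := fun j t ω => w t / B * (run.nextMean ω (g ω) j t - run.nextVal ω (g ω) j t))
    (V := fun j t ω => 1 / B * (run.nextMean ω (g ω) j t + run.nextVal ω (g ω) j t))
    (fun k hk t ht => ?_) (fun k hk t ht => Filter.Eventually.of_forall fun ω => ?_) hl0 hl1 x
  · refine (measureReal_mono ?_).trans h
    intro ω hω
    obtain ⟨k, hk⟩ := not_forall.1 hω
    obtain ⟨hk, h1⟩ := Classical.not_imp.1 hk
    refine ⟨k, hk, ?_⟩
    change l * epSum M.H k _ + x / l < epSum M.H k _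
    rw [epSum_const_mul]
    have e : epSum M.H k (fun j t => w t / B *
        (run.nextMean ω (g ω) j t - run.nextVal ω (g ω) j t)) = 1 / B * epSum M.H k (fun j t =>
          w t * (run.nextMean ω (g ω) j t - run.nextVal ω (g ω) j t)) := by
      rw [← epSum_const_mul]; exact epSum_congr fun _ _ _ _ => by ring
    rw [e]
    have h2 := mul_lt_mul_of_pos_left (not_le.1 h1) (one_div_pos.2 hB)
    refine lt_of_eq_of_lt ?_ h2
    field_simp
  · have h1 := (run.isDiff_state hk ht (f := fun ω => g ω k t) (hg k hk t ht) (C := B)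
      (fun ω y => by rw [abs_of_nonneg (hg0 ω k t y)]; exact hgB ω k t y)).mul_left ht
      (w := fun _ => -(w t / B)) measurable_const (C := |w t / B|) (fun _ => (abs_neg _).le)
    convert h1 using 2 with ω
    simp only [nextMean, nextVal]; ring
  · have h1 := run.nextMean_nonneg ω (g := g ω) (j := k) (t := t) (hg0 ω k t)
    have h2 := run.nextMean_le ω (g := g ω) (j := k) (t := t) hB.le (hgB ω k t)
    have h3 : 0 ≤ run.nextVal ω (g ω) k t := hg0 ω k t _
    have h4 : run.nextVal ω (g ω) k t ≤ B := hgB ω k t _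
    obtain ⟨hw0, hw1⟩ := hw t ht
    set a := run.nextMean ω (g ω) k t
    set b := run.nextVal ω (g ω) k t
    have e : |w t / B * (a - b)| = w t * (|a - b| / B) := by
      rw [abs_mul, abs_of_nonneg (div_nonneg hw0 hB.le)]; ring
    rw [e]
    have h5 : |a - b| ≤ B := by rw [abs_le]; constructor <;> linarith
    have h6 : |a - b| ≤ a + b := by rw [abs_le]; constructor <;> linarith
    have h7 : 0 ≤ |a - b| / B := by positivity
    constructor
    · exact mul_le_one₀ hw1 h7 ((div_le_one hB).2 h5)
    · refine (mul_le_of_le_one_left h7 hw1).trans ?_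
      rw [one_div, inv_mul_eq_div]
      exact div_le_div_of_nonneg_right h6 hB.le

/-- Upper deviations of the observed values from the conditional means. -/
lemma measureReal_not_nextVal_sub_le (run : EulerGPRun M K δ P) {g : Ω → ℕ → ℕ → S → ℝ}
    (hg : ∀ k < K, ∀ t < M.H, ∀ y, Measurable[run.info k t] fun ω => g ω k t y) {B : ℝ}
    (hB : 0 < B) (hg0 : ∀ ω k t y, 0 ≤ g ω k t y) (hgB : ∀ ω k t y, g ω k t y ≤ B)
    {l : ℝ} (hl0 : 0 < l) (hl1 : l ≤ 1 / 2) (x : ℝ) :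
    P.real {ω | ¬∀ k ≤ K, epSum M.H k (run.nextVal ω (g ω)) - epSum M.H k (run.nextMean ω (g ω)) ≤
      l * (epSum M.H k (run.nextVal ω (g ω)) + epSum M.H k (run.nextMean ω (g ω)))
        + B * x / l} ≤ Real.exp (-x) := by
  have h := run.measureReal_exists_lt_add_le_exp
    (Y := fun j t ω => 1 / B * (run.nextVal ω (g ω) j t - run.nextMean ω (g ω) j t))
    (V := fun j t ω => 1 / B * (run.nextVal ω (g ω) j t + run.nextMean ω (g ω) j t))
    (fun k hk t ht => ?_) (fun k hk t ht => Filter.Eventually.of_forall fun ω => ?_) hl0 hl1 x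
  · refine (measureReal_mono ?_).trans h
    intro ω hω
    obtain ⟨k, hk⟩ := not_forall.1 hω
    obtain ⟨hk, h1⟩ := Classical.not_imp.1 hk
    refine ⟨k, hk, ?_⟩
    change l * epSum M.H k _ + x / l < epSum M.H k _
    rw [epSum_const_mul, epSum_const_mul, epSum_add, epSum_sub]
    have h2 := mul_lt_mul_of_pos_left (not_le.1 h1) (one_div_pos.2 hB)
    refine lt_of_eq_of_lt ?_ h2
    field_simp
  · have h1 := (run.isDiff_state hk ht (f := fun ω => g ω k t) (hg k hk t ht) (C := B)
      (fun ω y => by rw [abs_of_nonneg (hg0 ω k t y)]; exact hgB ω k t y)).mul_left ht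
      (w := fun _ => 1 / B) measurable_const (C := |1 / B|) (fun _ => le_rfl)
    exact h1
  · have h1 := run.nextMean_nonneg ω (g := g ω) (j := k) (t := t) (hg0 ω k t)
    have h2 := run.nextMean_le ω (g := g ω) (j := k) (t := t) hB.le (hgB ω k t)
    have h3 : 0 ≤ run.nextVal ω (g ω) k t := hg0 ω k t _
    have h4 : run.nextVal ω (g ω) k t ≤ B := hgB ω k t _
    set a := run.nextMean ω (g ω) k t
    set b := run.nextVal ω (g ω) k t
    have e : |1 / B * (b - a)| = |b - a| / B := by
      rw [abs_mul, abs_of_pos (one_div_pos.2 hB)]; ring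
    rw [e]
    have h5 : |b - a| ≤ B := by rw [abs_le]; constructor <;> linarith
    have h6 : |b - a| ≤ b + a := by rw [abs_le]; constructor <;> linarith
    constructor
    · exact (div_le_one hB).2 h5
    · rw [one_div, inv_mul_eq_div]
      exact div_le_div_of_nonneg_right h6 hB.le

/-- The scale `1 / (6 · 2187 · H)` is chosen for `PathBound.sum_le`: after multiplication by `2187`
and summation over `H` time-steps, the relative error is half of the quantity to be bounded. -/
lemma measureReal_not_pathBound_le (run : EulerGPRun M K δ P) {g : Ω → ℕ → ℕ → S → ℝ}
    (hg : ∀ k < K, ∀ t < M.H, ∀ y, Measurable[run.info k t] fun ω => g ω k t y) {B : ℝ}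
    (hB : 0 < B) (hg0 : ∀ ω k t y, 0 ≤ g ω k t y) (hgB : ∀ ω k t y, g ω k t y ≤ B)
    {x : ℝ} (hx : 0 ≤ x) :
    P.real {ω | ¬run.PathBound x ω (g ω) B} ≤ (M.H + 1) * Real.exp (-x) := by
  have hH : (1 : ℝ) ≤ M.H := by exact_mod_cast M.H_pos
  have h1 := measureReal_not_forall_le fun τ : Fin M.H =>
    run.measureReal_not_nextMean_sub_le hg hB hg0 hgB
      (w := pathWeight M.H τ) (fun t ht => pathWeight_mem M.H_pos τ ht)
      (l := 1 / (6 * 2187 * M.H)) (by positivity)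
      (by rw [div_le_div_iff₀ (by positivity) (by norm_num)]; linarith) x
  have h2 := run.measureReal_not_nextMean_sub_le hg hB hg0 hgB
      (w := fun _ => 1) (fun t ht => ⟨zero_le_one, le_rfl⟩) (l := 1 / 8) (by norm_num)
      (by norm_num) x
  rw [Fintype.card_fin] at h1
  have h3 := measureReal_not_and_le h1 h2
  rw [add_mul, one_mul]
  refine measureReal_not_mono (fun ω hω => ?_) h3
  refine ⟨fun τ k hk => ?_, fun k hk => ?_⟩
  · refine (hω.1 τ k hk).trans_eq ?_
    rw [div_div_eq_mul_div, div_one]; ring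
  · have h4 := hω.2 k hk
    simp only [one_mul] at h4
    rw [epSum_sub, epSum_add] at h4
    refine le_two_mul_add_of_sub_le (epSum_nonneg fun j _ t _ => hg0 ω j t _) (by positivity) ?_
    linarith

/-- Deviations of functions of the rewards with values in `[0, 1]`. -/
lemma measureReal_not_reward_sub_le (run : EulerGPRun M K δ P) {φ : ℝ → ℝ} (hφ : Continuous φ)
    (hφ01 : ∀ y ∈ Set.Icc (0 : ℝ) 1, φ y ∈ Set.Icc (0 : ℝ) 1) {x : ℝ} (hx : 0 ≤ x) :
    P.real {ω | ¬∀ k ≤ K,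
      epSum M.H k (fun j t => ∫ y, φ y ∂(M.R (run.state j t ω) (run.action j t ω))) ≤
        2 * epSum M.H k (fun j t => φ (run.reward j t ω)) + 10 * x} ≤ Real.exp (-x) := by
  have hint : ∀ s a, ∫ y, φ y ∂(M.R s a) ∈ Set.Icc (0 : ℝ) 1 := by
    intro s a
    have := M.R_prob s a
    constructor
    · refine integral_nonneg_of_ae ?_
      filter_upwards [M.R_mem s a] with y hy using (hφ01 y hy).1
    · calc ∫ y, φ y ∂(M.R s a) ≤ ∫ _, (1 : ℝ) ∂(M.R s a) := by
            apply integral_mono_ae (M.integrable_of_continuous s a hφ) (integrable_const _)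
            filter_upwards [M.R_mem s a] with y hy using (hφ01 y hy).2
        _ = 1 := by simp
  have h := run.measureReal_exists_lt_add_le_exp
    (Y := fun j t ω => -(φ (run.reward j t ω)
      - ∫ y, φ y ∂(M.R (run.state j t ω) (run.action j t ω))))
    (V := fun j t ω => ∫ y, φ y ∂(M.R (run.state j t ω) (run.action j t ω))
      + φ (run.reward j t ω))
    (fun k hk t ht => (run.isDiff_reward hk ht hφ).neg) (fun k hk t ht => ?_)
    (l := 1 / 8) (by norm_num) (by norm_num) x
  · refine measureReal_not_mono_ae (p := fun ω => ∀ k ≤ K, epSum M.H k (fun j t =>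
      -(φ (run.reward j t ω) - ∫ y, φ y ∂(M.R (run.state j t ω) (run.action j t ω)))) ≤
      1 / 8 * epSum M.H k (fun j t => ∫ y, φ y ∂(M.R (run.state j t ω) (run.action j t ω))
      + φ (run.reward j t ω)) + x / (1 / 8)) ?_ ((measureReal_mono ?_).trans h)
    · filter_upwards [run.ae_reward_mem] with ω hω h1 k hk
      have h2 := h1 k hk
      simp only [neg_sub] at h2
      rw [epSum_sub, epSum_add] at h2
      exact le_two_mul_add_of_sub_le (epSum_nonneg fun j hj t ht =>
        (hφ01 _ (hω j (hj.trans_le hk) t ht)).1) hx h2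
    · intro ω hω
      obtain ⟨k, hk⟩ := not_forall.1 hω
      obtain ⟨hk, h1⟩ := Classical.not_imp.1 hk
      exact ⟨k, hk, not_le.1 h1⟩
  · filter_upwards [run.reward_mem hk ht] with ω hω
    have h1 := hint (run.state k t ω) (run.action k t ω)
    have h2 := hφ01 _ hω
    rw [abs_neg]
    refine ⟨abs_sub_le_one h2 h1, ?_⟩
    rw [abs_le]
    constructor <;> linarith [h1.1, h2.1]

end EulerGPRun

/-! ### The good event and its probability. -/

/-- The nearest point of `[0, b]`. -/
def clip (b y : ℝ) : ℝ := max 0 (min b y)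

lemma clip_nonneg (b y : ℝ) : 0 ≤ clip b y := le_max_left _ _

lemma clip_le {b : ℝ} (hb : 0 ≤ b) (y : ℝ) : clip b y ≤ b := max_le hb (min_le_left _ _)

lemma clip_of_mem {b y : ℝ} (h0 : 0 ≤ y) (h1 : y ≤ b) : clip b y = y := by
  rw [clip, min_eq_right h1, max_eq_right h0]

namespace EulerGPRun

variable {S A Ω : Type*} [Fintype S] [DecidableEq S] [Fintype A] [DecidableEq A]
  [mΩ : MeasurableSpace Ω] {M : FiniteMDP S A} {K : ℕ} {δ : ℝ} {P : Measure Ω}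

/-- The clipped gap between the upper estimate and the value of the policy, one step ahead. -/
def gapFn (run : EulerGPRun M K δ P) (ω : Ω) (j t : ℕ) (y : S) : ℝ :=
  clip M.H (run.upper j (t + 1) y ω - M.value (run.policy j ω) (t + 1) y)

/-- The square of the clipped width of the estimates, one step ahead. -/
def widthFn (run : EulerGPRun M K δ P) (ω : Ω) (j t : ℕ) (y : S) : ℝ :=
  clip M.H (run.upper j (t + 1) y ω - run.lower j (t + 1) y ω) ^ 2

/-- The value of the policy, one step ahead. -/
def valFn (run : EulerGPRun M K δ P) (ω : Ω) (j t : ℕ) (y : S) : ℝ :=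
  M.value (run.policy j ω) (t + 1) y

/-- The squared value of the policy, one step ahead. -/
def valSqFn (run : EulerGPRun M K δ P) (ω : Ω) (j t : ℕ) (y : S) : ℝ := run.valFn ω j t y ^ 2

/-- The normalised squared deviation of the squared value of the policy. -/
def valDevFn (run : EulerGPRun M K δ P) (ω : Ω) (j t : ℕ) (y : S) : ℝ :=
  (1 / (M.H : ℝ) ^ 2 * (run.nextMean ω (run.valSqFn ω) j t - run.valSqFn ω j t y)) ^ 2

/-- The event on which the regret bound holds; `ℓ` is the logarithmic factor. -/
structure GoodEvent (run : EulerGPRun M K δ P) (ℓ : ℝ) (ω : Ω) : Prop where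
  accurate : ∀ k ≤ K, EulerGP.IsAccurate M ℓ (run.hist ω) k
  reward_mem : ∀ k < K, ∀ t < M.H, run.reward k t ω ∈ Set.Icc (0 : ℝ) 1
  rewardVar : ∀ x : S × A, ∀ k ≤ K, epSum M.H k (fun j t => run.visitInd x.1 x.2 j t ω *
    (run.reward j t ω - M.r x.1 x.2) ^ 2) ≤
      2 * ((run.hist ω).count M.H k x.1 x.2 * M.varR x.1 x.2) + 10 * (3 * ℓ)
  transVar : ∀ x : (S × A) × Fin M.H, ∀ k ≤ K, epSum M.H k (fun j t =>
    run.visitInd x.1.1 x.1.2 j t ω * (M.optValue (x.2 + 1) (run.state j (t + 1) ω)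
      - meanOf (M.p x.1.1 x.1.2) (M.optValue (x.2 + 1))) ^ 2) ≤
      2 * ((run.hist ω).count M.H k x.1.1 x.1.2
        * varOf (M.p x.1.1 x.1.2) (M.optValue (x.2 + 1))) + 10 * ((M.H : ℝ) ^ 2 * (3 * ℓ))
  trans : ∀ x : (S × A) × S, ∀ k ≤ K, epSum M.H k (fun j t => run.visitInd x.1.1 x.1.2 j t ω *
    (if run.state j (t + 1) ω = x.2 then 1 else 0)) ≤
      (1 + 1 / M.H) * ((run.hist ω).count M.H k x.1.1 x.1.2 * M.p x.1.1 x.1.2 x.2)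
        + 16 * M.H * ℓ
  gap : run.PathBound (3 * ℓ) ω (run.gapFn ω) M.H
  width : run.PathBound (3 * ℓ) ω (run.widthFn ω) ((M.H : ℝ) ^ 2)
  valueDiff : ∀ k ≤ K, epSum M.H k (fun j t => run.nextMean ω (run.valSqFn ω) j t
    - run.nextVal ω (run.valSqFn ω) j t) ≤
      (M.H : ℝ) ^ 2 * (1 / 16 * epSum M.H k (run.nextVal ω (run.valDevFn ω)) + 16 * (3 * ℓ))
  valueDev : ∀ k ≤ K, epSum M.H k (run.nextVal ω (run.valDevFn ω)) ≤
    2 * epSum M.H k (run.nextMean ω (run.valDevFn ω)) + 10 * (3 * ℓ)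
  rewardSum : ∀ k ≤ K, epSum M.H k (fun j t => M.r (run.state j t ω) (run.action j t ω)) ≤
    2 * epSum M.H k (fun j t => run.reward j t ω) + 10 * (3 * ℓ)
  rewardSq : ∀ k ≤ K, epSum M.H k
    (fun j t => ∫ y, y ^ 2 ∂(M.R (run.state j t ω) (run.action j t ω))) ≤
    2 * epSum M.H k (fun j t => run.reward j t ω ^ 2) + 10 * (3 * ℓ)

lemma epSum_visitInd (run : EulerGPRun M K δ P) (k : ℕ) (s : S) (a : A) (ω : Ω) :
    epSum M.H k (fun j t => run.visitInd s a j t ω) = (run.hist ω).count M.H k s a := by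
  rw [History.count_eq_sum]; rfl

lemma valFn_nonneg (run : EulerGPRun M K δ P) (ω : Ω) (j t : ℕ) (y : S) :
    0 ≤ run.valFn ω j t y := M.value_nonneg _ _ _

lemma valFn_le (run : EulerGPRun M K δ P) (ω : Ω) (j t : ℕ) (y : S) :
    run.valFn ω j t y ≤ M.H := M.value_le _ _ _

lemma valSqFn_le (run : EulerGPRun M K δ P) (ω : Ω) (j t : ℕ) (y : S) :
    run.valSqFn ω j t y ≤ (M.H : ℝ) ^ 2 :=
  pow_le_pow_left₀ (run.valFn_nonneg ω j t y) (run.valFn_le ω j t y) 2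

lemma abs_valSq_dev_le (run : EulerGPRun M K δ P) (ω : Ω) (j t : ℕ) (y : S) :
    |1 / (M.H : ℝ) ^ 2 * (run.nextMean ω (run.valSqFn ω) j t - run.valSqFn ω j t y)| ≤ 1 := by
  have hH : (0 : ℝ) < (M.H : ℝ) ^ 2 := by have := M.H_pos; positivity
  have h1 := run.nextMean_nonneg ω (g := run.valSqFn ω) (j := j) (t := t) fun y => sq_nonneg _
  have h2 := run.nextMean_le ω (g := run.valSqFn ω) (j := j) (t := t) hH.le
    (run.valSqFn_le ω j t)
  have h3 : 0 ≤ run.valSqFn ω j t y := sq_nonneg _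
  have h4 := run.valSqFn_le ω j t y
  rw [abs_mul, abs_of_pos (one_div_pos.2 hH), one_div, inv_mul_le_iff₀ hH, mul_one, abs_le]
  constructor <;> linarith

lemma measurable_valFn (run : EulerGPRun M K δ P) {k : ℕ} (hk : k < K) {t : ℕ} (ht : t < M.H)
    (y : S) : Measurable[run.info k t] fun ω => run.valFn ω k t y :=
  (run.measurable_value hk ht y).mono (run.info_mono_step k (Nat.zero_le t) ht.le) le_rfl

lemma measurable_valDevFn (run : EulerGPRun M K δ P) {k : ℕ} (hk : k < K) {t : ℕ} (ht : t < M.H)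
    (y : S) : Measurable[run.info k t] fun ω => run.valDevFn ω k t y := by
  have h1 := fun y => (run.measurable_valFn hk ht y).pow_const 2
  have h2 : Measurable[run.info k t] fun ω => run.nextMean ω (run.valSqFn ω) k t :=
    Finset.measurable_sum _ fun x _ =>
      (run.measurable_pair hk ht (fun s a => M.p s a x)).mul (h1 x)
  exact ((h2.sub (h1 y)).const_mul _).pow_const 2

lemma measurable_gapFn (run : EulerGPRun M K δ P) {k : ℕ} (hk : k < K) {t : ℕ} (ht : t < M.H)
    (y : S) : Measurable[run.info k t] fun ω => run.gapFn ω k t y :=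
  (measurable_const.max (measurable_const.min ((run.measurable_upper hk.le (t + 1) y).sub
    (run.measurable_value hk ht y)))).mono (run.info_mono_step k (Nat.zero_le t) ht.le) le_rfl

lemma measurable_widthFn (run : EulerGPRun M K δ P) {k : ℕ} (hk : k < K) {t : ℕ} (ht : t < M.H)
    (y : S) : Measurable[run.info k t] fun ω => run.widthFn ω k t y :=
  ((measurable_const.max (measurable_const.min ((run.measurable_upper hk.le (t + 1) y).sub
    (run.measurable_lower hk.le (t + 1) y)))).pow_const 2).mono
    (run.info_mono_step k (Nat.zero_le t) ht.le) le_rfl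

lemma visitInd_nonneg (run : EulerGPRun M K δ P) (s : S) (a : A) (k t : ℕ) (ω : Ω) :
    0 ≤ run.visitInd s a k t ω := by
  unfold visitInd; split_ifs <;> simp

lemma visitInd_le_one (run : EulerGPRun M K δ P) (s : S) (a : A) (k t : ℕ) (ω : Ω) :
    run.visitInd s a k t ω ≤ 1 := (le_abs_self _).trans (run.abs_visitInd_le s a k t ω)

/-- A function of the next state at the visits of a fixed pair. -/
def visitFn (run : EulerGPRun M K δ P) (s : S) (a : A) (f : S → ℝ) (ω : Ω) (j t : ℕ) (y : S) : ℝ :=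
  run.visitInd s a j t ω * f y

lemma epSum_nextMean_visitFn (run : EulerGPRun M K δ P) (s : S) (a : A) (f : S → ℝ) (ω : Ω)
    (k : ℕ) : epSum M.H k (run.nextMean ω (run.visitFn s a f ω)) =
      (run.hist ω).count M.H k s a * meanOf (M.p s a) f := by
  rw [← epSum_visitInd, mul_comm, ← epSum_const_mul]
  refine epSum_congr fun j _ t _ => ?_
  have e : run.visitFn s a f ω j t = fun y => run.visitInd s a j t ω * f y := rfl
  rw [nextMean, e, meanOf_const_mul, visitInd]
  split_ifs with hc
  · rw [hc.1, hc.2]; ring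
  · simp

variable [IsProbabilityMeasure P]

/-- Whether the current pair is `(s, a)` is known before the transition, so the indicator of a visit
serves as a predictable weight and the number of visits may stay random. -/
lemma measureReal_not_visitFn_le (run : EulerGPRun M K δ P) (s : S) (a : A) {f : S → ℝ}
    (hf : ∀ y, f y ∈ Set.Icc (0 : ℝ) 1) {l : ℝ} (hl0 : 0 < l) (hl1 : l ≤ 1 / 2) (x : ℝ) :
    P.real {ω | ¬∀ k ≤ K, epSum M.H k (fun j t => run.visitInd s a j t ω *
      f (run.state j (t + 1) ω)) - (run.hist ω).count M.H k s a * meanOf (M.p s a) f ≤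
      l * (epSum M.H k (fun j t => run.visitInd s a j t ω * f (run.state j (t + 1) ω))
        + (run.hist ω).count M.H k s a * meanOf (M.p s a) f) + x / l} ≤ Real.exp (-x) := by
  have h := run.measureReal_not_nextVal_sub_le (g := run.visitFn s a f)
    (fun k hk t ht y => (run.measurable_visitInd s a hk ht).mul_const _) one_pos
    (fun ω k t y => mul_nonneg (run.visitInd_nonneg s a k t ω) (hf y).1)
    (fun ω k t y => mul_le_one₀ (run.visitInd_le_one s a k t ω) (hf y).1 (hf y).2) hl0 hl1 x
  simp only [epSum_nextMean_visitFn, one_mul] at h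
  exact h

lemma measureReal_not_rewardVar_le (run : EulerGPRun M K δ P) (s : S) (a : A) {x : ℝ}
    (hx : 0 ≤ x) :
    P.real {ω | ¬∀ k ≤ K, epSum M.H k (fun j t => run.visitInd s a j t ω *
      (run.reward j t ω - M.r s a) ^ 2) ≤
      2 * ((run.hist ω).count M.H k s a * M.varR s a) + 10 * x} ≤ Real.exp (-x) := by
  have h := run.measureReal_exists_lt_add_le_exp
    (Y := fun j t ω => run.visitInd s a j t ω * ((run.reward j t ω - M.r s a) ^ 2
      - ∫ y, (y - M.r s a) ^ 2 ∂(M.R s a)))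
    (V := fun j t ω => run.visitInd s a j t ω * (run.reward j t ω - M.r s a) ^ 2
      + M.varR s a * run.visitInd s a j t ω)
    (fun k hk t ht => run.isDiff_visit_reward (φ := fun y => (y - M.r s a) ^ 2)
      (by fun_prop) s a hk ht) (fun k hk t ht => ?_)
    (l := 1 / 8) (by norm_num) (by norm_num) x
  · refine (measureReal_mono ?_).trans h
    intro ω hω
    obtain ⟨k, hk⟩ := not_forall.1 hω
    obtain ⟨hk, h1⟩ := Classical.not_imp.1 hk
    refine ⟨k, hk, not_le.1 fun h2 => h1 ?_⟩
    change epSum M.H k _ ≤ 1 / 8 * epSum M.H k _ + x / (1 / 8) at h2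
    rw [epSum_add, epSum_const_mul, epSum_visitInd, ← M.varR_eq] at h2
    have e : epSum M.H k (fun j t => run.visitInd s a j t ω * ((run.reward j t ω - M.r s a) ^ 2
        - M.varR s a)) = epSum M.H k (fun j t => run.visitInd s a j t ω *
          (run.reward j t ω - M.r s a) ^ 2) - M.varR s a * (run.hist ω).count M.H k s a := by
      rw [← epSum_visitInd, ← epSum_const_mul, ← epSum_sub]
      exact epSum_congr fun _ _ _ _ => by ring
    rw [e] at h2
    rw [mul_comm ((run.hist ω).count M.H k s a : ℝ)]
    exact le_two_mul_add_of_sub_le (mul_nonneg (M.varR_nonneg s a) (Nat.cast_nonneg _)) hx h2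
  · filter_upwards [run.reward_mem hk ht] with ω hω
    have h1 := M.varR_nonneg s a
    have h2 := M.varR_le_one s a
    have h3 : (run.reward k t ω - M.r s a) ^ 2 ≤ 1 := by
      rw [sq_le_one_iff_abs_le_one]
      exact abs_sub_le_one hω ⟨M.r_nonneg s a, M.r_le_one s a⟩
    have h4 := sq_nonneg (run.reward k t ω - M.r s a)
    have h5 := run.visitInd_nonneg s a k t ω
    rw [← M.varR_eq]
    refine ⟨abs_visitInd_mul_le (abs_sub_le_one ⟨h4, h3⟩ ⟨h1, h2⟩), ?_⟩
    rw [abs_mul, abs_of_nonneg h5, mul_comm (M.varR s a), ← mul_add]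
    refine mul_le_mul_of_nonneg_left ?_ h5
    rw [abs_le]; constructor <;> linarith

lemma measureReal_not_transVar_le [Nonempty A] (run : EulerGPRun M K δ P) (s : S) (a : A) (τ : ℕ)
    {x : ℝ} (hx : 0 ≤ x) :
    P.real {ω | ¬∀ k ≤ K, epSum M.H k (fun j t =>
      run.visitInd s a j t ω * (M.optValue (τ + 1) (run.state j (t + 1) ω)
      - meanOf (M.p s a) (M.optValue (τ + 1))) ^ 2) ≤
      2 * ((run.hist ω).count M.H k s a * varOf (M.p s a) (M.optValue (τ + 1)))
        + 10 * ((M.H : ℝ) ^ 2 * x)} ≤ Real.exp (-x) := by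
  have hH : (0 : ℝ) < M.H := by exact_mod_cast M.H_pos
  set V := M.optValue (τ + 1) with hV
  set m := meanOf (M.p s a) V with hm
  have hm0 : 0 ≤ m := meanOf_nonneg (M.p_nonneg s a) (M.optValue_nonneg _)
  have hm1 : m ≤ M.H := meanOf_le (M.p_nonneg s a) (M.p_sum s a).le hH.le (M.optValue_le _)
  have h := run.measureReal_not_visitFn_le s a (f := fun y => 1 / (M.H : ℝ) ^ 2 * (V y - m) ^ 2)
    (fun y => ⟨by positivity, by
      rw [one_div, inv_mul_le_iff₀ (by positivity), mul_one]
      refine sq_le_sq' ?_ ?_ <;> linarith [M.optValue_nonneg (τ + 1) y, M.optValue_le (τ + 1) y]⟩)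
    (l := 1 / 8) (by norm_num) (by norm_num) x
  refine measureReal_not_mono (fun ω hω k hk => ?_) h
  have h1 := hω k hk
  rw [meanOf_const_mul] at h1
  have e : epSum M.H k (fun j t => run.visitInd s a j t ω *
      (1 / (M.H : ℝ) ^ 2 * (V (run.state j (t + 1) ω) - m) ^ 2)) = 1 / (M.H : ℝ) ^ 2 *
        epSum M.H k (fun j t => run.visitInd s a j t ω * (V (run.state j (t + 1) ω) - m) ^ 2) := by
    rw [← epSum_const_mul]; exact epSum_congr fun _ _ _ _ => by ring
  rw [e] at h1
  change _ - _ * (_ * varOf (M.p s a) V) ≤ _ * (_ + _ * (_ * varOf (M.p s a) V)) + _ at h1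
  have h2 := le_two_mul_add_of_sub_le (mul_nonneg (Nat.cast_nonneg _) (mul_nonneg (by positivity)
    (varOf_nonneg (M.p_nonneg s a) V))) hx h1
  rw [one_div, inv_mul_le_iff₀ (by positivity)] at h2
  refine h2.trans_eq ?_
  field_simp

/-- At the relative scale `l = 1 / (4 H)` the multiplicative error is `(4 H + 1) / (4 H - 1) ≤ 1 + 1
/ H`, harmless when compounded over an episode. The additive part `12 H ℓ / (1 - l)` is at most `16
H ℓ`. -/
lemma measureReal_not_trans_le (run : EulerGPRun M K δ P) (s : S) (a : A) (s' : S)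
    {ℓ : ℝ} (hℓ : 0 ≤ ℓ) :
    P.real {ω | ¬∀ k ≤ K, epSum M.H k (fun j t => run.visitInd s a j t ω *
      (if run.state j (t + 1) ω = s' then 1 else 0)) ≤
      (1 + 1 / M.H) * ((run.hist ω).count M.H k s a * M.p s a s') + 16 * M.H * ℓ}
      ≤ Real.exp (-(3 * ℓ)) := by
  have hH : (1 : ℝ) ≤ M.H := by exact_mod_cast M.H_pos
  have h := run.measureReal_not_visitFn_le s a (f := fun y => if y = s' then (1 : ℝ) else 0)
    (fun y => by split_ifs <;> simp) (l := 1 / (4 * M.H)) (by positivity)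
    (by rw [div_le_div_iff₀ (by positivity) (by norm_num)]; linarith) (3 * ℓ)
  refine measureReal_not_mono (fun ω hω k hk => ?_) h
  have h1 := hω k hk
  have e : meanOf (M.p s a) (fun y => if y = s' then (1 : ℝ) else 0) = M.p s a s' := by
    simp [meanOf]
  rw [e] at h1
  set Z := epSum M.H k (fun j t => run.visitInd s a j t ω *
      (if run.state j (t + 1) ω = s' then (1 : ℝ) else 0))
  have hE : 0 ≤ ((run.hist ω).count M.H k s a : ℝ) * M.p s a s' :=
    mul_nonneg (Nat.cast_nonneg _) (M.p_nonneg s a s')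
  set E := ((run.hist ω).count M.H k s a : ℝ) * M.p s a s'
  set H := (M.H : ℝ)
  have h2 : (4 * H - 1) * Z ≤ (4 * H + 1) * E + 48 * H ^ 2 * ℓ := by
    have h3 := mul_le_mul_of_nonneg_left h1 (by positivity : 0 ≤ 4 * H)
    have e1 : 4 * H * (1 / (4 * H) * (Z + E) + 3 * ℓ / (1 / (4 * H))) =
        (Z + E) + 48 * H ^ 2 * ℓ := by field_simp; ring
    rw [e1] at h3
    linarith
  have h4 : (4 * H + 1) * E + 48 * H ^ 2 * ℓ ≤
      (4 * H - 1) * ((1 + 1 / H) * E + 16 * H * ℓ) := by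
    have e2 : (4 * H - 1) * ((1 + 1 / H) * E + 16 * H * ℓ) =
        (4 * H + 3 - 1 / H) * E + (64 * H ^ 2 - 16 * H) * ℓ := by field_simp; ring
    rw [e2]
    have h5 : 1 / H ≤ 1 := (div_le_one (by linarith)).2 hH
    have h6 : (4 * H + 1) * E ≤ (4 * H + 3 - 1 / H) * E :=
      mul_le_mul_of_nonneg_right (by linarith) hE
    have h7 : 48 * H ^ 2 * ℓ ≤ (64 * H ^ 2 - 16 * H) * ℓ :=
      mul_le_mul_of_nonneg_right (by nlinarith) hℓ
    linarith
  exact le_of_mul_le_mul_left (h2.trans h4) (by linarith)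

/-- The actual sum of squares is kept, rather than a bound by the range, because it will be compared
with the very variances that this inequality helps to bound. -/
lemma measureReal_not_valueDiff_le (run : EulerGPRun M K δ P) (x : ℝ) :
    P.real {ω | ¬∀ k ≤ K, epSum M.H k (fun j t => run.nextMean ω (run.valSqFn ω) j t
      - run.nextVal ω (run.valSqFn ω) j t) ≤
      (M.H : ℝ) ^ 2 * (1 / 16 * epSum M.H k (run.nextVal ω (run.valDevFn ω)) + 16 * x)}
      ≤ Real.exp (-x) := by
  have hH : (0 : ℝ) < M.H := by exact_mod_cast M.H_pos
  have h := run.measureReal_exists_lt_le_exp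
    (Y := fun j t ω => 1 / (M.H : ℝ) ^ 2 * (run.nextMean ω (run.valSqFn ω) j t
      - run.nextVal ω (run.valSqFn ω) j t)) (fun k hk t ht => ?_)
    (fun k hk t ht => Filter.Eventually.of_forall fun ω => run.abs_valSq_dev_le ω k t _)
    (l := 1 / 16) (ψ := (1 / 16) ^ 2)
    (fun y hy => exp_mul_sub_sq_le_one_add (by norm_num) (by norm_num) hy) x
  · refine (measureReal_mono ?_).trans h
    intro ω hω
    obtain ⟨k, hk⟩ := not_forall.1 hω
    obtain ⟨hk, h1⟩ := Classical.not_imp.1 hk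
    refine ⟨k, hk, not_le.1 fun h2 => h1 ?_⟩
    change 1 / 16 * epSum M.H k _ - (1 / 16) ^ 2 * epSum M.H k (run.nextVal ω (run.valDevFn ω))
      ≤ x at h2
    rw [epSum_const_mul] at h2
    have h3 : 1 / (M.H : ℝ) ^ 2 * epSum M.H k (fun j t => run.nextMean ω (run.valSqFn ω) j t
      - run.nextVal ω (run.valSqFn ω) j t) ≤
      1 / 16 * epSum M.H k (run.nextVal ω (run.valDevFn ω)) + 16 * x := by linarith
    rwa [one_div, inv_mul_le_iff₀ (by positivity)] at h3
  · have h1 := (run.isDiff_state hk ht (f := fun ω => run.valSqFn ω k t)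
      (fun y => (run.measurable_valFn hk ht y).pow_const 2) (C := (M.H : ℝ) ^ 2)
      (fun ω y => by
        rw [abs_of_nonneg (sq_nonneg _)]; exact run.valSqFn_le ω k t y)).mul_left ht
      (w := fun _ => -(1 / (M.H : ℝ) ^ 2)) measurable_const
      (C := |1 / (M.H : ℝ) ^ 2|) (fun _ => (abs_neg _).le)
    convert h1 using 2 with ω
    simp only [nextMean, nextVal]; ring

lemma measureReal_not_valueDev_le (run : EulerGPRun M K δ P) {x : ℝ} (hx : 0 ≤ x) :
    P.real {ω | ¬∀ k ≤ K, epSum M.H k (run.nextVal ω (run.valDevFn ω)) ≤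
      2 * epSum M.H k (run.nextMean ω (run.valDevFn ω)) + 10 * x} ≤ Real.exp (-x) := by
  have h := run.measureReal_not_nextVal_sub_le (g := fun ω => run.valDevFn ω)
    (fun k hk t ht y => run.measurable_valDevFn hk ht y) one_pos
    (fun ω k t y => sq_nonneg _)
    (fun ω k t y => (sq_le_one_iff_abs_le_one _).2 (run.abs_valSq_dev_le ω k t y))
    (l := 1 / 8) (by norm_num) (by norm_num) x
  refine measureReal_not_mono (fun ω hω k hk => ?_) h
  have h1 := hω k hk
  rw [one_mul] at h1
  exact le_two_mul_add_of_sub_le (epSum_nonneg fun j _ t _ =>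
    run.nextMean_nonneg ω fun y => sq_nonneg _) hx h1

/-- All bounds other than accuracy are taken at level `3 ℓ`. This changes constants only, while `exp
(-3 ℓ)` outweighs the `S² A` terms of the union bound. -/
theorem measureReal_not_goodEvent_le [Nonempty A] (run : EulerGPRun M K δ P) {ℓ : ℝ} (hℓ : 0 ≤ ℓ)
    {e : ℝ} (hacc : P.real {ω | ¬∀ k ≤ K, EulerGP.IsAccurate M ℓ (run.hist ω) k} ≤ e) :
    P.real {ω | ¬run.GoodEvent ℓ ω} ≤ e + (Fintype.card S * Fintype.card A
      + Fintype.card S * Fintype.card A * M.H + Fintype.card S * Fintype.card A * Fintype.card S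
      + (M.H + 1) + (M.H + 1) + 4) * Real.exp (-(3 * ℓ)) := by
  have hH : (0 : ℝ) < M.H := by exact_mod_cast M.H_pos
  have hx : 0 ≤ 3 * ℓ := by linarith
  have h1 := measureReal_not_forall_le fun x : S × A =>
    run.measureReal_not_rewardVar_le x.1 x.2 hx
  have h2 := measureReal_not_forall_le fun x : (S × A) × Fin M.H =>
    run.measureReal_not_transVar_le x.1.1 x.1.2 x.2 hx
  have h3 := measureReal_not_forall_le fun x : (S × A) × S =>
    run.measureReal_not_trans_le x.1.1 x.1.2 x.2 hℓ
  have h4 := run.measureReal_not_pathBound_le (g := run.gapFn)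
    (fun k hk t ht y => run.measurable_gapFn hk ht y) hH
    (fun ω k t y => clip_nonneg _ _) (fun ω k t y => clip_le hH.le _) hx
  have h5 := run.measureReal_not_pathBound_le (g := run.widthFn)
    (fun k hk t ht y => run.measurable_widthFn hk ht y) (pow_pos hH 2)
    (fun ω k t y => sq_nonneg _)
    (fun ω k t y => pow_le_pow_left₀ (clip_nonneg _ _) (clip_le hH.le _) 2) hx
  have h6 := run.measureReal_not_valueDiff_le (3 * ℓ)
  have h7 := run.measureReal_not_valueDev_le hx
  have h8 := run.measureReal_not_reward_sub_le (φ := fun y => y) continuous_id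
    (fun y hy => hy) hx
  have h9 := run.measureReal_not_reward_sub_le (φ := fun y => y ^ 2) (continuous_pow 2)
    (fun y hy => ⟨sq_nonneg _, pow_le_one₀ hy.1 hy.2⟩) hx
  simp only [Fintype.card_prod, Fintype.card_fin, Nat.cast_mul] at h1 h2 h3
  have h := measureReal_not_and_le hacc (measureReal_not_and_le h1 (measureReal_not_and_le h2
    (measureReal_not_and_le h3 (measureReal_not_and_le h4 (measureReal_not_and_le h5
    (measureReal_not_and_le h6 (measureReal_not_and_le h7 (measureReal_not_and_le h8 h9))))))))
  refine (measureReal_not_mono_ae ?_ h).trans_eq (by ring)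
  filter_upwards [run.ae_reward_mem] with ω hω hall
  obtain ⟨g0, g1, g2, g3, g4, g5, g6, g7, g8, g9⟩ := hall
  exact ⟨g0, hω, g1, g2, g3, g4, g5, g6, g7, g8, g9⟩

end EulerGPRun

/-! ### Counting visits -/

namespace History

variable {S A : Type*} [DecidableEq S] [DecidableEq A]

/-- The number of visits of `(s, a)` in episode `j`. -/
def episodeCount (h : History S A) (H j : ℕ) (s : S) (a : A) : ℝ :=
  ∑ t ∈ Finset.range H, if h.state j t = s ∧ h.action j t = a then 1 else 0

lemma count_succ (h : History S A) (H k : ℕ) (s : S) (a : A) :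
    (h.count H (k + 1) s a : ℝ) = h.count H k s a + h.episodeCount H k s a := by
  rw [count_eq_sum, count_eq_sum, Finset.sum_range_succ, episodeCount]

lemma count_zero (h : History S A) (H : ℕ) (s : S) (a : A) : h.count H 0 s a = 0 := by
  simp [count, visits]

lemma episodeCount_nonneg (h : History S A) (H j : ℕ) (s : S) (a : A) :
    0 ≤ h.episodeCount H j s a :=
  Finset.sum_nonneg fun t _ => by split_ifs <;> simp

lemma episodeCount_le (h : History S A) (H j : ℕ) (s : S) (a : A) :
    h.episodeCount H j s a ≤ H := by
  calc h.episodeCount H j s a ≤ ∑ _t ∈ Finset.range H, (1 : ℝ) :=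
        Finset.sum_le_sum fun t _ => by split_ifs <;> simp
    _ = H := by simp

lemma epSum_pair [Fintype S] [Fintype A] (h : History S A) (H k : ℕ) (F : ℕ → S → A → ℝ) :
    epSum H k (fun j t => F j (h.state j t) (h.action j t)) =
      ∑ s, ∑ a, ∑ j ∈ Finset.range k, h.episodeCount H j s a * F j s a := by
  have e : ∀ j t, F j (h.state j t) (h.action j t) = ∑ s, ∑ a,
      (if h.state j t = s ∧ h.action j t = a then 1 else 0) * F j s a := by
    intro j t
    simp [ite_and]
  have e' : ∀ j ∈ Finset.range k, ∑ t ∈ Finset.range H, F j (h.state j t) (h.action j t) =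
      ∑ s, ∑ a, h.episodeCount H j s a * F j s a := by
    intro j _
    simp only [e, episodeCount, Finset.sum_mul]
    rw [Finset.sum_comm]
    exact Finset.sum_congr rfl fun s _ => Finset.sum_comm
  rw [epSum, Finset.sum_congr rfl e', Finset.sum_comm]
  exact Finset.sum_congr rfl fun s _ => Finset.sum_comm

/-- Whether there are fewer than `N` visits of `(s, a)` before episode `j`. -/
def unseen (h : History S A) (H N j : ℕ) (s : S) (a : A) : ℝ :=
  if h.count H j s a < N then 1 else 0

/-- The inverse of the number of visits of `(s, a)` before episode `j`, if there are at least
`N`. -/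
def invCount (h : History S A) (H N j : ℕ) (s : S) (a : A) : ℝ :=
  if h.count H j s a < N then 0 else 1 / (h.count H j s a : ℝ)

lemma unseen_nonneg (h : History S A) (H N j : ℕ) (s : S) (a : A) : 0 ≤ h.unseen H N j s a := by
  unfold unseen; split_ifs <;> simp

lemma invCount_nonneg (h : History S A) (H N j : ℕ) (s : S) (a : A) :
    0 ≤ h.invCount H N j s a := by
  unfold invCount; split_ifs
  · exact le_rfl
  · positivity

/-- Counts are updated between episodes, so the episode that crosses `N` may overshoot by `H`. The
first bound is what the induction for the second needs. -/
lemma sum_episodeCount_mul_unseen_le (h : History S A) (H N k : ℕ) (s : S) (a : A) :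
    ∑ j ∈ Finset.range k, h.episodeCount H j s a * h.unseen H N j s a ≤ h.count H k s a ∧
      ∑ j ∈ Finset.range k, h.episodeCount H j s a * h.unseen H N j s a ≤ N + H := by
  induction k with
  | zero => simp; positivity
  | succ k ih =>
    rw [Finset.sum_range_succ, count_succ]
    have h1 := h.episodeCount_nonneg H k s a
    have h2 := h.episodeCount_le H k s a
    unfold unseen at ih ⊢
    split_ifs with hc
    · have hc' : (h.count H k s a : ℝ) < N := by exact_mod_cast hc
      constructor <;> linarith [ih.1]
    · constructor <;> linarith [ih.1, ih.2]

lemma le_two_mul_log {z : ℝ} (h0 : 0 ≤ z) (h1 : z ≤ 1) : z ≤ 2 * Real.log (1 + z) := by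
  have h2 := Real.one_sub_inv_le_log_of_pos (x := 1 + z) (by linarith)
  have h3 : z / 2 ≤ 1 - (1 + z)⁻¹ := by
    rw [show 1 - (1 + z)⁻¹ = z / (1 + z) by field_simp; ring]
    exact div_le_div_of_nonneg_left h0 (by linarith) (by linarith)
  linarith

/-- An episode adds `w ≤ H ≤ N ≤ n` visits, so `w / n ≤ 1` and `w / n ≤ 2 log (1 + w / n)`, an
increment of `2 log n`. -/
lemma sum_episodeCount_mul_invCount_le (h : History S A) {H N : ℕ} (hN : H ≤ N) (hH : 0 < H)
    (k : ℕ) (s : S) (a : A) :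
    ∑ j ∈ Finset.range k, h.episodeCount H j s a * h.invCount H N j s a ≤
      2 * Real.log (h.count1 H k s a) := by
  induction k with
  | zero => simp [count1, count_zero]
  | succ k ih =>
    rw [Finset.sum_range_succ]
    have h1 := h.episodeCount_nonneg H k s a
    have h2 := h.episodeCount_le H k s a
    have hs := h.count_succ H k s a
    have hmono : h.count1 H k s a ≤ h.count1 H (k + 1) s a :=
      max_le_max (by linarith) le_rfl
    unfold invCount at ih ⊢
    split_ifs with hc
    · have := Real.log_le_log (h.count1_pos H k s a) hmono
      linarith
    · have hn : 0 < h.count H k s a := by omega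
      have hn' : (0 : ℝ) < h.count H k s a := by exact_mod_cast hn
      have hHn : (H : ℝ) ≤ h.count H k s a := by exact_mod_cast hN.trans (not_lt.1 hc)
      have hn2 : 0 < h.count H (k + 1) s a := by
        have : (0 : ℝ) < h.count H (k + 1) s a := by linarith
        exact_mod_cast this
      rw [h.count1_of_pos hn] at ih
      rw [h.count1_of_pos hn2, hs]
      have e : (h.count H k s a : ℝ) + h.episodeCount H k s a =
          h.count H k s a * (1 + h.episodeCount H k s a * (1 / h.count H k s a)) := by
        field_simp
      rw [e, Real.log_mul hn'.ne' (by positivity)]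
      have := le_two_mul_log (z := h.episodeCount H k s a * (1 / h.count H k s a))
        (by positivity) (by rw [mul_one_div]; exact (div_le_one hn').2 (h2.trans hHn))
      linarith

variable [Fintype S] [Fintype A]

lemma epSum_unseen_le (h : History S A) (H N k : ℕ) :
    epSum H k (fun j t => h.unseen H N j (h.state j t) (h.action j t)) ≤
      Fintype.card S * Fintype.card A * (N + H) := by
  rw [h.epSum_pair H k (fun j s a => h.unseen H N j s a)]
  calc _ ≤ ∑ _s : S, ∑ _a : A, ((N : ℝ) + H) := Finset.sum_le_sum fun s _ =>
        Finset.sum_le_sum fun a _ => (h.sum_episodeCount_mul_unseen_le H N k s a).2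
    _ = _ := by simp; ring

lemma epSum_invCount_le (h : History S A) {H N : ℕ} (hN : H ≤ N) (hH : 0 < H) {k : ℕ} {ℓ : ℝ}
    (hℓ : 0 ≤ ℓ) (hk : (k * H : ℕ) ≤ Real.exp ℓ) :
    epSum H k (fun j t => h.invCount H N j (h.state j t) (h.action j t)) ≤
      2 * (Fintype.card S * Fintype.card A * ℓ) := by
  rw [h.epSum_pair H k (fun j s a => h.invCount H N j s a)]
  calc _ ≤ ∑ _s : S, ∑ _a : A, 2 * ℓ := Finset.sum_le_sum fun s _ =>
        Finset.sum_le_sum fun a _ => by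
          refine (h.sum_episodeCount_mul_invCount_le hN hH k s a).trans ?_
          have h1 : h.count1 H k s a ≤ Real.exp ℓ := by
            refine max_le (le_trans ?_ hk) (Real.one_le_exp hℓ)
            exact_mod_cast h.count_le H k s a
          have h2 := Real.log_le_log (h.count1_pos H k s a) h1
          rw [Real.log_exp] at h2
          linarith
    _ = _ := by simp; ring

end History

/-! ### The total decrease of the estimates -/

/-- Each step changes only the visited state, so the decreases met along the path are all the
decreases there are. This prices the one-state updates: a backup bounds the new estimate, and the
old one exceeds it by the decrease. -/
lemma epSum_decrease {S : Type*} [Fintype S] [DecidableEq S] {H : ℕ} {E : ℕ → ℕ → S → ℝ}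
    {st : ℕ → ℕ → S} (hE : ∀ j, ∀ t < H, ∀ s, s ≠ st j t → E (j + 1) t s = E j t s) (k : ℕ) :
    epSum H k (fun j t => E j t (st j t) - E (j + 1) t (st j t)) =
      ∑ t ∈ Finset.range H, ∑ s, (E 0 t s - E k t s) := by
  induction k with
  | zero => simp [epSum]
  | succ k ih =>
    rw [epSum, Finset.sum_range_succ]
    rw [epSum] at ih
    rw [ih, ← Finset.sum_add_distrib]
    refine Finset.sum_congr rfl fun t ht => ?_
    have : E k t (st k t) - E (k + 1) t (st k t) = ∑ s, (E k t s - E (k + 1) t s) := by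
      rw [Finset.sum_eq_single (st k t)]
      · intro s _ hs
        rw [hE k t (Finset.mem_range.1 ht) s hs, sub_self]
      · simp
    rw [this, ← Finset.sum_add_distrib]
    exact Finset.sum_congr rfl fun s _ => by ring

lemma epSum_decrease_le {S : Type*} [Fintype S] [DecidableEq S] {H : ℕ} {E : ℕ → ℕ → S → ℝ}
    {st : ℕ → ℕ → S} (hE : ∀ j, ∀ t < H, ∀ s, s ≠ st j t → E (j + 1) t s = E j t s) {k : ℕ}
    (h0 : ∀ t < H, ∀ s, E 0 t s ≤ H) (hk : ∀ t < H, ∀ s, 0 ≤ E k t s) :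
    epSum H k (fun j t => E j t (st j t) - E (j + 1) t (st j t)) ≤
      Fintype.card S * (H : ℝ) ^ 2 := by
  rw [epSum_decrease hE]
  calc _ ≤ ∑ _t ∈ Finset.range H, ∑ _s : S, (H : ℝ) := Finset.sum_le_sum fun t ht =>
        Finset.sum_le_sum fun s _ => by
          linarith [h0 t (Finset.mem_range.1 ht) s, hk t (Finset.mem_range.1 ht) s]
    _ = _ := by simp; ring

namespace EulerGP

variable {S A : Type*} [Fintype S] [DecidableEq S] [DecidableEq A]

lemma estimates_succ_of_ne (H : ℕ) (ℓ : ℝ) (h : History S A) (k t : ℕ) {s : S}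
    (hs : s ≠ h.state k t) : (estimates H ℓ h (k + 1)).1 t s = (estimates H ℓ h k).1 t s ∧
      (estimates H ℓ h (k + 1)).2 t s = (estimates H ℓ h k).2 t s := by
  have : ¬(t < H ∧ h.state k t = s) := fun hc => hs hc.2.symm
  simp [estimates, this]

lemma upper_succ_le (H : ℕ) (ℓ : ℝ) (h : History S A) {k t : ℕ} (ht : t < H) :
    (estimates H ℓ h (k + 1)).1 t (h.state k t) ≤ qUpper H ℓ h k ((estimates H ℓ h k).1 (t + 1))
      ((estimates H ℓ h k).2 (t + 1)) (h.state k t) (h.action k t) := by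
  simp [estimates, ht]

lemma le_lower_succ (H : ℕ) (ℓ : ℝ) (h : History S A) {k t : ℕ} (ht : t < H) :
    qLower H ℓ h k ((estimates H ℓ h k).1 (t + 1))
      ((estimates H ℓ h k).2 (t + 1)) (h.state k t) (h.action k t)
      ≤ (estimates H ℓ h (k + 1)).2 t (h.state k t) := by
  simp [estimates, ht]

lemma upper_succ_le_upper (H : ℕ) (ℓ : ℝ) (h : History S A) (k t : ℕ) (s : S) :
    (estimates H ℓ h (k + 1)).1 t s ≤ (estimates H ℓ h k).1 t s := by
  simp only [estimates]; split_ifs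
  · exact min_le_left _ _
  · exact le_rfl

lemma lower_le_lower_succ (H : ℕ) (ℓ : ℝ) (h : History S A) (k t : ℕ) (s : S) :
    (estimates H ℓ h k).2 t s ≤ (estimates H ℓ h (k + 1)).2 t s := by
  simp only [estimates]; split_ifs
  · exact le_max_left _ _
  · exact le_rfl

end EulerGP

/-! ### Upper bounds for the bonuses on the good event. -/

lemma sqrt_le_add_of_le {a u v : ℝ} (hu : 0 ≤ u) (hv : 0 ≤ v) (h : a ≤ u ^ 2 + v ^ 2) :
    √a ≤ u + v := by
  rw [Real.sqrt_le_left (by linarith)]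
  nlinarith [mul_nonneg hu hv]

lemma sqrt_two_le : √2 ≤ 3 / 2 := by
  rw [Real.sqrt_le_left (by norm_num)]; norm_num

namespace EulerGP

variable {S A : Type*} [Fintype S] [DecidableEq S] [DecidableEq A]

lemma sqrt_two_mul_mul_div_le {v ℓ n : ℝ} (hv : 0 ≤ v) :
    √(2 * v * ℓ / n) ≤ 3 / 2 * (√(ℓ / n) * √v) := by
  rw [show 2 * v * ℓ / n = 2 * (ℓ / n * v) by ring, Real.sqrt_mul (by norm_num),
    Real.sqrt_mul' _ hv]
  exact mul_le_mul_of_nonneg_right sqrt_two_le (by positivity)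

/-- The reverse exchange to `width_le_transBonus`: returning from `U` to `V` costs a second copy of
`‖U - L‖`. For `ℓ ≥ 2` the `B_p` term is absorbed through `√(2 ℓ) ≤ ℓ`. -/
lemma transBonus_le {H : ℕ} {ℓ : ℝ} (hℓ : 2 ≤ ℓ) (h : History S A) (k : ℕ) (s : S) (a : A)
    {V U L : S → ℝ} (hVU : ∀ x, |U x - V x| ≤ |U x - L x|) :
    transBonus H ℓ h k s a U L ≤
      3 / 2 * (√(ℓ / h.count1 H k s a) * √(varOf (h.pHat H k s a) V))
        + 3 * (√(ℓ / h.count1 H k s a) * norm2Of (h.pHat H k s a) (fun x => U x - L x))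
        + 5 * (H * (ℓ / h.count1 H k s a)) := by
  have hp := h.pHat_nonneg H k s a
  have hn := h.count1_pos H k s a
  set n := h.count1 H k s a
  set p := h.pHat H k s a
  have h1 := h.sqrt_varOf_pHat_le H k s a U V
  have h2 : norm2Of p (fun x => U x - V x) ≤ norm2Of p (fun x => U x - L x) := norm2Of_mono hp hVU
  have hN : 0 ≤ norm2Of p (fun x => U x - L x) := Real.sqrt_nonneg _
  set N := norm2Of p (fun x => U x - L x)
  have h3 := sqrt_two_mul_mul_div_le (ℓ := ℓ) (n := n) (varOf_nonneg hp U)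
  have h4 : √(ℓ / n) * √(varOf p U) ≤ √(ℓ / n) * (√(varOf p V) + N) :=
    mul_le_mul_of_nonneg_left (h1.trans (add_le_add le_rfl h2)) (Real.sqrt_nonneg _)
  have h5 : √(2 * ℓ) * N / √n ≤ 3 / 2 * (√(ℓ / n) * N) := by
    rw [Real.sqrt_mul (by norm_num), Real.sqrt_div (by linarith)]
    have : √2 * √ℓ * N / √n = √2 * (√ℓ / √n * N) := by ring
    rw [this]
    exact mul_le_mul_of_nonneg_right sqrt_two_le (by positivity)
  have h6 : √(2 * ℓ) ≤ ℓ := by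
    rw [Real.sqrt_le_left (by linarith)]; nlinarith
  have h7 : 2 * H * ℓ / (3 * n) + (4 * (2 * H * ℓ / 3) + H * √(2 * ℓ)) / n ≤
      5 * (H * (ℓ / n)) := by
    have e : 5 * (H * (ℓ / n)) - (2 * H * ℓ / (3 * n) + (4 * (2 * H * ℓ / 3)
        + H * √(2 * ℓ)) / n) = H * ((5 / 3 * ℓ - √(2 * ℓ)) / n) := by
      field_simp; ring
    have : 0 ≤ H * ((5 / 3 * ℓ - √(2 * ℓ)) / n) :=
      mul_nonneg (Nat.cast_nonneg _) (div_nonneg (by linarith) hn.le)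
    linarith
  unfold transBonus phi constBv constBp constJ
  linarith

end EulerGP

namespace EulerGPRun

variable {S A Ω : Type*} [Fintype S] [DecidableEq S] [Fintype A] [DecidableEq A]
  [mΩ : MeasurableSpace Ω] {M : FiniteMDP S A} {K : ℕ} {δ : ℝ} {P : Measure Ω}

lemma epSum_visitInd_mul (run : EulerGPRun M K δ P) (s : S) (a : A) (k : ℕ) (ω : Ω)
    (F : ℕ → ℕ → ℝ) : epSum M.H k (fun j t => run.visitInd s a j t ω * F j t) =
      ∑ j ∈ Finset.range k, ∑ t ∈ Finset.range M.H,
        if (run.hist ω).state j t = s ∧ (run.hist ω).action j t = a then F j t else 0 := by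
  rw [← History.sum_visits, run.sum_visits_eq s a k ω F, epSum]

variable {run : EulerGPRun M K δ P} {ℓ : ℝ} {ω : Ω}

namespace GoodEvent

lemma pHat_le (hg : run.GoodEvent ℓ ω) {k : ℕ} (hk : k ≤ K) {s : S} {a : A}
    (hn : 0 < (run.hist ω).count M.H k s a) (s' : S) :
    (run.hist ω).pHat M.H k s a s' ≤ (1 + 1 / M.H) * M.p s a s'
      + 16 * (M.H * (ℓ / (run.hist ω).count M.H k s a)) := by
  have hn' : (0 : ℝ) < (run.hist ω).count M.H k s a := by exact_mod_cast hn
  have h := hg.trans ((s, a), s') k hk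
  rw [run.epSum_visitInd_mul s a k ω (fun j t => if run.state j (t + 1) ω = s' then 1 else 0)] at h
  rw [History.pHat_eq_sum, div_le_iff₀ hn']
  refine h.trans_eq ?_
  field_simp

/-- `D` may depend on the data, so the transition probabilities are compared entry by entry. The
price is the factor `S` in the additive term; the main term grows by `1 + 1 / H` only. -/
lemma meanOf_pHat_le (hg : run.GoodEvent ℓ ω) (hℓ : 0 ≤ ℓ) {k : ℕ} (hk : k ≤ K) {s : S} {a : A}
    (hn : 0 < (run.hist ω).count M.H k s a) {D : S → ℝ} {b : ℝ} (hD : ∀ x, 0 ≤ D x)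
    (hb : ∀ x, D x ≤ b) :
    meanOf ((run.hist ω).pHat M.H k s a) D ≤ (1 + 1 / M.H) * meanOf (M.p s a) D
      + 16 * (Fintype.card S * M.H * b * (ℓ / (run.hist ω).count M.H k s a)) := by
  set y := ℓ / (run.hist ω).count M.H k s a with hy
  have hy0 : 0 ≤ y := by positivity
  have h1 : ∀ x ∈ (Finset.univ : Finset S), (run.hist ω).pHat M.H k s a x * D x ≤
      (1 + 1 / M.H) * (M.p s a x * D x) + 16 * (M.H * y) * b := fun x _ => by
    have h2 := mul_le_mul_of_nonneg_right (hg.pHat_le hk hn x) (hD x)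
    have h3 : 16 * (M.H * y) * D x ≤ 16 * (M.H * y) * b :=
      mul_le_mul_of_nonneg_left (hb x) (by positivity)
    linarith
  refine (Finset.sum_le_sum h1).trans_eq ?_
  rw [Finset.sum_add_distrib, ← Finset.mul_sum, meanOf]
  simp; ring

/-- Replacing the sample mean by the true mean increases the sum of squares. For `n ≥ 2` one has `n
- 1 ≥ n / 2`; for `n = 1` the division by zero makes the left side `0`. -/
lemma varHat_le (hg : run.GoodEvent ℓ ω) (hℓ : 0 ≤ ℓ) {k : ℕ} (hk : k ≤ K) {s : S} {a : A}
    (hn : 0 < (run.hist ω).count M.H k s a) :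
    (run.hist ω).varHat M.H k s a ≤ 4 * M.varR s a
      + 60 * (ℓ / (run.hist ω).count M.H k s a) := by
  have hn' : (0 : ℝ) < (run.hist ω).count M.H k s a := by exact_mod_cast hn
  have h := hg.rewardVar (s, a) k hk
  rw [run.epSum_visitInd_mul s a k ω (fun j t => (run.reward j t ω - M.r s a) ^ 2),
    ← History.sum_visits (run.hist ω) M.H k s a
      (fun j t => (run.reward j t ω - M.r s a) ^ 2)] at h
  have hv := M.varR_nonneg s a
  have hR : (run.hist ω).rHat M.H k s a * (run.hist ω).count M.H k s a =
      ∑ i ∈ (run.hist ω).visits M.H k s a, run.reward i.1 i.2 ω :=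
    div_mul_cancel₀ _ hn'.ne'
  have h1 : ∑ i ∈ (run.hist ω).visits M.H k s a,
      ((run.hist ω).reward i.1 i.2 - (run.hist ω).rHat M.H k s a) ^ 2 ≤
      ∑ i ∈ (run.hist ω).visits M.H k s a, (run.reward i.1 i.2 ω - M.r s a) ^ 2 := by
    have e : ∑ i ∈ (run.hist ω).visits M.H k s a, (run.reward i.1 i.2 ω - M.r s a) ^ 2 =
        ∑ i ∈ (run.hist ω).visits M.H k s a,
          ((run.reward i.1 i.2 ω - (run.hist ω).rHat M.H k s a) ^ 2
          + (2 * ((run.hist ω).rHat M.H k s a - M.r s a) * run.reward i.1 i.2 ω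
          + (M.r s a ^ 2 - (run.hist ω).rHat M.H k s a ^ 2))) :=
      Finset.sum_congr rfl fun i _ => by ring
    rw [e, Finset.sum_add_distrib, Finset.sum_add_distrib, ← Finset.mul_sum, ← hR,
      Finset.sum_const, nsmul_eq_mul]
    change _ ≤ _ + (_ + ((run.hist ω).count M.H k s a : ℝ) * _)
    have : 0 ≤ ((run.hist ω).count M.H k s a : ℝ)
      * ((run.hist ω).rHat M.H k s a - M.r s a) ^ 2 := by positivity
    change ∑ i ∈ (run.hist ω).visits M.H k s a, (run.reward i.1 i.2 ω
      - (run.hist ω).rHat M.H k s a) ^ 2 ≤ _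
    linarith
  have h2 := h1.trans h
  rw [History.varHat]
  rcases Nat.lt_or_ge 1 ((run.hist ω).count M.H k s a) with hn2 | hn2
  · have hn3 : (2 : ℝ) ≤ (run.hist ω).count M.H k s a := by exact_mod_cast hn2
    rw [div_le_iff₀ (by linarith)]
    refine h2.trans ?_
    set n := ((run.hist ω).count M.H k s a : ℝ)
    have e : 60 * (ℓ / n) * (n - 1) = 60 * ℓ - 60 * (ℓ / n) := by field_simp
    have h3 : ℓ / n ≤ ℓ / 2 := div_le_div_of_nonneg_left hℓ (by norm_num) hn3
    have h4 : 0 ≤ M.varR s a * (n - 2) := mul_nonneg hv (by linarith)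
    simp only
    rw [add_mul, e]
    nlinarith
  · have : (run.hist ω).count M.H k s a = 1 := by omega
    rw [this]
    simp only [Nat.cast_one, sub_self, div_zero]
    positivity

lemma varOf_pHat_le (hg : run.GoodEvent ℓ ω) {k : ℕ} (hk : k ≤ K) {s : S} {a : A}
    (hn : 0 < (run.hist ω).count M.H k s a) {t : ℕ} (ht : t < M.H) :
    varOf ((run.hist ω).pHat M.H k s a) (M.optValue (t + 1)) ≤
      2 * varOf (M.p s a) (M.optValue (t + 1))
        + 30 * ((M.H : ℝ) ^ 2 * (ℓ / (run.hist ω).count M.H k s a)) := by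
  have hn' : (0 : ℝ) < (run.hist ω).count M.H k s a := by exact_mod_cast hn
  have h := hg.transVar ((s, a), ⟨t, ht⟩) k hk
  refine (varOf_le_meanOf_sq ((run.hist ω).pHat_sum hn) _
    (meanOf (M.p s a) (M.optValue (t + 1)))).trans ?_
  rw [run.epSum_visitInd_mul s a k ω (fun j u => (M.optValue (t + 1) (run.state j (u + 1) ω)
      - meanOf (M.p s a) (M.optValue (t + 1))) ^ 2)] at h
  rw [History.sum_pHat_mul, div_le_iff₀ hn']
  refine h.trans_eq ?_
  field_simp; ring

lemma rewardBonus_le (hg : run.GoodEvent ℓ ω) (hℓ : 0 ≤ ℓ) {k : ℕ} (hk : k ≤ K) {s : S} {a : A}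
    (hn : 0 < (run.hist ω).count M.H k s a) :
    EulerGP.rewardBonus M.H ℓ (run.hist ω) k s a ≤
      3 * (√(ℓ / (run.hist ω).count M.H k s a) * √(M.varR s a))
        + 16 * (ℓ / (run.hist ω).count M.H k s a) := by
  have hn' : (0 : ℝ) < (run.hist ω).count M.H k s a := by exact_mod_cast hn
  have hv := M.varR_nonneg s a
  have h := hg.varHat_le hℓ hk hn
  rw [EulerGP.rewardBonus, History.count1_of_pos _ hn]
  set n := ((run.hist ω).count M.H k s a : ℝ)
  have hy : 0 ≤ ℓ / n := by positivity
  -- With `y = ℓ / n` and `v` the reward variance: `2 y (4 v + 60 y) ≤ 9 y v + 121 y²`, the sum of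
  -- the squares of the two terms.
  have h1 : √(2 * (run.hist ω).varHat M.H k s a * ℓ / n) ≤
      3 * (√(ℓ / n) * √(M.varR s a)) + 11 * (ℓ / n) := by
    refine sqrt_le_add_of_le (by positivity) (by positivity) ?_
    rw [mul_pow, mul_pow, Real.sq_sqrt hy, Real.sq_sqrt hv]
    have h2 := mul_le_mul_of_nonneg_right h hy
    have e : 2 * (run.hist ω).varHat M.H k s a * ℓ / n =
        2 * ((run.hist ω).varHat M.H k s a * (ℓ / n)) := by ring
    rw [e]
    nlinarith [mul_nonneg hy hv, mul_nonneg hy hy]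
  have e2 : 14 * ℓ / (3 * n) = 14 / 3 * (ℓ / n) := by field_simp
  rw [e2]
  linarith

lemma norm2Of_pHat_le (hg : run.GoodEvent ℓ ω) (hℓ : 0 ≤ ℓ) {k : ℕ} (hk : k ≤ K) {s : S} {a : A}
    (hn : 0 < (run.hist ω).count M.H k s a) {D : S → ℝ} (hD : ∀ x, 0 ≤ D x)
    (hb : ∀ x, D x ≤ M.H) :
    norm2Of ((run.hist ω).pHat M.H k s a) D ≤ 3 / 2 * √(meanOf (M.p s a) (fun x => D x ^ 2))
      + 4 * (Fintype.card S * (M.H : ℝ) ^ 2 * √(ℓ / (run.hist ω).count M.H k s a)) := by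
  have hH : (1 : ℝ) ≤ M.H := by exact_mod_cast M.H_pos
  have hS : (1 : ℝ) ≤ Fintype.card S := by
    exact_mod_cast Fintype.card_pos_iff.2 ⟨s⟩
  have h := hg.meanOf_pHat_le hℓ hk hn (D := fun x => D x ^ 2) (b := (M.H : ℝ) ^ 2)
    (fun x => sq_nonneg _) (fun x => pow_le_pow_left₀ (hD x) (hb x) 2)
  have hm : 0 ≤ meanOf (M.p s a) (fun x => D x ^ 2) :=
    meanOf_nonneg (M.p_nonneg s a) fun x => sq_nonneg _
  set m := meanOf (M.p s a) (fun x => D x ^ 2)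
  have hy : 0 ≤ ℓ / (run.hist ω).count M.H k s a := by positivity
  set y := ℓ / (run.hist ω).count M.H k s a
  refine sqrt_le_add_of_le (by positivity) (by positivity) (h.trans ?_)
  rw [mul_pow, mul_pow, mul_pow, Real.sq_sqrt hm, Real.sq_sqrt hy]
  have h1 : 1 / (M.H : ℝ) ≤ 1 := (div_le_one (by linarith)).2 hH
  have h2 : (1 + 1 / (M.H : ℝ)) * m ≤ (3 / 2) ^ 2 * m :=
    mul_le_mul_of_nonneg_right (by linarith) hm
  have h3 : (Fintype.card S : ℝ) * M.H * M.H ^ 2 ≤ (Fintype.card S * (M.H : ℝ) ^ 2) ^ 2 := by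
    calc (Fintype.card S : ℝ) * M.H * (M.H : ℝ) ^ 2 =
          (Fintype.card S * (M.H : ℝ) ^ 3) * 1 := by ring
      _ ≤ (Fintype.card S * (M.H : ℝ) ^ 3) * (Fintype.card S * M.H) :=
          mul_le_mul_of_nonneg_left (one_le_mul_of_one_le_of_one_le hS hH) (by positivity)
      _ = _ := by ring
  have h4 := mul_le_mul_of_nonneg_right h3 hy
  nlinarith

variable [Nonempty A]

/-- The excess of the upper `Q`-value of a visited pair over its value. -/
lemma qUpper_le (hg : run.GoodEvent ℓ ω) (hℓ : 2 ≤ ℓ) {k : ℕ} (hk : k ≤ K) {s : S} {a : A}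
    (hn : 0 < (run.hist ω).count M.H k s a) {t : ℕ} (ht : t < M.H) {U L : S → ℝ}
    (hL0 : ∀ x, 0 ≤ L x) (hLV : ∀ x, L x ≤ M.optValue (t + 1) x)
    (hVU : ∀ x, M.optValue (t + 1) x ≤ U x) (hUH : ∀ x, U x ≤ M.H) :
    EulerGP.qUpper M.H ℓ (run.hist ω) k U L s a ≤ M.r s a
      + meanOf (M.p s a) (M.optValue (t + 1))
      + (1 + 1 / M.H) * meanOf (M.p s a) (fun x => U x - M.optValue (t + 1) x)
      + 6 * (√(ℓ / (run.hist ω).count M.H k s a) * (√(M.varR s a)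
        + √(varOf (M.p s a) (M.optValue (t + 1)))
        + √(meanOf (M.p s a) (fun x => (U x - L x) ^ 2))))
      + 90 * (Fintype.card S * (M.H : ℝ) ^ 2 * (ℓ / (run.hist ω).count M.H k s a)) := by
  have hH : (1 : ℝ) ≤ M.H := by exact_mod_cast M.H_pos
  have hS : (1 : ℝ) ≤ Fintype.card S := by
    exact_mod_cast Fintype.card_pos_iff.2 ⟨s⟩
  have hn' : (0 : ℝ) < (run.hist ω).count M.H k s a := by exact_mod_cast hn
  have hacc := hg.accurate k hk
  have hp := (run.hist ω).pHat_nonneg M.H k s a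
  have h1 := (abs_le.1 (hacc.reward s a)).2
  have h2 := (abs_le.1 (hacc.trans s a t ht)).2
  have h3 := hg.rewardBonus_le (by linarith) hk hn
  have h4 := EulerGP.transBonus_le (H := M.H) hℓ (run.hist ω) k s a (V := M.optValue (t + 1))
    (U := U) (L := L) (fun x => by
      rw [abs_of_nonneg (by linarith [hVU x]), abs_of_nonneg (by linarith [hVU x, hLV x])]
      linarith [hLV x])
  -- `p̂ U = p̂ V* + p̂ (U - V*)`: Bernstein handles the fixed function `V*`, and the entrywise
  -- comparison handles the data-dependent difference.
  have h5 := hg.meanOf_pHat_le (by linarith) hk hn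
    (D := fun x => U x - M.optValue (t + 1) x) (b := M.H) (fun x => by linarith [hVU x])
    (fun x => by linarith [hUH x, M.optValue_nonneg (t + 1) x])
  rw [meanOf_sub] at h5
  have h6 := hg.varOf_pHat_le hk hn ht
  have h7 := hg.norm2Of_pHat_le (by linarith) hk hn (D := fun x => U x - L x)
    (fun x => by linarith [hVU x, hLV x]) (fun x => by linarith [hUH x, hL0 x])
  have h8 := EulerGP.sqrt_two_mul_mul_div_le (ℓ := ℓ) (n := (run.hist ω).count M.H k s a)
    (varOf_nonneg hp (M.optValue (t + 1)))
  rw [History.count1_of_pos _ hn] at h2 h4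
  unfold EulerGP.qUpper
  have hy : 0 ≤ ℓ / (run.hist ω).count M.H k s a := by positivity
  have e1 : (M.H : ℝ) * ℓ / (run.hist ω).count M.H k s a
    = M.H * (ℓ / (run.hist ω).count M.H k s a) := by ring
  rw [e1] at h2
  set y := ℓ / (run.hist ω).count M.H k s a
  set v := varOf (M.p s a) (M.optValue (t + 1)) with hv
  have hv0 : 0 ≤ v := varOf_nonneg (M.p_nonneg s a) _
  have h9 : √(varOf ((run.hist ω).pHat M.H k s a) (M.optValue (t + 1))) ≤
      3 / 2 * √v + 6 * (M.H * √y) := by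
    refine sqrt_le_add_of_le (by positivity) (by positivity) (h6.trans ?_)
    rw [mul_pow, mul_pow, mul_pow, Real.sq_sqrt hv0, Real.sq_sqrt hy]
    nlinarith [mul_nonneg (sq_nonneg (M.H : ℝ)) hy]
  have hq := Real.sqrt_nonneg y
  have hqq : √y * √y = y := Real.mul_self_sqrt hy
  have h10 := mul_le_mul_of_nonneg_left h9 hq
  have h11 := mul_le_mul_of_nonneg_left h7 hq
  set m := meanOf (M.p s a) (fun x => (U x - L x) ^ 2)
  have e2 : √y * (3 / 2 * √v + 6 * (M.H * √y)) = 3 / 2 * (√y * √v) + 6 * (M.H * y) := by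
    linear_combination (6 * (M.H : ℝ)) * hqq
  have e3 : √y * (3 / 2 * √m + 4 * (Fintype.card S * (M.H : ℝ) ^ 2 * √y)) =
      3 / 2 * (√y * √m) + 4 * (Fintype.card S * (M.H : ℝ) ^ 2 * y) := by
    linear_combination (4 * (Fintype.card S * (M.H : ℝ) ^ 2)) * hqq
  rw [e2] at h10
  rw [e3] at h11
  have e4 : (Fintype.card S : ℝ) * M.H * M.H * y = Fintype.card S * (M.H : ℝ) ^ 2 * y := by ring
  rw [e4] at h5
  have h12 : (M.H : ℝ) * y ≤ Fintype.card S * (M.H : ℝ) ^ 2 * y := by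
    refine mul_le_mul_of_nonneg_right ?_ hy
    calc (M.H : ℝ) = 1 * (M.H * 1) := by ring
      _ ≤ Fintype.card S * (M.H * M.H) := by gcongr
      _ = _ := by ring
  have h13 : y ≤ M.H * y := le_mul_of_one_le_left hy hH
  have h14 : 0 ≤ √y * √v := by positivity
  have h15 : 0 ≤ √y * √m := by positivity
  have h16 : 0 ≤ √y * √(M.varR s a) := by positivity
  rw [mul_add (√y), mul_add (√y)]
  linarith

/-- The width of the confidence interval of a visited pair. -/
lemma qUpper_sub_qLower_le (hg : run.GoodEvent ℓ ω) (hℓ : 2 ≤ ℓ) {k : ℕ} (hk : k ≤ K) {s : S}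
    {a : A} (hn : 0 < (run.hist ω).count M.H k s a) {t : ℕ} {U L : S → ℝ}
    (hL0 : ∀ x, 0 ≤ L x) (hLV : ∀ x, L x ≤ M.optValue (t + 1) x)
    (hVU : ∀ x, M.optValue (t + 1) x ≤ U x) (hUH : ∀ x, U x ≤ M.H) :
    EulerGP.qUpper M.H ℓ (run.hist ω) k U L s a - EulerGP.qLower M.H ℓ (run.hist ω) k U L s a ≤
      (1 + 1 / M.H) * meanOf (M.p s a) (fun x => U x - L x)
      + 15 * (M.H * √(ℓ / (run.hist ω).count M.H k s a))
      + 58 * (Fintype.card S * (M.H : ℝ) ^ 2 * (ℓ / (run.hist ω).count M.H k s a)) := by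
  have hH : (1 : ℝ) ≤ M.H := by exact_mod_cast M.H_pos
  have hS : (1 : ℝ) ≤ Fintype.card S := by
    exact_mod_cast Fintype.card_pos_iff.2 ⟨s⟩
  have hn' : (0 : ℝ) < (run.hist ω).count M.H k s a := by exact_mod_cast hn
  have hp := (run.hist ω).pHat_nonneg M.H k s a
  have hUL : ∀ x, 0 ≤ U x - L x := fun x => by linarith [hVU x, hLV x]
  have hULH : ∀ x, U x - L x ≤ M.H := fun x => by linarith [hUH x, hL0 x]
  have h3 := hg.rewardBonus_le (by linarith) hk hn
  have h4 := EulerGP.transBonus_le (H := M.H) hℓ (run.hist ω) k s a (V := M.optValue (t + 1))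
    (U := U) (L := L) (fun x => by
      rw [abs_of_nonneg (by linarith [hVU x]), abs_of_nonneg (hUL x)]
      linarith [hLV x])
  have h4' := EulerGP.transBonus_le (H := M.H) hℓ (run.hist ω) k s a (V := M.optValue (t + 1))
    (U := L) (L := U) (fun x => by
      rw [abs_sub_comm, abs_of_nonneg (by linarith [hLV x]), abs_sub_comm, abs_of_nonneg (hUL x)]
      linarith [hVU x])
  have h5 := hg.meanOf_pHat_le (by linarith) hk hn
    (D := fun x => U x - L x) (b := M.H) hUL hULH
  rw [meanOf_sub] at h5
  -- Crude bounds by `H` suffice, since the widths contribute to the regret at lower order only.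
  have h6 : √(varOf ((run.hist ω).pHat M.H k s a) (M.optValue (t + 1))) ≤ M.H := by
    rw [Real.sqrt_le_left (by linarith)]
    refine (varOf_le_meanOf_sq ((run.hist ω).pHat_sum hn) _ 0).trans
      (meanOf_le hp ((run.hist ω).pHat_sum hn).le (by positivity) fun x => ?_)
    rw [sub_zero]
    exact pow_le_pow_left₀ (M.optValue_nonneg _ x) (M.optValue_le _ x) 2
  have h7 : norm2Of ((run.hist ω).pHat M.H k s a) (fun x => U x - L x) ≤ M.H := by
    rw [← abs_of_nonneg (by linarith : (0 : ℝ) ≤ M.H)]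
    refine abs_le_of_sq_le_sq' ?_ (abs_nonneg _) |>.2
    rw [norm2Of_sq hp, sq_abs]
    exact meanOf_le hp ((run.hist ω).pHat_sum hn).le (by positivity) fun x =>
      pow_le_pow_left₀ (hUL x) (hULH x) 2
  have h7' : norm2Of ((run.hist ω).pHat M.H k s a) (fun x => L x - U x) ≤ M.H :=
    (norm2Of_mono hp fun x => (abs_sub_comm _ _).le).trans h7
  have h8 : √(M.varR s a) ≤ 1 := by
    rw [Real.sqrt_le_one]; exact M.varR_le_one s a
  rw [History.count1_of_pos _ hn] at h4 h4'
  unfold EulerGP.qUpper EulerGP.qLower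
  have hy : 0 ≤ ℓ / (run.hist ω).count M.H k s a := by positivity
  set y := ℓ / (run.hist ω).count M.H k s a
  have hq := Real.sqrt_nonneg y
  have h10 := mul_le_mul_of_nonneg_left h6 hq
  have h11 := mul_le_mul_of_nonneg_left h7 hq
  have h11' := mul_le_mul_of_nonneg_left h7' hq
  have h8' := mul_le_mul_of_nonneg_left h8 hq
  have e4 : (Fintype.card S : ℝ) * M.H * M.H * y = Fintype.card S * (M.H : ℝ) ^ 2 * y := by ring
  rw [e4] at h5
  have h12 : (M.H : ℝ) * y ≤ Fintype.card S * (M.H : ℝ) ^ 2 * y := by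
    refine mul_le_mul_of_nonneg_right ?_ hy
    calc (M.H : ℝ) = 1 * (M.H * 1) := by ring
      _ ≤ Fintype.card S * (M.H * M.H) := by gcongr
      _ = _ := by ring
  have h13 : y ≤ M.H * y := le_mul_of_one_le_left hy hH
  have h14 : √y ≤ M.H * √y := le_mul_of_one_le_left hq hH
  rw [mul_comm (√y) (M.H : ℝ)] at h10 h11 h11'
  linarith

end GoodEvent

end EulerGPRun

/-! ### Recursions along the path -/

/-- Weighting time-step `t` by `γ ^ t` makes the recursion telescope, up to the martingale terms `m
t - a (t + 1)`. -/
lemma pow_mul_le_sum_of_recursion {H : ℕ} {γ : ℝ} (hγ : 0 ≤ γ) {a c m : ℕ → ℝ} (haH : a H = 0)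
    (hrec : ∀ t < H, a t ≤ c t + γ * m t) : ∀ τ ≤ H,
    γ ^ τ * a τ ≤ ∑ t ∈ Finset.Ico τ H, (γ ^ t * c t + γ ^ (t + 1) * (m t - a (t + 1))) := by
  intro τ hτ
  induction hτ using Nat.decreasingInduction with
  | self => simp [haH]
  | of_succ τ hτ ih =>
    rw [Finset.sum_eq_sum_Ico_succ_bot hτ]
    have h1 := mul_le_mul_of_nonneg_left (hrec τ hτ) (pow_nonneg hγ τ)
    have e : γ ^ τ * (c τ + γ * m τ) = γ ^ τ * c τ + γ ^ (τ + 1) * m τ := by ring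
    rw [e] at h1
    linarith

namespace EulerGPRun

variable {S A Ω : Type*} [Fintype S] [DecidableEq S] [Fintype A] [DecidableEq A]
  [mΩ : MeasurableSpace Ω] {M : FiniteMDP S A} {K : ℕ} {δ : ℝ} {P : Measure Ω}
  {run : EulerGPRun M K δ P} {ω : Ω}

lemma epSum_nextVal_le {k : ℕ} {g : ℕ → ℕ → S → ℝ} {a : ℕ → ℕ → ℝ}
    (hag : ∀ j < k, ∀ t < M.H, a j (t + 1) = run.nextVal ω g j t) {b : ℝ}
    (hb : ∀ τ ≤ M.H, ∑ j ∈ Finset.range k, a j τ ≤ b) :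
    epSum M.H k (run.nextVal ω g) ≤ M.H * b := by
  rw [← epSum_congr hag, epSum, Finset.sum_comm]
  calc _ ≤ ∑ _t ∈ Finset.range M.H, b :=
        Finset.sum_le_sum fun t ht => hb (t + 1) (Finset.mem_range.1 ht)
    _ = _ := by simp

/-- A quantity that is dominated, up to the factor `1 + 7 / H` and an additive error, by the
conditional mean of its value at the next time-step, is bounded by the total error. -/
lemma PathBound.sum_le {x B : ℝ} {g : ℕ → ℕ → S → ℝ} (hb : run.PathBound x ω g B) (hx : 0 ≤ x)
    (hB : 0 ≤ B) {k : ℕ} (hk : k ≤ K) {a c : ℕ → ℕ → ℝ} (ha : ∀ j < k, ∀ t ≤ M.H, 0 ≤ a j t)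
    (haH : ∀ j < k, a j M.H = 0) (hag : ∀ j < k, ∀ t < M.H, a j (t + 1) = run.nextVal ω g j t)
    (hc : ∀ j < k, ∀ t < M.H, 0 ≤ c j t)
    (hrec : ∀ j < k, ∀ t < M.H, a j t ≤ c j t + (1 + 7 / M.H) * run.nextMean ω g j t) :
    ∀ τ ≤ M.H, ∑ j ∈ Finset.range k, a j τ ≤
      4374 * epSum M.H k c + 13 * 2187 ^ 2 * (M.H * (B * x)) := by
  have hH : (1 : ℝ) ≤ M.H := by exact_mod_cast M.H_pos
  -- At the time-step with the largest sum, the sum over all time-steps is at most `H` times the sum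
  -- to be bounded, which makes absorption possible.
  obtain ⟨τ, hτ, hmax⟩ := Finset.exists_max_image (Finset.range (M.H + 1))
    (fun τ => ∑ j ∈ Finset.range k, a j τ) ⟨0, by simp⟩
  have hmax' : ∀ u ≤ M.H, ∑ j ∈ Finset.range k, a j u ≤ ∑ j ∈ Finset.range k, a j τ :=
    fun u hu => hmax u (Finset.mem_range.2 (by omega))
  have hτ' : τ ≤ M.H := by have := Finset.mem_range.1 hτ; omega
  refine fun u hu => (hmax' u hu).trans ?_
  have hC : 0 ≤ epSum M.H k c := epSum_nonneg hc
  have hBx : 0 ≤ B * x := mul_nonneg hB hx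
  rcases hτ'.eq_or_lt with rfl | hlt
  · rw [Finset.sum_eq_zero fun j hj => haH j (Finset.mem_range.1 hj)]
    positivity
  have hnv := epSum_nextVal_le hag hmax'
  set Aτ := ∑ j ∈ Finset.range k, a j τ with hA
  have hd := hb.diff ⟨τ, hlt⟩ k hk
  have hm := hb.mean k hk
  rw [epSum_add] at hd
  have hγ : (1 : ℝ) ≤ 1 + 7 / M.H := le_add_of_nonneg_right (by positivity)
  have h1 : Aτ ≤ 2187 * epSum M.H k c + 2187 * epSum M.H k (fun j t => pathWeight M.H τ t *
      (run.nextMean ω g j t - run.nextVal ω g j t)) := by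
    rw [← epSum_const_mul, ← epSum_const_mul, ← epSum_add]
    refine Finset.sum_le_sum fun j hj => ?_
    have hj' := Finset.mem_range.1 hj
    have h2 := pow_mul_le_sum_of_recursion (by linarith) (haH j hj') (hrec j hj') τ hτ'
    have h3 : a j τ ≤ (1 + 7 / (M.H : ℝ)) ^ τ * a j τ :=
      le_mul_of_one_le_left (ha j hj' τ hτ') (one_le_pow₀ hγ)
    refine (h3.trans h2).trans ?_
    have e : Finset.Ico τ M.H = (Finset.range M.H).filter fun t => τ ≤ t := by
      ext t; simp [and_comm]
    rw [e, Finset.sum_filter]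
    refine Finset.sum_le_sum fun t ht => ?_
    have ht' := Finset.mem_range.1 ht
    have hct := hc j hj' t ht'
    unfold pathWeight
    beta_reduce
    split_ifs with hc'
    · have h4 := mul_le_mul_of_nonneg_right (pow_le_of_le M.H_pos ht'.le) hct
      rw [hag j hj' t ht']
      linarith
    · linarith
  -- The values add up to at most `H Aτ` and their conditional means to `2 H Aτ + 10 B x`; divided
  -- by `6 H`, this leaves `Aτ / 2`.
  have h5 : 2187 * (1 / (6 * 2187 * (M.H : ℝ)) * (epSum M.H k (run.nextMean ω g)
      + epSum M.H k (run.nextVal ω g))) ≤ 1 / 2 * Aτ + 5 / 3 * (B * x) := by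
    have e : 2187 * (1 / (6 * 2187 * (M.H : ℝ)) * (epSum M.H k (run.nextMean ω g)
      + epSum M.H k (run.nextVal ω g))) = (epSum M.H k (run.nextMean ω g)
      + epSum M.H k (run.nextVal ω g)) / (6 * M.H) := by field_simp
    rw [e, div_le_iff₀ (by positivity)]
    have : B * x ≤ B * x * M.H := le_mul_of_one_le_right hBx hH
    linarith
  have h6 : B * x ≤ M.H * (B * x) := le_mul_of_one_le_left hBx hH
  linarith

/-! ### The gap and the width of the estimates along the path -/

/-- The gap between the upper estimate and the value of the policy at the current state. -/
def gapAt (run : EulerGPRun M K δ P) (ω : Ω) (j t : ℕ) : ℝ :=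
  run.upper j t (run.state j t ω) ω - M.value (run.policy j ω) t (run.state j t ω)

/-- The width of the estimates at the current state. -/
def widthAt (run : EulerGPRun M K δ P) (ω : Ω) (j t : ℕ) : ℝ :=
  run.upper j t (run.state j t ω) ω - run.lower j t (run.state j t ω) ω

/-- The decrease of the upper estimate at the current state. -/
def upperDrop (run : EulerGPRun M K δ P) (ω : Ω) (j t : ℕ) : ℝ :=
  run.upper j t (run.state j t ω) ω - run.upper (j + 1) t (run.state j t ω) ω

/-- The decrease of the width at the current state. -/
def widthDrop (run : EulerGPRun M K δ P) (ω : Ω) (j t : ℕ) : ℝ :=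
  run.widthAt ω j t
    - (run.upper (j + 1) t (run.state j t ω) ω - run.lower (j + 1) t (run.state j t ω) ω)

/-- Whether the current pair had fewer than `S H` visits before the episode. -/
def unseenAt (run : EulerGPRun M K δ P) (ω : Ω) (j t : ℕ) : ℝ :=
  (run.hist ω).unseen M.H (Fintype.card S * M.H) j (run.state j t ω) (run.action j t ω)

/-- The inverse of the number of visits of the current pair before the episode, if there were at
least `S H`. -/
def invCountAt (run : EulerGPRun M K δ P) (ω : Ω) (j t : ℕ) : ℝ :=
  (run.hist ω).invCount M.H (Fintype.card S * M.H) j (run.state j t ω) (run.action j t ω)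

lemma unseenAt_nonneg (j t : ℕ) : 0 ≤ run.unseenAt ω j t := History.unseen_nonneg _ _ _ _ _ _

lemma invCountAt_nonneg (j t : ℕ) : 0 ≤ run.invCountAt ω j t :=
  History.invCount_nonneg _ _ _ _ _ _

lemma card_pos_of_run (run : EulerGPRun M K δ P) (ω : Ω) : 0 < Fintype.card S :=
  Fintype.card_pos_iff.2 ⟨run.state 0 0 ω⟩

/-- The threshold `S H` serves twice: it is at least `H`, as the counting of visits requires, and it
gives `S H / n ≤ 1`, which reduces squares of the `1 / n` terms to first order. -/
lemma unseenAt_eq_one_or (run : EulerGPRun M K δ P) (ω : Ω) (j t : ℕ) :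
    (run.unseenAt ω j t = 1 ∧ run.invCountAt ω j t = 0) ∨ (run.unseenAt ω j t = 0 ∧
      0 < (run.hist ω).count M.H j (run.state j t ω) (run.action j t ω) ∧
      run.invCountAt ω j t
        = 1 / (run.hist ω).count M.H j (run.state j t ω) (run.action j t ω) ∧
      Fintype.card S * (M.H : ℝ) * run.invCountAt ω j t ≤ 1) := by
  have hS := run.card_pos_of_run ω
  have hH := M.H_pos
  unfold unseenAt invCountAt History.unseen History.invCount
  split_ifs with hc
  · exact Or.inl ⟨rfl, rfl⟩
  · have h0 : 0 < Fintype.card S * M.H := Nat.mul_pos hS hH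
    have hn : 0 < (run.hist ω).count M.H j (run.state j t ω) (run.action j t ω) := by omega
    refine Or.inr ⟨rfl, hn, rfl, ?_⟩
    rw [mul_one_div, div_le_one (by exact_mod_cast hn)]
    exact_mod_cast not_lt.1 hc

lemma upper_of_ne (j t : ℕ) {s : S} (hs : s ≠ run.state j t ω) :
    run.upper (j + 1) t s ω = run.upper j t s ω ∧ run.lower (j + 1) t s ω = run.lower j t s ω :=
  EulerGP.estimates_succ_of_ne M.H (logFactor S A M.H K δ) (run.hist ω) j t hs

lemma upperDrop_nonneg (j t : ℕ) : 0 ≤ run.upperDrop ω j t :=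
  sub_nonneg.2 (EulerGP.upper_succ_le_upper _ _ _ _ _ _)

lemma widthDrop_nonneg (j t : ℕ) : 0 ≤ run.widthDrop ω j t := by
  have h1 := EulerGP.upper_succ_le_upper M.H (logFactor S A M.H K δ) (run.hist ω) j t
    (run.state j t ω)
  have h2 := EulerGP.lower_le_lower_succ M.H (logFactor S A M.H K δ) (run.hist ω) j t
    (run.state j t ω)
  unfold widthDrop widthAt upper lower
  linarith

namespace GoodEvent

variable {ℓ : ℝ} [Nonempty A]

lemma brackets (hg : run.GoodEvent ℓ ω) (hL : logFactor S A M.H K δ = ℓ) (hℓ : 0 ≤ ℓ) :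
    ∀ k ≤ K, EulerGP.Brackets M ℓ (run.hist ω) k :=
  EulerGP.brackets_of_isAccurate hℓ (fun k hk => hg.accurate k hk.le) fun k hk t ht a => by
    subst hL
    exact run.greedy k hk ω t ht _ a

/-- The order relations between the estimates and the values. -/
lemma order (hg : run.GoodEvent ℓ ω) (hL : logFactor S A M.H K δ = ℓ) (hℓ : 0 ≤ ℓ) {k : ℕ}
    (hk : k ≤ K) {t : ℕ} (ht : t ≤ M.H) (s : S) :
    0 ≤ run.lower k t s ω ∧ run.lower k t s ω ≤ M.optValue t s ∧
      M.optValue t s ≤ run.upper k t s ω ∧ run.upper k t s ω ≤ (M.H : ℝ) - t := by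
  have hb := hg.brackets hL hℓ k hk
  subst hL
  exact ⟨hb.lower_nonneg t s, hb.lower_le t ht s, hb.le_upper t ht s, hb.upper_le t s⟩

lemma upper_le (hg : run.GoodEvent ℓ ω) (hL : logFactor S A M.H K δ = ℓ) (hℓ : 0 ≤ ℓ) {k : ℕ}
    (hk : k ≤ K) {t : ℕ} (ht : t ≤ M.H) (s : S) : run.upper k t s ω ≤ M.H :=
  (hg.order hL hℓ hk ht s).2.2.2.trans (by linarith [(Nat.cast_nonneg t : (0 : ℝ) ≤ t)])

/-- The martingale bounds need functions bounded for every outcome, hence the clipping; on the good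
event it is inactive. -/
lemma gapFn_eq (hg : run.GoodEvent ℓ ω) (hL : logFactor S A M.H K δ = ℓ) (hℓ : 0 ≤ ℓ) {j : ℕ}
    (hj : j < K) {t : ℕ} (ht : t < M.H) (y : S) :
    run.gapFn ω j t y = run.upper j (t + 1) y ω - M.value (run.policy j ω) (t + 1) y := by
  have h := hg.order hL hℓ hj.le (Nat.succ_le_of_lt ht) y
  have h1 := hg.upper_le hL hℓ hj.le (Nat.succ_le_of_lt ht) y
  have h2 := M.value_le_optValue (run.policy j ω) (t + 1) y
  have h3 := M.value_nonneg (run.policy j ω) (t + 1) y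
  exact clip_of_mem (by linarith) (by linarith)

lemma widthFn_eq (hg : run.GoodEvent ℓ ω) (hL : logFactor S A M.H K δ = ℓ) (hℓ : 0 ≤ ℓ) {j : ℕ}
    (hj : j < K) {t : ℕ} (ht : t < M.H) (y : S) :
    run.widthFn ω j t y = (run.upper j (t + 1) y ω - run.lower j (t + 1) y ω) ^ 2 := by
  have h := hg.order hL hℓ hj.le (Nat.succ_le_of_lt ht) y
  have h1 := hg.upper_le hL hℓ hj.le (Nat.succ_le_of_lt ht) y
  rw [widthFn, clip_of_mem (by linarith) (by linarith)]

lemma gapAt_mem (hg : run.GoodEvent ℓ ω) (hL : logFactor S A M.H K δ = ℓ) (hℓ : 0 ≤ ℓ) {j : ℕ}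
    (hj : j ≤ K) {t : ℕ} (ht : t ≤ M.H) :
    0 ≤ run.gapAt ω j t ∧ run.gapAt ω j t ≤ (M.H : ℝ) - t := by
  have h := hg.order hL hℓ hj ht (run.state j t ω)
  have h2 := M.value_le_optValue (run.policy j ω) t (run.state j t ω)
  have h3 := M.value_nonneg (run.policy j ω) t (run.state j t ω)
  unfold gapAt
  constructor <;> linarith

lemma widthAt_mem (hg : run.GoodEvent ℓ ω) (hL : logFactor S A M.H K δ = ℓ) (hℓ : 0 ≤ ℓ) {j : ℕ}
    (hj : j ≤ K) {t : ℕ} (ht : t ≤ M.H) :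
    0 ≤ run.widthAt ω j t ∧ run.widthAt ω j t ≤ (M.H : ℝ) - t := by
  have h := hg.order hL hℓ hj ht (run.state j t ω)
  unfold widthAt
  constructor <;> linarith

lemma widthDrop_le (hg : run.GoodEvent ℓ ω) (hL : logFactor S A M.H K δ = ℓ) (hℓ : 0 ≤ ℓ) {j : ℕ}
    (hj : j < K) {t : ℕ} (ht : t ≤ M.H) : run.widthDrop ω j t ≤ M.H := by
  have h := hg.order hL hℓ (Nat.succ_le_of_lt hj) ht (run.state j t ω)
  have h1 := (hg.widthAt_mem hL hℓ hj.le ht).2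
  have h2 : (0 : ℝ) ≤ t := Nat.cast_nonneg t
  unfold widthDrop
  linarith

lemma epSum_upperDrop_le (hg : run.GoodEvent ℓ ω) (hL : logFactor S A M.H K δ = ℓ) (hℓ : 0 ≤ ℓ)
    {k : ℕ} (hk : k ≤ K) :
    epSum M.H k (run.upperDrop ω) ≤ Fintype.card S * (M.H : ℝ) ^ 2 :=
  epSum_decrease_le (E := fun j t s => run.upper j t s ω) (st := fun j t => run.state j t ω)
    (fun j t _ _ hs => (upper_of_ne j t hs).1)
    (fun _ ht s => hg.upper_le hL hℓ (Nat.zero_le K) ht.le s)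
    (fun t ht s => by
      have h := hg.order hL hℓ hk ht.le s
      linarith [M.optValue_nonneg t s])

lemma epSum_widthDrop_le (hg : run.GoodEvent ℓ ω) (hL : logFactor S A M.H K δ = ℓ) (hℓ : 0 ≤ ℓ)
    {k : ℕ} (hk : k ≤ K) :
    epSum M.H k (run.widthDrop ω) ≤ Fintype.card S * (M.H : ℝ) ^ 2 :=
  epSum_decrease_le (E := fun j t s => run.upper j t s ω - run.lower j t s ω)
    (st := fun j t => run.state j t ω)
    (fun j t _ _ hs => by rw [(upper_of_ne j t hs).1, (upper_of_ne j t hs).2])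
    (fun t ht s => by
      have h := hg.order hL hℓ (Nat.zero_le K) ht.le s
      linarith [hg.upper_le hL hℓ (Nat.zero_le K) ht.le s])
    (fun t ht s => by
      have h := hg.order hL hℓ hk ht.le s
      linarith)

end GoodEvent

end EulerGPRun

/-- Young's inequality in the form `(g + b)² ≤ (1 + H) g² + (1 + 1 / H) b²` keeps the factor of the
recursive term close to one. The `7` in `1 + 7 / H` comes from `(1 + 1 / H)³ ≤ 1 + 7 / H`. -/
lemma sq_le_of_recursion {H u d β m q w : ℝ} (hH : 1 ≤ H) (hw : 0 ≤ w)
    (h : w ≤ H * u + d + β + (1 + 1 / H) * m) (hq : m ^ 2 ≤ q)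
    (hu : u ^ 2 = u) (hd : 0 ≤ d) (hdH : d ≤ H) :
    w ^ 2 ≤ 6 * H * (H ^ 2 * u + H * d + β ^ 2) + (1 + 7 / H) * q := by
  obtain ⟨z, hz⟩ : ∃ z, z = 1 / H := ⟨_, rfl⟩
  have hHz : H * z = 1 := by rw [hz]; field_simp
  have hz0 : 0 ≤ z := by rw [hz]; positivity
  have hz1 : z ≤ 1 := by rw [hz]; exact (div_le_one (by linarith)).2 hH
  have e7 : 7 / H = 7 * z := by rw [hz]; ring
  rw [← hz] at h
  rw [e7]
  set g := H * u + d + β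
  set b := (1 + z) * m
  have h1 : w ^ 2 ≤ (g + b) ^ 2 := pow_le_pow_left₀ hw h 2
  have h2 : 2 * (g * b) ≤ H * g ^ 2 + z * b ^ 2 := by
    have h3 : 0 ≤ z * (H * g - b) ^ 2 := by positivity
    have e : z * (H * g - b) ^ 2 = (H * z) * (H * g ^ 2) - 2 * ((H * z) * (g * b)) + z * b ^ 2 := by
      ring
    rw [e, hHz] at h3
    linarith
  have h4 : (1 + z) * b ^ 2 ≤ (1 + 7 * z) * q := by
    have e : (1 + z) * b ^ 2 = (1 + z) ^ 3 * m ^ 2 := by simp only [b]; ring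
    rw [e]
    have h5 : (1 + z) ^ 3 ≤ 1 + 7 * z := by nlinarith [mul_nonneg hz0 hz0]
    exact mul_le_mul h5 hq (sq_nonneg _) (by linarith)
  have h6 : g ^ 2 ≤ 3 * (H ^ 2 * u + H * d + β ^ 2) := by
    have h7 : g ^ 2 ≤ 3 * ((H * u) ^ 2 + d ^ 2 + β ^ 2) := by
      simp only [g]
      nlinarith [sq_nonneg (H * u - d), sq_nonneg (H * u - β), sq_nonneg (d - β)]
    rw [mul_pow, hu] at h7
    nlinarith
  have h8 : (1 + H) * g ^ 2 ≤ 6 * H * (H ^ 2 * u + H * d + β ^ 2) := by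
    have h9 : (1 + H) * g ^ 2 ≤ (2 * H) * g ^ 2 :=
      mul_le_mul_of_nonneg_right (by linarith) (sq_nonneg _)
    have h10 := mul_le_mul_of_nonneg_left h6 (by linarith : 0 ≤ 2 * H)
    linarith
  linarith

lemma sq_meanOf_le {S : Type*} [Fintype S] {p : S → ℝ} (hp : ∀ x, 0 ≤ p x) (hp1 : ∑ x, p x = 1)
    (V : S → ℝ) : meanOf p V ^ 2 ≤ meanOf p (fun x => V x ^ 2) := by
  have := varOf_nonneg hp V
  rw [varOf_eq hp1] at this
  linarith

namespace EulerGPRun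

variable {S A Ω : Type*} [Fintype S] [DecidableEq S] [Fintype A] [DecidableEq A]
  [mΩ : MeasurableSpace Ω] {M : FiniteMDP S A} {K : ℕ} {δ : ℝ} {P : Measure Ω}
  {run : EulerGPRun M K δ P} {ω : Ω} {ℓ : ℝ}

/-- The variance of the reward at the current pair. -/
def varRAt (run : EulerGPRun M K δ P) (ω : Ω) (j t : ℕ) : ℝ :=
  M.varR (run.state j t ω) (run.action j t ω)

/-- The variance of the next optimal value at the current pair. -/
def varOptAt (run : EulerGPRun M K δ P) (ω : Ω) (j t : ℕ) : ℝ :=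
  varOf (M.p (run.state j t ω) (run.action j t ω)) (M.optValue (t + 1))

lemma epSum_unseenAt_le (run : EulerGPRun M K δ P) (ω : Ω) (k : ℕ) :
    epSum M.H k (run.unseenAt ω) ≤ 2 * ((Fintype.card S : ℝ) ^ 2 * Fintype.card A * M.H) := by
  have hS : (1 : ℝ) ≤ Fintype.card S := by exact_mod_cast run.card_pos_of_run ω
  refine ((run.hist ω).epSum_unseen_le M.H (Fintype.card S * M.H) k).trans ?_
  push_cast
  have h1 : (Fintype.card S : ℝ) * (Fintype.card A * M.H) ≤
      Fintype.card S * (Fintype.card S * (Fintype.card A * M.H)) :=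
    mul_le_mul_of_nonneg_left (le_mul_of_one_le_left (by positivity) hS) (by positivity)
  linarith

lemma epSum_invCountAt_le (run : EulerGPRun M K δ P) (ω : Ω) (hℓ : 0 ≤ ℓ)
    (hK : (K * M.H : ℕ) ≤ Real.exp ℓ) {k : ℕ} (hk : k ≤ K) :
    epSum M.H k (run.invCountAt ω) ≤ 2 * (Fintype.card S * Fintype.card A * ℓ) :=
  (run.hist ω).epSum_invCount_le (Nat.le_mul_of_pos_left _ (run.card_pos_of_run ω)) M.H_pos hℓ
    (le_trans (by exact_mod_cast Nat.mul_le_mul_right _ hk) hK)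

namespace GoodEvent

variable [Nonempty A]

/-- The old width is its decrease plus the new width, and the latter is bounded by the difference of
two backups with old estimates. At rarely visited pairs the trivial bound `H` is used. -/
lemma widthAt_le (hg : run.GoodEvent ℓ ω) (hL : logFactor S A M.H K δ = ℓ) (hℓ : 2 ≤ ℓ)
    {j : ℕ} (hj : j < K) {t : ℕ} (ht : t < M.H) :
    run.widthAt ω j t ≤ M.H * run.unseenAt ω j t + run.widthDrop ω j t
      + (15 * (M.H * √(ℓ * run.invCountAt ω j t))
        + 58 * (Fintype.card S * (M.H : ℝ) ^ 2 * (ℓ * run.invCountAt ω j t)))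
      + (1 + 1 / M.H) * meanOf (M.p (run.state j t ω) (run.action j t ω))
        (fun y => run.upper j (t + 1) y ω - run.lower j (t + 1) y ω) := by
  have hℓ0 : 0 ≤ ℓ := by linarith
  have hord := fun y => hg.order hL hℓ0 hj.le (Nat.succ_le_of_lt ht) y
  have hup := fun y => hg.upper_le hL hℓ0 hj.le (Nat.succ_le_of_lt ht) y
  have hd := widthDrop_nonneg (run := run) (ω := ω) j t
  have hm : 0 ≤ meanOf (M.p (run.state j t ω) (run.action j t ω))
      (fun y => run.upper j (t + 1) y ω - run.lower j (t + 1) y ω) :=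
    meanOf_nonneg (M.p_nonneg _ _) fun y => by linarith [hord y]
  rcases run.unseenAt_eq_one_or ω j t with ⟨hu, hy⟩ | ⟨hu, hn, hy, -⟩
  · have h1 := (hg.widthAt_mem hL hℓ0 hj.le ht.le).2
    have h2 : (0 : ℝ) ≤ t := Nat.cast_nonneg t
    rw [hu, hy]
    have h3 : 0 ≤ (1 + 1 / (M.H : ℝ)) * meanOf (M.p (run.state j t ω) (run.action j t ω))
      (fun y => run.upper j (t + 1) y ω - run.lower j (t + 1) y ω) := by positivity
    simp only [mul_zero, Real.sqrt_zero]
    linarith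
  · have h1 := hg.qUpper_sub_qLower_le hℓ hj.le hn (t := t)
      (U := fun y => run.upper j (t + 1) y ω) (L := fun y => run.lower j (t + 1) y ω)
      (fun y => (hord y).1) (fun y => (hord y).2.1) (fun y => (hord y).2.2.1) hup
    have h2 := EulerGP.upper_succ_le M.H (logFactor S A M.H K δ) (run.hist ω) (k := j) ht
    have h3 := EulerGP.le_lower_succ M.H (logFactor S A M.H K δ) (run.hist ω) (k := j) ht
    subst hL
    change run.upper (j + 1) t (run.state j t ω) ω ≤ _ at h2
    change _ ≤ run.lower (j + 1) t (run.state j t ω) ω at h3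
    have e : run.widthAt ω j t = run.widthDrop ω j t + (run.upper (j + 1) t (run.state j t ω) ω
      - run.lower (j + 1) t (run.state j t ω) ω) := by unfold widthDrop; ring
    rw [e, hu, hy, mul_one_div, mul_zero, zero_add]
    have h4 := (sub_le_sub h2 h3).trans h1
    linarith

lemma sq_widthAt_le (hg : run.GoodEvent ℓ ω) (hL : logFactor S A M.H K δ = ℓ) (hℓ : 2 ≤ ℓ)
    {j : ℕ} (hj : j < K) {t : ℕ} (ht : t < M.H) :
    run.widthAt ω j t ^ 2 ≤ 6 * M.H * ((M.H : ℝ) ^ 2 * run.unseenAt ω j t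
      + M.H * run.widthDrop ω j t
      + 7200 * (Fintype.card S * (M.H : ℝ) ^ 3 * ℓ ^ 2) * run.invCountAt ω j t)
      + (1 + 7 / M.H) * run.nextMean ω (run.widthFn ω) j t := by
  have hℓ0 : 0 ≤ ℓ := by linarith
  have hH : (1 : ℝ) ≤ M.H := by exact_mod_cast M.H_pos
  have hS : (1 : ℝ) ≤ Fintype.card S := by exact_mod_cast run.card_pos_of_run ω
  have hy0 := run.invCountAt_nonneg (ω := ω) j t
  have h1 := sq_le_of_recursion hH (hg.widthAt_mem hL hℓ0 hj.le ht.le).1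
    (hg.widthAt_le hL hℓ hj ht)
    (sq_meanOf_le (M.p_nonneg _ _) (M.p_sum _ _) _)
    (by rcases run.unseenAt_eq_one_or ω j t with h | h <;> rw [h.1] <;> norm_num)
    (widthDrop_nonneg j t) (hg.widthDrop_le hL hℓ0 hj ht.le)
  have e : run.nextMean ω (run.widthFn ω) j t = meanOf (M.p (run.state j t ω) (run.action j t ω))
      (fun y => (run.upper j (t + 1) y ω - run.lower j (t + 1) y ω) ^ 2) := by
    rw [nextMean]; congr 1; ext y; exact hg.widthFn_eq hL hℓ0 hj ht y
  rw [← e] at h1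
  refine h1.trans (add_le_add (mul_le_mul_of_nonneg_left (add_le_add le_rfl ?_)
    (by positivity)) le_rfl)
  have hSy : Fintype.card S * (M.H : ℝ) * run.invCountAt ω j t ≤ 1 := by
    rcases run.unseenAt_eq_one_or ω j t with h | h
    · rw [h.2]; simp
    · exact h.2.2.2
  set y := run.invCountAt ω j t
  set c := (Fintype.card S : ℝ)
  set H := (M.H : ℝ)
  have hly : 0 ≤ ℓ * y := mul_nonneg hℓ0 hy0
  have h2 : (15 * (H * √(ℓ * y)) + 58 * (c * H ^ 2 * (ℓ * y))) ^ 2 ≤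
      450 * (H ^ 2 * (ℓ * y)) + 6728 * (c * H ^ 2 * (ℓ * y)) ^ 2 := by
    have h3 := add_sq_le (a := 15 * (H * √(ℓ * y))) (b := 58 * (c * H ^ 2 * (ℓ * y)))
    have h4 : (15 * (H * √(ℓ * y))) ^ 2 = 225 * (H ^ 2 * (ℓ * y)) := by
      rw [mul_pow, mul_pow, Real.sq_sqrt hly]; ring
    rw [h4] at h3
    linarith
  -- One factor `y` is removed by `S H y ≤ 1`.
  have h5 : (c * H ^ 2 * (ℓ * y)) ^ 2 ≤ c * H ^ 3 * ℓ ^ 2 * y := by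
    have h6 := mul_le_mul_of_nonneg_left hSy (by positivity : 0 ≤ c * H ^ 3 * ℓ ^ 2 * y)
    linarith
  have h7 : H ^ 2 * (ℓ * y) ≤ c * H ^ 3 * ℓ ^ 2 * y := by
    have h8 : 1 ≤ c * (H * ℓ) :=
      one_le_mul_of_one_le_of_one_le hS (one_le_mul_of_one_le_of_one_le hH (by linarith))
    have h9 := mul_le_mul_of_nonneg_left h8 (by positivity : 0 ≤ H ^ 2 * (ℓ * y))
    linarith
  have h10 : 0 ≤ c * H ^ 3 * ℓ ^ 2 * y := by positivity
  linarith

/-- The expected squared widths along the path are of lower order. -/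
lemma epSum_width_le (hg : run.GoodEvent ℓ ω) (hL : logFactor S A M.H K δ = ℓ) (hℓ : 2 ≤ ℓ)
    (hK : (K * M.H : ℕ) ≤ Real.exp ℓ) {k : ℕ} (hk : k ≤ K) :
    epSum M.H k (run.nextMean ω (run.widthFn ω)) ≤
      1300000000 * ((Fintype.card S : ℝ) ^ 2 * Fintype.card A * (M.H : ℝ) ^ 5 * ℓ ^ 3) := by
  have hℓ0 : 0 ≤ ℓ := by linarith
  have hℓ1 : 1 ≤ ℓ := by linarith
  have hH : (1 : ℝ) ≤ M.H := by exact_mod_cast M.H_pos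
  have hS : (1 : ℝ) ≤ Fintype.card S := by exact_mod_cast run.card_pos_of_run ω
  have hA : (1 : ℝ) ≤ Fintype.card A := by exact_mod_cast Fintype.card_pos
  have hnv : ∀ j < k, ∀ t < M.H, run.widthAt ω j (t + 1) ^ 2 = run.nextVal ω (run.widthFn ω) j t :=
    fun j hj t ht => (hg.widthFn_eq hL hℓ0 (hj.trans_le hk) ht _).symm
  have h1 := hg.width.sum_le (a := fun j t => run.widthAt ω j t ^ 2) (by linarith) (sq_nonneg _) hk
    (fun j _ t _ => sq_nonneg _)
    (fun j hj => by
      have := hg.widthAt_mem hL hℓ0 (hj.trans_le hk).le le_rfl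
      rw [sub_self] at this
      rw [le_antisymm this.2 this.1]; norm_num)
    hnv
    (fun j hj t ht => by
      have h1 := run.unseenAt_nonneg (ω := ω) j t
      have h2 := widthDrop_nonneg (run := run) (ω := ω) j t
      have h3 := run.invCountAt_nonneg (ω := ω) j t
      positivity)
    (fun j hj t ht => hg.sq_widthAt_le hL hℓ (hj.trans_le hk) ht)
  rw [epSum_const_mul, epSum_add, epSum_add, epSum_const_mul, epSum_const_mul,
    epSum_const_mul] at h1
  have h2 := run.epSum_unseenAt_le ω k
  have h3 := hg.epSum_widthDrop_le hL hℓ0 hk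
  have h4 := run.epSum_invCountAt_le ω hℓ0 hK hk
  set c := (Fintype.card S : ℝ)
  set α := (Fintype.card A : ℝ)
  set H := (M.H : ℝ)
  set X := c ^ 2 * α * H ^ 4 * ℓ ^ 3 with hX
  have h5 : 6 * H * (H ^ 2 * epSum M.H k (run.unseenAt ω) + H * epSum M.H k (run.widthDrop ω)
      + 7200 * (c * H ^ 3 * ℓ ^ 2) * epSum M.H k (run.invCountAt ω)) ≤ 86418 * X := by
    have h6 : H ^ 2 * epSum M.H k (run.unseenAt ω) + H * epSum M.H k (run.widthDrop ω)
      + 7200 * (c * H ^ 3 * ℓ ^ 2) * epSum M.H k (run.invCountAt ω) ≤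
      H ^ 2 * (2 * (c ^ 2 * α * H)) + H * (c * H ^ 2)
        + 7200 * (c * H ^ 3 * ℓ ^ 2) * (2 * (c * α * ℓ)) := by gcongr
    have h7 := mul_le_mul_of_nonneg_left h6 (by positivity : 0 ≤ 6 * H)
    have h8 : c ^ 2 * α * H ^ 4 ≤ X :=
      le_mul_of_one_le_right (by positivity) (one_le_pow₀ hℓ1)
    have h9 : c * H ^ 4 ≤ c ^ 2 * α * H ^ 4 := by
      have h10 : 1 ≤ c * α := one_le_mul_of_one_le_of_one_le hS hA
      have h11 := mul_le_mul_of_nonneg_left h10 (by positivity : 0 ≤ c * H ^ 4)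
      linarith
    have e : 6 * H * (H ^ 2 * (2 * (c ^ 2 * α * H)) + H * (c * H ^ 2)
        + 7200 * (c * H ^ 3 * ℓ ^ 2) * (2 * (c * α * ℓ))) =
        12 * (c ^ 2 * α * H ^ 4) + 6 * (c * H ^ 4) + 86400 * X := by rw [hX]; ring
    linarith
  have h12 : H ^ 3 * ℓ ≤ X := by
    calc H ^ 3 * ℓ = 1 * 1 * H ^ 3 * ℓ := by ring
      _ ≤ c ^ 2 * α * H ^ 4 * ℓ ^ 3 := by
        gcongr
        · exact one_le_pow₀ hS
        · norm_num
        · exact le_self_pow₀ hℓ1 (by norm_num)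
  have h13 : ∀ τ ≤ M.H, ∑ j ∈ Finset.range k, run.widthAt ω j τ ^ 2 ≤ 600000000 * X := by
    intro τ hτ
    have h14 := h1 τ hτ
    have e : 13 * 2187 ^ 2 * (H * (H ^ 2 * (3 * ℓ))) = 186535791 * (H ^ 3 * ℓ) := by ring
    rw [e] at h14
    have : 0 ≤ X := by positivity
    linarith
  have h15 := epSum_nextVal_le (run := run) (a := fun j t => run.widthAt ω j t ^ 2) hnv h13
  have h16 := hg.width.mean k hk
  have h17 : H ^ 2 * ℓ ≤ H * X := by
    have : H ^ 2 * ℓ ≤ H ^ 3 * ℓ := by gcongr; norm_num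
    exact (this.trans h12).trans (le_mul_of_one_le_left (by positivity) hH)
  have e2 : c ^ 2 * α * H ^ 5 * ℓ ^ 3 = H * X := by rw [hX]; ring
  rw [e2]
  have : 0 ≤ H * X := by positivity
  change _ ≤ _ + 10 * (H ^ 2 * (3 * ℓ)) at h16
  linarith

end GoodEvent

end EulerGPRun

/-- The left side is the variance of `V²`. Squaring is `2 b`-Lipschitz on `[0, b]`, and recentring
at `(pᵀ V)²` can only increase the mean square. -/
lemma meanOf_sq_sub_sq_le {S : Type*} [Fintype S] {p V : S → ℝ} (hp : ∀ x, 0 ≤ p x) (hp1 : ∑ x, p x = 1) {b : ℝ}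
    (h0 : ∀ x, 0 ≤ V x) (hb : ∀ x, V x ≤ b) (hb0 : 0 ≤ b) :
    meanOf p (fun x => (meanOf p (fun x => V x ^ 2) - V x ^ 2) ^ 2) ≤ 4 * b ^ 2 * varOf p V := by
  have h1 : meanOf p (fun x => (meanOf p (fun x => V x ^ 2) - V x ^ 2) ^ 2) =
      varOf p (fun x => V x ^ 2) := by
    unfold varOf; exact Finset.sum_congr rfl fun x _ => by ring
  rw [h1]
  refine (varOf_le_meanOf_sq hp1 _ (meanOf p V ^ 2)).trans ?_
  have e : 4 * b ^ 2 * varOf p V = meanOf p (fun x => 4 * b ^ 2 * (V x - meanOf p V) ^ 2) :=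
    (meanOf_const_mul _ _ _).symm
  rw [e]
  refine meanOf_mono hp fun x => ?_
  have h2 := meanOf_nonneg hp h0
  have h3 := meanOf_le hp hp1.le hb0 hb
  have h4 : (V x + meanOf p V) ^ 2 ≤ (2 * b) ^ 2 :=
    pow_le_pow_left₀ (add_nonneg (h0 x) h2) (by linarith [hb x]) 2
  calc (V x ^ 2 - meanOf p V ^ 2) ^ 2 = (V x + meanOf p V) ^ 2 * (V x - meanOf p V) ^ 2 := by ring
    _ ≤ (2 * b) ^ 2 * (V x - meanOf p V) ^ 2 := mul_le_mul_of_nonneg_right h4 (sq_nonneg _)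
    _ = _ := by ring

namespace EulerGPRun

variable {S A Ω : Type*} [Fintype S] [DecidableEq S] [Fintype A] [DecidableEq A]
  [mΩ : MeasurableSpace Ω] {M : FiniteMDP S A} {K : ℕ} {δ : ℝ} {P : Measure Ω}
  {run : EulerGPRun M K δ P} {ω : Ω} {ℓ : ℝ}

lemma value_state_eq (run : EulerGPRun M K δ P) (ω : Ω) (j : ℕ) {t : ℕ} (ht : t < M.H) :
    M.value (run.policy j ω) t (run.state j t ω) = M.r (run.state j t ω) (run.action j t ω)
      + run.nextMean ω (run.valFn ω) j t := M.value_of_lt _ ht _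

lemma varOptAt_nonneg (j t : ℕ) : 0 ≤ run.varOptAt ω j t := varOf_nonneg (M.p_nonneg _ _) _

lemma varRAt_nonneg (j t : ℕ) : 0 ≤ run.varRAt ω j t := M.varR_nonneg _ _

namespace GoodEvent

variable [Nonempty A]

lemma nextMean_gapFn_eq (hg : run.GoodEvent ℓ ω) (hL : logFactor S A M.H K δ = ℓ) (hℓ : 0 ≤ ℓ)
    {j : ℕ} (hj : j < K) {t : ℕ} (ht : t < M.H) : run.nextMean ω (run.gapFn ω) j t =
      meanOf (M.p (run.state j t ω) (run.action j t ω)) (fun y => run.upper j (t + 1) y ω)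
        - run.nextMean ω (run.valFn ω) j t := by
  rw [nextMean, nextMean, ← meanOf_sub]; congr 1; ext y; exact hg.gapFn_eq hL hℓ hj ht y

lemma nextMean_widthFn_eq (hg : run.GoodEvent ℓ ω) (hL : logFactor S A M.H K δ = ℓ) (hℓ : 0 ≤ ℓ)
    {j : ℕ} (hj : j < K) {t : ℕ} (ht : t < M.H) : run.nextMean ω (run.widthFn ω) j t =
      meanOf (M.p (run.state j t ω) (run.action j t ω))
        (fun y => (run.upper j (t + 1) y ω - run.lower j (t + 1) y ω) ^ 2) := by
  rw [nextMean]; congr 1; ext y; exact hg.widthFn_eq hL hℓ hj ht y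

/-- Since `V^π ≤ V*`, the sum `pᵀ V* + (1 + 1 / H) pᵀ (U - V*)` does not decrease when `V*` is
replaced by `V^π`, so the recursion closes in `U - V^π`. The factor is relaxed to `1 + 7 / H` to
share the path weights with the squared widths. -/
lemma gapAt_le (hg : run.GoodEvent ℓ ω) (hL : logFactor S A M.H K δ = ℓ) (hℓ : 2 ≤ ℓ)
    {j : ℕ} (hj : j < K) {t : ℕ} (ht : t < M.H) :
    run.gapAt ω j t ≤ (run.upperDrop ω j t + M.H * run.unseenAt ω j t
      + 6 * (√(ℓ * run.invCountAt ω j t) * √(run.varRAt ω j t)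
        + √(ℓ * run.invCountAt ω j t) * √(run.varOptAt ω j t)
        + √(ℓ * run.invCountAt ω j t) * √(run.nextMean ω (run.widthFn ω) j t))
      + 90 * (Fintype.card S * (M.H : ℝ) ^ 2 * ℓ) * run.invCountAt ω j t)
      + (1 + 7 / M.H) * run.nextMean ω (run.gapFn ω) j t := by
  have hℓ0 : 0 ≤ ℓ := by linarith
  have hord := fun y => hg.order hL hℓ0 hj.le (Nat.succ_le_of_lt ht) y
  have hup := fun y => hg.upper_le hL hℓ0 hj.le (Nat.succ_le_of_lt ht) y
  have hd := upperDrop_nonneg (run := run) (ω := ω) j t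
  have hm : 0 ≤ run.nextMean ω (run.gapFn ω) j t :=
    meanOf_nonneg (M.p_nonneg _ _) fun y => clip_nonneg _ _
  have hme := hg.nextMean_gapFn_eq hL hℓ0 hj ht
  rcases run.unseenAt_eq_one_or ω j t with ⟨hu, hy⟩ | ⟨hu, hn, hy, -⟩
  · have h1 := (hg.gapAt_mem hL hℓ0 hj.le ht.le).2
    have h2 : (0 : ℝ) ≤ t := Nat.cast_nonneg t
    rw [hu, hy]
    have h3 : 0 ≤ (1 + 7 / (M.H : ℝ)) * run.nextMean ω (run.gapFn ω) j t := by positivity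
    simp only [mul_zero, Real.sqrt_zero, zero_mul]
    linarith
  · have h1 := hg.qUpper_le hℓ hj.le hn ht
      (U := fun y => run.upper j (t + 1) y ω) (L := fun y => run.lower j (t + 1) y ω)
      (fun y => (hord y).1) (fun y => (hord y).2.1) (fun y => (hord y).2.2.1) hup
    have h2 := EulerGP.upper_succ_le M.H (logFactor S A M.H K δ) (run.hist ω) (k := j) ht
    have hwe := hg.nextMean_widthFn_eq hL hℓ0 hj ht
    have hV : run.nextMean ω (run.valFn ω) j t ≤
        meanOf (M.p (run.state j t ω) (run.action j t ω)) (M.optValue (t + 1)) :=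
      meanOf_mono (M.p_nonneg _ _) fun y => M.value_le_optValue _ _ _
    have hmean : meanOf (M.p (run.state j t ω) (run.action j t ω)) (M.optValue (t + 1))
        + (1 + 1 / M.H) * meanOf (M.p (run.state j t ω) (run.action j t ω))
          (fun y => run.upper j (t + 1) y ω - M.optValue (t + 1) y) ≤
        run.nextMean ω (run.valFn ω) j t
          + (1 + 7 / M.H) * run.nextMean ω (run.gapFn ω) j t := by
      rw [meanOf_sub]
      have h3 : (1 + 1 / (M.H : ℝ)) * run.nextMean ω (run.gapFn ω) j t ≤
          (1 + 7 / M.H) * run.nextMean ω (run.gapFn ω) j t := by gcongr; norm_num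
      rw [hme] at h3 ⊢
      have h4 : 0 ≤ 1 / (M.H : ℝ) * (meanOf (M.p (run.state j t ω) (run.action j t ω))
        (M.optValue (t + 1)) - run.nextMean ω (run.valFn ω) j t) :=
        mul_nonneg (by positivity) (by linarith)
      linarith
    subst hL
    change run.upper (j + 1) t (run.state j t ω) ω ≤ _ at h2
    have e : run.gapAt ω j t = run.upperDrop ω j t + (run.upper (j + 1) t (run.state j t ω) ω
      - M.value (run.policy j ω) t (run.state j t ω)) := by unfold gapAt upperDrop; ring
    rw [e, run.value_state_eq ω j ht, hu, hy, mul_one_div, mul_zero, add_zero, hwe, varRAt,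
      varOptAt]
    have h5 := h2.trans h1
    rw [mul_add, mul_add] at h5
    have e2 : 90 * ((Fintype.card S : ℝ) * (M.H : ℝ) ^ 2 * logFactor S A M.H K δ)
        * (1 / ((run.hist ω).count M.H j (run.state j t ω) (run.action j t ω))) =
        90 * (Fintype.card S * (M.H : ℝ) ^ 2 * (logFactor S A M.H K δ
        / ((run.hist ω).count M.H j (run.state j t ω) (run.action j t ω)))) := by ring
    rw [e2]
    change run.upper (j + 1) t (run.state j t ω) ω ≤ M.r (run.state j t ω) (run.action j t ω)
      + _ + _ + _ + _ at h5
    change _ + (run.upper (j + 1) t (run.state j t ω) ω - _) ≤ _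
    linarith

/-- The sum of the gaps in terms of the sums of the variances. -/
lemma sum_gapAt_le (hg : run.GoodEvent ℓ ω) (hL : logFactor S A M.H K δ = ℓ) (hℓ : 2 ≤ ℓ)
    (hK : (K * M.H : ℕ) ≤ Real.exp ℓ) {k : ℕ} (hk : k ≤ K) :
    ∀ τ ≤ M.H, ∑ j ∈ Finset.range k, run.gapAt ω j τ ≤
      4374 * (183 * ((Fintype.card S : ℝ) ^ 2 * Fintype.card A * (M.H : ℝ) ^ 2 * ℓ ^ 2)
        + 6 * (√(2 * (Fintype.card S * Fintype.card A * ℓ ^ 2)) *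
          (√(epSum M.H k (run.varRAt ω)) + √(epSum M.H k (run.varOptAt ω))
          + √(1300000000 * ((Fintype.card S : ℝ) ^ 2 * Fintype.card A * (M.H : ℝ) ^ 5 * ℓ ^ 3)))))
        + 186535791 * ((M.H : ℝ) ^ 2 * ℓ) := by
  have hℓ0 : 0 ≤ ℓ := by linarith
  have hℓ1 : 1 ≤ ℓ := by linarith
  have hH : (1 : ℝ) ≤ M.H := by exact_mod_cast M.H_pos
  have hS : (1 : ℝ) ≤ Fintype.card S := by exact_mod_cast run.card_pos_of_run ω
  have hA : (1 : ℝ) ≤ Fintype.card A := by exact_mod_cast Fintype.card_pos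
  have hy : ∀ j < k, ∀ t < M.H, 0 ≤ ℓ * run.invCountAt ω j t := fun j _ t _ =>
    mul_nonneg hℓ0 (run.invCountAt_nonneg (ω := ω) j t)
  have hw : ∀ j < k, ∀ t < M.H, 0 ≤ run.nextMean ω (run.widthFn ω) j t := fun j _ t _ =>
    run.nextMean_nonneg ω fun y => sq_nonneg _
  have h1 := hg.gap.sum_le (a := run.gapAt ω) (by linarith) (by linarith) hk
    (fun j hj t ht => (hg.gapAt_mem hL hℓ0 (hj.trans_le hk).le ht).1)
    (fun j hj => by
      have := hg.gapAt_mem hL hℓ0 (hj.trans_le hk).le le_rfl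
      rw [sub_self] at this
      exact le_antisymm this.2 this.1)
    (fun j hj t ht => (hg.gapFn_eq hL hℓ0 (hj.trans_le hk) ht _).symm)
    (fun j hj t ht => by
      have h1 := run.unseenAt_nonneg (ω := ω) j t
      have h2 := upperDrop_nonneg (run := run) (ω := ω) j t
      have h3 := run.invCountAt_nonneg (ω := ω) j t
      positivity)
    (fun j hj t ht => hg.gapAt_le hL hℓ (hj.trans_le hk) ht)
  intro τ hτ
  refine (h1 τ hτ).trans ?_
  have e : 13 * 2187 ^ 2 * ((M.H : ℝ) * (M.H * (3 * ℓ))) = 186535791 * ((M.H : ℝ) ^ 2 * ℓ) := by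
    ring
  rw [e]
  refine add_le_add (mul_le_mul_of_nonneg_left ?_ (by norm_num)) le_rfl
  rw [epSum_add, epSum_add, epSum_add, epSum_const_mul, epSum_const_mul, epSum_const_mul,
    epSum_add, epSum_add]
  have h2 := run.epSum_unseenAt_le ω k
  have h3 := hg.epSum_upperDrop_le hL hℓ0 hk
  have h4 := run.epSum_invCountAt_le ω hℓ0 hK hk
  -- Cauchy-Schwarz: the inverse counts give `√(2 S A ℓ²)`, and the variances are kept as sums along
  -- the path.
  have h5 := epSum_sqrt_mul_le hy (fun j _ t _ => varRAt_nonneg (run := run) (ω := ω) j t)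
  have h6 := epSum_sqrt_mul_le hy (fun j _ t _ => varOptAt_nonneg (run := run) (ω := ω) j t)
  have h7 := epSum_sqrt_mul_le hy hw
  have h8 := Real.sqrt_le_sqrt (hg.epSum_width_le hL hℓ hK hk)
  set c := (Fintype.card S : ℝ)
  set α := (Fintype.card A : ℝ)
  set H := (M.H : ℝ)
  have h9 : √(epSum M.H k fun j t => ℓ * run.invCountAt ω j t) ≤ √(2 * (c * α * ℓ ^ 2)) := by
    apply Real.sqrt_le_sqrt
    rw [epSum_const_mul]
    calc _ ≤ ℓ * (2 * (c * α * ℓ)) := mul_le_mul_of_nonneg_left h4 hℓ0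
      _ = _ := by ring
  have h10 := mul_le_mul_of_nonneg_right h9 (Real.sqrt_nonneg (epSum M.H k (run.varRAt ω)))
  have h11 := mul_le_mul_of_nonneg_right h9 (Real.sqrt_nonneg (epSum M.H k (run.varOptAt ω)))
  have h12 := mul_le_mul h9 h8 (Real.sqrt_nonneg _) (Real.sqrt_nonneg _)
  have h13 : c ^ 2 * α * H ^ 2 ≤ c ^ 2 * α * H ^ 2 * ℓ ^ 2 :=
    le_mul_of_one_le_right (by positivity) (one_le_pow₀ hℓ1)
  have h14 : c * H ^ 2 ≤ c ^ 2 * α * H ^ 2 := by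
    have h10 : 1 ≤ c * α := one_le_mul_of_one_le_of_one_le hS hA
    have h11 := mul_le_mul_of_nonneg_left h10 (by positivity : 0 ≤ c * H ^ 2)
    linarith
  have h15 := mul_le_mul_of_nonneg_left h2 (by positivity : 0 ≤ H)
  have h16 := mul_le_mul_of_nonneg_left h4 (by positivity : 0 ≤ 90 * (c * H ^ 2 * ℓ))
  have e1 : H * (2 * (c ^ 2 * α * H)) = 2 * (c ^ 2 * α * H ^ 2) := by ring
  have e2 : 90 * (c * H ^ 2 * ℓ) * (2 * (c * α * ℓ)) = 180 * (c ^ 2 * α * H ^ 2 * ℓ ^ 2) := by ring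
  rw [e1] at h15
  rw [e2] at h16
  rw [mul_add (√(2 * (c * α * ℓ ^ 2))), mul_add (√(2 * (c * α * ℓ ^ 2)))]
  linarith

end GoodEvent

/-! ### The variance of the values along the path -/

/-- The variance of the next value of the policy at the current pair. -/
def varValAt (run : EulerGPRun M K δ P) (ω : Ω) (j t : ℕ) : ℝ :=
  varOf (M.p (run.state j t ω) (run.action j t ω)) (run.valFn ω j t)

/-- The product of the expected reward and the value of the policy at the current state. -/
def rewardValAt (run : EulerGPRun M K δ P) (ω : Ω) (j t : ℕ) : ℝ :=
  M.r (run.state j t ω) (run.action j t ω) * M.value (run.policy j ω) t (run.state j t ω)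

lemma nextMean_valDevFn_le (run : EulerGPRun M K δ P) (ω : Ω) (j t : ℕ) :
    run.nextMean ω (run.valDevFn ω) j t ≤ 4 / (M.H : ℝ) ^ 2 * run.varValAt ω j t := by
  have hH : (0 : ℝ) < M.H := by exact_mod_cast M.H_pos
  have h := meanOf_sq_sub_sq_le (M.p_nonneg (run.state j t ω) (run.action j t ω)) (M.p_sum _ _)
    (run.valFn_nonneg ω j t) (run.valFn_le ω j t) hH.le
  have e : run.nextMean ω (run.valDevFn ω) j t = (1 / (M.H : ℝ) ^ 2) ^ 2 *
      meanOf (M.p (run.state j t ω) (run.action j t ω)) (fun x =>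
        (meanOf (M.p (run.state j t ω) (run.action j t ω)) (fun x => run.valFn ω j t x ^ 2)
          - run.valFn ω j t x ^ 2) ^ 2) := by
    rw [← meanOf_const_mul, nextMean]
    congr 1; ext y
    rw [valDevFn, mul_pow]; rfl
  rw [e]
  refine (mul_le_mul_of_nonneg_left h (by positivity)).trans_eq ?_
  rw [varValAt]; field_simp

/-- By the Bellman equation `pᵀ V = V_t - r`, so `-(pᵀ V)² ≤ -V_t² + 2 r V_t`. -/
lemma varValAt_le (run : EulerGPRun M K δ P) (ω : Ω) (j : ℕ) {t : ℕ} (ht : t < M.H) :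
    run.varValAt ω j t ≤ run.nextMean ω (run.valSqFn ω) j t
      - M.value (run.policy j ω) t (run.state j t ω) ^ 2 + 2 * run.rewardValAt ω j t := by
  rw [varValAt, varOf_eq (M.p_sum _ _)]
  have h := run.value_state_eq ω j ht
  rw [rewardValAt, h]
  change _ - run.nextMean ω (run.valFn ω) j t ^ 2 ≤ _
  change run.nextMean ω (run.valSqFn ω) j t - _ ≤ _
  nlinarith [sq_nonneg (M.r (run.state j t ω) (run.action j t ω))]

/-- The squared values telescope along an episode: the value at time `H` is zero, and the square at
time `0` enters with a favourable sign. -/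
lemma epSum_varValAt_le_add (run : EulerGPRun M K δ P) (ω : Ω) (k : ℕ) :
    epSum M.H k (run.varValAt ω) ≤ epSum M.H k (fun j t => run.nextMean ω (run.valSqFn ω) j t
      - run.nextVal ω (run.valSqFn ω) j t) + 2 * epSum M.H k (run.rewardValAt ω) := by
  rw [← epSum_const_mul, ← epSum_add]
  refine Finset.sum_le_sum fun j _ => ?_
  have h1 := Finset.sum_le_sum fun t (ht : t ∈ Finset.range M.H) =>
    run.varValAt_le ω j (Finset.mem_range.1 ht)
  have h2 := Finset.sum_range_sub
    (fun t => M.value (run.policy j ω) t (run.state j t ω) ^ 2) M.H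
  rw [M.value_of_ge _ le_rfl] at h2
  have h3 := sq_nonneg (M.value (run.policy j ω) 0 (run.state j 0 ω))
  have e : ∀ t, run.nextVal ω (run.valSqFn ω) j t =
      M.value (run.policy j ω) (t + 1) (run.state j (t + 1) ω) ^ 2 := fun t => rfl
  simp only [e]
  simp only [Finset.sum_add_distrib, Finset.sum_sub_distrib] at h1 h2 ⊢
  linarith

namespace GoodEvent

/-- The law of total variance along the path, up to a logarithmic deviation. -/
lemma epSum_varValAt_le (hg : run.GoodEvent ℓ ω) (hℓ : 0 ≤ ℓ) {k : ℕ} (hk : k ≤ K) :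
    epSum M.H k (run.varValAt ω) ≤
      4 * epSum M.H k (run.rewardValAt ω) + 100 * ((M.H : ℝ) ^ 2 * ℓ) := by
  have hH : (0 : ℝ) < M.H := by exact_mod_cast M.H_pos
  have h1 := run.epSum_varValAt_le_add ω k
  have h2 := hg.valueDiff k hk
  have h3 := hg.valueDev k hk
  have h4 : epSum M.H k (run.nextMean ω (run.valDevFn ω)) ≤
      4 / (M.H : ℝ) ^ 2 * epSum M.H k (run.varValAt ω) := by
    rw [← epSum_const_mul]
    exact epSum_mono fun j _ t _ => run.nextMean_valDevFn_le ω j t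
  have h5 : (M.H : ℝ) ^ 2 * (1 / 16 * epSum M.H k (run.nextVal ω (run.valDevFn ω))
      + 16 * (3 * ℓ)) ≤ (M.H : ℝ) ^ 2 * (1 / 16 * (2 * (4 / (M.H : ℝ) ^ 2
        * epSum M.H k (run.varValAt ω)) + 10 * (3 * ℓ)) + 16 * (3 * ℓ)) := by
    gcongr
    linarith
  -- As `2 · 4 / 16 = 1 / 2`, half of the variance sum is absorbed on the left.
  have e : (M.H : ℝ) ^ 2 * (1 / 16 * (2 * (4 / (M.H : ℝ) ^ 2
        * epSum M.H k (run.varValAt ω)) + 10 * (3 * ℓ)) + 16 * (3 * ℓ)) =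
      1 / 2 * epSum M.H k (run.varValAt ω) + 399 / 8 * ((M.H : ℝ) ^ 2 * ℓ) := by
    field_simp; ring
  rw [e] at h5
  have : 0 ≤ (M.H : ℝ) ^ 2 * ℓ := by positivity
  linarith

variable [Nonempty A]

/-- `V* - V^π` is at most `H` and at most the gap `U - V^π`, so its square is at most `H` times the
gap. -/
lemma varOptAt_le (hg : run.GoodEvent ℓ ω) (hL : logFactor S A M.H K δ = ℓ) (hℓ : 0 ≤ ℓ)
    {j : ℕ} (hj : j < K) {t : ℕ} (ht : t < M.H) :
    run.varOptAt ω j t ≤ 2 * run.varValAt ω j t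
      + 2 * M.H * run.nextMean ω (run.gapFn ω) j t := by
  refine (varOf_le_two_mul (M.p_nonneg _ _) (M.p_sum _ _) _ (run.valFn ω j t)).trans ?_
  have h1 : meanOf (M.p (run.state j t ω) (run.action j t ω))
      (fun x => (M.optValue (t + 1) x - run.valFn ω j t x) ^ 2) ≤
      M.H * run.nextMean ω (run.gapFn ω) j t := by
    rw [nextMean, ← meanOf_const_mul]
    refine meanOf_mono (M.p_nonneg _ _) fun y => ?_
    rw [hg.gapFn_eq hL hℓ hj ht y]
    have h2 := hg.order hL hℓ hj.le (Nat.succ_le_of_lt ht) y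
    have h3 := M.value_le_optValue (run.policy j ω) (t + 1) y
    have h4 := M.value_nonneg (run.policy j ω) (t + 1) y
    have h5 := M.optValue_le (t + 1) y
    rw [sq, valFn]
    exact mul_le_mul (by linarith) (by linarith) (by linarith) (by positivity)
  rw [varValAt]
  linarith

/-- The sum of the variances of the optimal value along the path. -/
lemma epSum_varOptAt_le (hg : run.GoodEvent ℓ ω) (hL : logFactor S A M.H K δ = ℓ) (hℓ : 0 ≤ ℓ)
    {k : ℕ} (hk : k ≤ K) {b : ℝ} (hb : ∀ τ ≤ M.H, ∑ j ∈ Finset.range k, run.gapAt ω j τ ≤ b) :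
    epSum M.H k (run.varOptAt ω) ≤ 8 * epSum M.H k (run.rewardValAt ω)
      + 260 * ((M.H : ℝ) ^ 2 * ℓ) + 4 * ((M.H : ℝ) ^ 2 * b) := by
  have h1 : epSum M.H k (run.varOptAt ω) ≤ 2 * epSum M.H k (run.varValAt ω)
      + 2 * M.H * epSum M.H k (run.nextMean ω (run.gapFn ω)) := by
    rw [← epSum_const_mul, ← epSum_const_mul, ← epSum_add]
    exact epSum_mono fun j hj t ht => hg.varOptAt_le hL hℓ (hj.trans_le hk) ht
  have h2 := hg.epSum_varValAt_le hℓ hk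
  have h3 := hg.gap.mean k hk
  have h4 := epSum_nextVal_le (run := run) (g := run.gapFn ω) (a := run.gapAt ω)
    (fun j hj t ht => (hg.gapFn_eq hL hℓ (hj.trans_le hk) ht _).symm) hb
  have h5 : 2 * (M.H : ℝ) * epSum M.H k (run.nextMean ω (run.gapFn ω)) ≤
      2 * M.H * (2 * (M.H * b) + 10 * (M.H * (3 * ℓ))) := by
    gcongr
    linarith
  linarith

end GoodEvent

end EulerGPRun

/-- The self-bounding inequality for the sum `D` of the gaps, solved. -/
lemma le_of_self_bounding {c α H ℓ V R O D : ℝ} (hc : 1 ≤ c) (hα : 1 ≤ α) (hH : 1 ≤ H)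
    (hℓ : 1 ≤ ℓ) (hV : 0 ≤ V) (hD : 0 ≤ D) (hR : R ≤ 2 * V + 30 * ℓ)
    (hO : O ≤ 16 * V + 500 * (H ^ 2 * ℓ) + 4 * (H ^ 2 * D))
    (h : D ≤ 4374 * (183 * (c ^ 2 * α * H ^ 2 * ℓ ^ 2) + 6 * (√(2 * (c * α * ℓ ^ 2)) *
      (√R + √O + √(1300000000 * (c ^ 2 * α * H ^ 5 * ℓ ^ 3))))) + 186535791 * (H ^ 2 * ℓ)) :
    D ≤ 7000000000 * (ℓ ^ 3 * (√(c * α * V) + √c * c * α * H ^ 2 * (√c + √H))) := by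
  have hσ : √(2 * (c * α * ℓ ^ 2)) ≤ 3 / 2 * (√(c * α) * ℓ) := by
    rw [Real.sqrt_mul (by norm_num), Real.sqrt_mul' _ (sq_nonneg ℓ), Real.sqrt_sq (by linarith)]
    exact mul_le_mul_of_nonneg_right sqrt_two_le (by positivity)
  have hRs : √R ≤ 3 / 2 * √V + 6 * ℓ := by
    refine sqrt_le_add_of_le (by positivity) (by positivity) (hR.trans ?_)
    rw [mul_pow, Real.sq_sqrt hV]
    nlinarith
  have hOs : √O ≤ 4 * √V + (23 * (H * ℓ) + 2 * (H * √D)) := by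
    refine sqrt_le_add_of_le (by positivity) (by positivity) (hO.trans ?_)
    rw [mul_pow, Real.sq_sqrt hV, add_sq, mul_pow 2, mul_pow H, Real.sq_sqrt hD]
    have h1 : H ^ 2 * ℓ ≤ H ^ 2 * ℓ ^ 2 := by gcongr; exact le_self_pow₀ hℓ (by norm_num)
    have h2 : 0 ≤ 2 * (23 * (H * ℓ)) * (2 * (H * √D)) := by positivity
    nlinarith
  have hWs : √(1300000000 * (c ^ 2 * α * H ^ 5 * ℓ ^ 3)) ≤
      36056 * (c * √α * (H ^ 2 * √H) * ℓ ^ 2) := by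
    rw [Real.sqrt_le_left (by positivity)]
    have e : (36056 * (c * √α * (H ^ 2 * √H) * ℓ ^ 2)) ^ 2 =
        1300035136 * (c ^ 2 * (√α) ^ 2 * (H ^ 4 * (√H) ^ 2) * ℓ ^ 4) := by ring
    rw [e, Real.sq_sqrt (by linarith), Real.sq_sqrt (by linarith)]
    have h1 : c ^ 2 * α * H ^ 5 * ℓ ^ 3 ≤ c ^ 2 * α * H ^ 5 * ℓ ^ 4 := by
      gcongr
      norm_num
    have h2 : 0 ≤ c ^ 2 * α * H ^ 5 * ℓ ^ 3 := by positivity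
    have e2 : c ^ 2 * α * (H ^ 4 * H) * ℓ ^ 4 = c ^ 2 * α * H ^ 5 * ℓ ^ 4 := by ring
    rw [e2]
    linarith
  obtain ⟨σ, hσ'⟩ : ∃ σ, σ = √(c * α) := ⟨_, rfl⟩
  rw [← hσ'] at hσ
  have hσ0 : 0 ≤ σ := by rw [hσ']; positivity
  have hσσ : σ ^ 2 = c * α := by rw [hσ', Real.sq_sqrt (by positivity)]
  have hσ1 : 1 ≤ σ := by
    rw [hσ', Real.one_le_sqrt]; exact one_le_mul_of_one_le_of_one_le hc hα
  obtain ⟨Y, hY⟩ : ∃ Y, Y = √(c * α * V) := ⟨_, rfl⟩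
  have hYe : σ * √V = Y := by rw [hY, hσ', ← Real.sqrt_mul (by positivity)]
  -- `X` and `Z` are the two summands of the lower-order term; `Z` collects the contribution of the
  -- squared widths.
  obtain ⟨X, hX⟩ : ∃ X, X = c ^ 2 * α * H ^ 2 := ⟨_, rfl⟩
  obtain ⟨Z, hZ⟩ : ∃ Z, Z = √c * c * α * H ^ 2 * √H := ⟨_, rfl⟩
  have hXZ : √c * c * α * H ^ 2 * (√c + √H) = X + Z := by
    rw [hX, hZ]
    have : √c * √c = c := Real.mul_self_sqrt (by linarith)
    linear_combination (c * α * H ^ 2) * this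
  rw [hXZ, ← hY]
  have hX0 : 0 ≤ X := by rw [hX]; positivity
  have hZ0 : 0 ≤ Z := by rw [hZ]; positivity
  have hY0 : 0 ≤ Y := by rw [hY]; positivity
  have hcX : c * α * H ^ 2 ≤ X := by
    rw [hX]; gcongr; exact le_self_pow₀ hc (by norm_num)
  have hcα : 1 ≤ c * α := one_le_mul_of_one_le_of_one_le hc hα
  have hσH : σ * H ≤ X := by
    refine le_trans ?_ hcX
    rw [← hσσ]
    have h1 : σ ≤ σ ^ 2 := le_self_pow₀ hσ1 (by norm_num)
    have h2 : H ≤ H ^ 2 := le_self_pow₀ hH (by norm_num)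
    gcongr
  have hσX : σ ≤ X := (le_mul_of_one_le_right hσ0 hH).trans hσH
  have hHX : H ^ 2 ≤ X := (le_mul_of_one_le_left (by positivity) hcα).trans hcX
  have hσZ : σ * (c * √α * (H ^ 2 * √H)) = Z := by
    rw [hσ', hZ, Real.sqrt_mul (by linarith)]
    have : √α * √α = α := Real.mul_self_sqrt (by linarith)
    linear_combination (√c * c * H ^ 2 * √H) * this
  have hDs : √D ^ 2 = D := Real.sq_sqrt hD
  have hDs0 := Real.sqrt_nonneg D
  -- The term that contains `D` itself, with `78732 = 4374 · 6 · 3`; completing the square leaves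
  -- half of `D` to absorb.
  have hcross : 78732 * (σ * ℓ * H * √D) ≤ 1 / 2 * D + 3099363912 * (ℓ ^ 2 * X) := by
    have h1 : 0 ≤ (√D - 78732 * (σ * ℓ * H)) ^ 2 := sq_nonneg _
    have h2 : (σ * ℓ * H) ^ 2 ≤ ℓ ^ 2 * X := by
      have e : (σ * ℓ * H) ^ 2 = ℓ ^ 2 * (c * α * H ^ 2) := by rw [← hσσ]; ring
      rw [e]; gcongr
    have e : (√D - 78732 * (σ * ℓ * H)) ^ 2 = √D ^ 2 - 2 * (78732 * (σ * ℓ * H * √D))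
      + 6198727824 * (σ * ℓ * H) ^ 2 := by ring
    rw [e, hDs] at h1
    linarith
  have hmain : √(2 * (c * α * ℓ ^ 2)) *
      (√R + √O + √(1300000000 * (c ^ 2 * α * H ^ 5 * ℓ ^ 3))) ≤
      3 / 2 * (σ * ℓ) * ((3 / 2 * √V + 6 * ℓ) + (4 * √V + (23 * (H * ℓ) + 2 * (H * √D)))
        + 36056 * (c * √α * (H ^ 2 * √H) * ℓ ^ 2)) := by
    gcongr
  have e : 3 / 2 * (σ * ℓ) * ((3 / 2 * √V + 6 * ℓ) + (4 * √V + (23 * (H * ℓ) + 2 * (H * √D)))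
        + 36056 * (c * √α * (H ^ 2 * √H) * ℓ ^ 2)) = 33 / 4 * (ℓ * Y) + 9 * (ℓ ^ 2 * σ)
      + 69 / 2 * (ℓ ^ 2 * (σ * H)) + 3 * (σ * ℓ * H * √D) + 54084 * (ℓ ^ 3 * Z) := by
    rw [← hYe, ← hσZ]; ring
  rw [e] at hmain
  have p1 : ℓ ^ 2 ≤ ℓ ^ 3 := pow_le_pow_right₀ hℓ (by norm_num)
  have p2 : ℓ ≤ ℓ ^ 3 := le_self_pow₀ hℓ (by norm_num)
  have q1 : ℓ * Y ≤ ℓ ^ 3 * Y := mul_le_mul_of_nonneg_right p2 hY0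
  have q2 : ℓ ^ 2 * σ ≤ ℓ ^ 3 * X := by gcongr
  have q3 : ℓ ^ 2 * (σ * H) ≤ ℓ ^ 3 * X := by gcongr
  have q4 : H ^ 2 * ℓ ≤ ℓ ^ 3 * X := by rw [mul_comm]; gcongr
  have q5 : ℓ ^ 2 * X ≤ ℓ ^ 3 * X := by gcongr
  have q6 : c ^ 2 * α * H ^ 2 * ℓ ^ 2 ≤ ℓ ^ 3 * X := by rw [← hX, mul_comm]; exact q5
  have q7 : 0 ≤ ℓ ^ 3 * Y := by positivity
  have q8 : 0 ≤ ℓ ^ 3 * X := by positivity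
  have q9 : 0 ≤ ℓ ^ 3 * Z := by positivity
  rw [mul_add, mul_add]
  linarith

namespace EulerGPRun

variable {S A Ω : Type*} [Fintype S] [DecidableEq S] [Fintype A] [DecidableEq A]
  [mΩ : MeasurableSpace Ω] {M : FiniteMDP S A} {K : ℕ} {δ : ℝ} {P : Measure Ω}
  {run : EulerGPRun M K δ P} {ω : Ω} {ℓ : ℝ}

namespace GoodEvent

variable [Nonempty A]

/-- The regret bound in terms of a budget `V` for the variances along the path. -/
lemma regret_le (hg : run.GoodEvent ℓ ω) (hL : logFactor S A M.H K δ = ℓ) (hℓ : 2 ≤ ℓ)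
    (hK : (K * M.H : ℕ) ≤ Real.exp ℓ) {k : ℕ} (hk : k ≤ K) {V : ℝ} (hV : 0 ≤ V)
    (hR : epSum M.H k (run.varRAt ω) ≤ 2 * V + 30 * ℓ)
    (hO : epSum M.H k (run.varOptAt ω) ≤ 16 * V ∨
      epSum M.H k (run.rewardValAt ω) ≤ 2 * V + 30 * (M.H * ℓ)) :
    run.regret k ω ≤ 7000000000 * (ℓ ^ 3 * (√(Fintype.card S * Fintype.card A * V)
      + lowerOrder S A M.H)) := by
  have hℓ0 : 0 ≤ ℓ := by linarith
  have hH : (1 : ℝ) ≤ M.H := by exact_mod_cast M.H_pos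
  have hS : (1 : ℝ) ≤ Fintype.card S := by exact_mod_cast run.card_pos_of_run ω
  have hA : (1 : ℝ) ≤ Fintype.card A := by exact_mod_cast Fintype.card_pos
  -- The variance bound needs the sums of the gaps at all time-steps, so the self-bounding
  -- inequality is applied to the largest of them, not to the regret itself.
  obtain ⟨τ, hτ, hmax⟩ := Finset.exists_max_image (Finset.range (M.H + 1))
    (fun τ => ∑ j ∈ Finset.range k, run.gapAt ω j τ) ⟨0, by simp⟩
  have hmax' : ∀ u ≤ M.H, ∑ j ∈ Finset.range k, run.gapAt ω j u ≤
      ∑ j ∈ Finset.range k, run.gapAt ω j τ :=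
    fun u hu => hmax u (Finset.mem_range.2 (by omega))
  have hτ' : τ ≤ M.H := by have := Finset.mem_range.1 hτ; omega
  have hreg : run.regret k ω ≤ ∑ j ∈ Finset.range k, run.gapAt ω j τ := by
    refine le_trans (Finset.sum_le_sum fun j hj => ?_) (hmax' 0 (Nat.zero_le _))
    have := hg.order hL hℓ0 ((Finset.mem_range.1 hj).trans_le hk).le (Nat.zero_le M.H)
      (run.state j 0 ω)
    unfold gapAt
    linarith
  refine hreg.trans (le_of_self_bounding hS hA hH (by linarith) hV
    (Finset.sum_nonneg fun j hj =>
      (hg.gapAt_mem hL hℓ0 ((Finset.mem_range.1 hj).trans_le hk).le hτ').1) hR ?_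
    (hg.sum_gapAt_le hL hℓ hK hk τ hτ'))
  have hb : 0 ≤ ∑ j ∈ Finset.range k, run.gapAt ω j τ := Finset.sum_nonneg fun j hj =>
      (hg.gapAt_mem hL hℓ0 ((Finset.mem_range.1 hj).trans_le hk).le hτ').1
  rcases hO with h | h
  · have h1 : 0 ≤ (M.H : ℝ) ^ 2 * ℓ := by positivity
    have h2 : 0 ≤ (M.H : ℝ) ^ 2 * ∑ j ∈ Finset.range k, run.gapAt ω j τ := by positivity
    linarith
  · have h1 := hg.epSum_varOptAt_le hL hℓ0 hk hmax'
    have h2 : (M.H : ℝ) * ℓ ≤ (M.H : ℝ) ^ 2 * ℓ := by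
      gcongr; exact le_self_pow₀ hH (by norm_num)
    linarith

end GoodEvent

/-! ### Variance budgets -/

lemma epSum_varRAt_le_card (run : EulerGPRun M K δ P) (ω : Ω) (k : ℕ) :
    epSum M.H k (run.varRAt ω) ≤ (k * M.H : ℕ) := by
  refine (epSum_mono fun j _ t _ => M.varR_le_one _ _).trans_eq ?_
  rw [epSum_const, mul_one]

lemma epSum_rewardValAt_le_card (run : EulerGPRun M K δ P) (ω : Ω) (k : ℕ) :
    epSum M.H k (run.rewardValAt ω) ≤ M.H * (k * M.H : ℕ) := by
  refine (epSum_mono fun j _ t _ => ?_).trans_eq ((epSum_const M.H k (M.H : ℝ)).trans (mul_comm _ _))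
  exact (mul_le_of_le_one_left (M.value_nonneg _ _ _) (M.r_le_one _ _)).trans (M.value_le _ _ _)

lemma varRAt_add_varOptAt_le (run : EulerGPRun M K δ P) (ω : Ω) (j : ℕ) {t : ℕ} (ht : t < M.H) :
    run.varRAt ω j t + run.varOptAt ω j t ≤ M.qStar :=
  le_ciSup (f := fun x : S × A × Fin M.H =>
      M.varR x.1 x.2.1 + varOf (M.p x.1 x.2.1) (M.optValue (x.2.2 + 1)))
    (Set.finite_range _).bddAbove (run.state j t ω, run.action j t ω, ⟨t, ht⟩)

lemma epSum_variances_le_qStar (run : EulerGPRun M K δ P) (ω : Ω) (k : ℕ) :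
    epSum M.H k (run.varRAt ω) ≤ M.qStar * (k * M.H : ℕ) ∧
      epSum M.H k (run.varOptAt ω) ≤ M.qStar * (k * M.H : ℕ) := by
  rw [mul_comm M.qStar, ← epSum_const]
  constructor
  · exact epSum_mono fun j _ t ht => by
      linarith [run.varRAt_add_varOptAt_le ω j ht, varOptAt_nonneg (run := run) (ω := ω) j t]
  · exact epSum_mono fun j _ t ht => by
      linarith [run.varRAt_add_varOptAt_le ω j ht, varRAt_nonneg (run := run) (ω := ω) j t]

/-- Variances are below second moments, and for nonnegative rewards `∑ R² ≤ (∑ R)² ≤ G²` in each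
episode. -/
lemma GoodEvent.epSum_varRAt_le_sq (hg : run.GoodEvent ℓ ω) {k : ℕ} (hk : k ≤ K) {G : ℝ}
    (hG : ∀ j < K, ∑ t ∈ Finset.range M.H, run.reward j t ω ≤ G) :
    epSum M.H k (run.varRAt ω) ≤ 2 * (k * G ^ 2) + 30 * ℓ := by
  have h1 : epSum M.H k (run.varRAt ω) ≤ epSum M.H k
      (fun j t => ∫ y, y ^ 2 ∂(M.R (run.state j t ω) (run.action j t ω))) :=
    epSum_mono fun j _ t _ => M.varR_le_integral_sq _ _
  have h2 := hg.rewardSq k hk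
  have h3 : epSum M.H k (fun j t => run.reward j t ω ^ 2) ≤ k * G ^ 2 := by
    calc _ ≤ ∑ _j ∈ Finset.range k, G ^ 2 := Finset.sum_le_sum fun j hj => by
          have hj' := (Finset.mem_range.1 hj).trans_le hk
          have h0 : ∀ t ∈ Finset.range M.H, 0 ≤ run.reward j t ω := fun t ht =>
            (hg.reward_mem j hj' t (Finset.mem_range.1 ht)).1
          exact (Finset.sum_sq_le_sq_sum_of_nonneg h0).trans
            (pow_le_pow_left₀ (Finset.sum_nonneg h0) (hG j hj') 2)
      _ = _ := by simp
  linarith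

lemma GoodEvent.epSum_rewardValAt_le_sq (hg : run.GoodEvent ℓ ω) (hℓ : 0 ≤ ℓ) {k : ℕ} (hk : k ≤ K)
    {G : ℝ} (hG0 : 0 ≤ G) (hG : ∀ j < K, ∑ t ∈ Finset.range M.H, run.reward j t ω ≤ G)
    (hVG : ∀ j < K, ∀ t < M.H, M.value (run.policy j ω) t (run.state j t ω) ≤ G) :
    epSum M.H k (run.rewardValAt ω) ≤ 2 * (k * G ^ 2) + 30 * (M.H * ℓ) := by
  -- `G` may be far larger than `H`; the minimum keeps the additive error at the order `H ℓ`.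
  set g := min G M.H with hgdef
  have hg0 : 0 ≤ g := le_min hG0 (Nat.cast_nonneg _)
  have h1 : epSum M.H k (run.rewardValAt ω) ≤
      g * epSum M.H k (fun j t => M.r (run.state j t ω) (run.action j t ω)) := by
    rw [← epSum_const_mul]
    refine epSum_mono fun j hj t ht => ?_
    rw [rewardValAt, mul_comm]
    exact mul_le_mul_of_nonneg_right (le_min (hVG j (hj.trans_le hk) t ht) (M.value_le _ _ _))
      (M.r_nonneg _ _)
  have h2 := hg.rewardSum k hk
  have h3 : epSum M.H k (fun j t => run.reward j t ω) ≤ k * G := by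
    calc _ ≤ ∑ _j ∈ Finset.range k, G := Finset.sum_le_sum fun j hj =>
          hG j ((Finset.mem_range.1 hj).trans_le hk)
      _ = _ := by simp
  have h4 : epSum M.H k (fun j t => M.r (run.state j t ω) (run.action j t ω)) ≤
      2 * (k * G) + 10 * (3 * ℓ) := by linarith
  have h5 := mul_le_mul_of_nonneg_left h4 hg0
  have h6 : g * (k * G) ≤ G * (k * G) :=
    mul_le_mul_of_nonneg_right (min_le_left _ _) (by positivity)
  have h7 : g * ℓ ≤ M.H * ℓ := mul_le_mul_of_nonneg_right (min_le_right _ _) hℓ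
  linarith

section AlmostSure

variable [IsProbabilityMeasure P]

/-- Conditioning on `info k t` removes `Y` and leaves `Z` and `G` unchanged. -/
lemma IsDiff.le_of_ae_add_le {k t : ℕ} {Y Z : Ω → ℝ} (hY : run.IsDiff k t Y)
    (hZ : Measurable[run.info k t] Z) (hZi : Integrable Z P) {G : ℝ}
    (h : ∀ᵐ ω ∂P, Z ω + Y ω ≤ G) : ∀ᵐ ω ∂P, Z ω ≤ G := by
  have hle := run.info_le k t
  have h1 := condExp_mono (m := run.info k t) hY.2.1 ((integrable_const G).sub hZi)
    (h.mono fun ω hω => by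
      change Y ω ≤ G - Z ω
      linarith)
  have h2 : StronglyMeasurable[run.info k t] ((fun _ => G) - Z) :=
    (measurable_const.sub hZ).stronglyMeasurable
  rw [condExp_of_stronglyMeasurable hle h2 ((integrable_const G).sub hZi)] at h1
  filter_upwards [h1, hY.2.2] with ω h3 h4
  rw [h4] at h3
  change 0 ≤ G - Z ω at h3
  linarith

lemma integrable_pair (run : EulerGPRun M K δ P) {k t : ℕ} (hk : k < K) (ht : t < M.H)
    (g : S → A → ℝ) : Integrable (fun ω => g (run.state k t ω) (run.action k t ω)) P := by
  refine Integrable.of_bound ((run.measurable_pair hk ht g).mono (run.info_le k t)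
    le_rfl).aestronglyMeasurable (∑ s, ∑ a, ‖g s a‖) (Filter.Eventually.of_forall fun ω => ?_)
  calc ‖g (run.state k t ω) (run.action k t ω)‖ ≤ ∑ a, ‖g (run.state k t ω) a‖ :=
        Finset.single_le_sum (f := fun a => ‖g (run.state k t ω) a‖)
          (fun a _ => norm_nonneg _) (Finset.mem_univ _)
    _ ≤ _ := Finset.single_le_sum (f := fun s => ∑ a, ‖g s a‖)
          (fun s _ => Finset.sum_nonneg fun a _ => norm_nonneg _) (Finset.mem_univ _)

/-- `G` bounds realised rewards, whereas the law of total variance needs `V^π ≤ G`. Going backward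
in time, conditioning replaces the current reward and the next value by their means, which add up to
the current value. By linearity only their separate conditional laws matter. -/
lemma ae_value_add_sum_le (run : EulerGPRun M K δ P) {k : ℕ} (hk : k < K) {G : ℝ}
    (hG : ∀ᵐ ω ∂P, ∑ t ∈ Finset.range M.H, run.reward k t ω ≤ G) : ∀ t ≤ M.H, ∀ᵐ ω ∂P,
    M.value (run.policy k ω) t (run.state k t ω) + ∑ u ∈ Finset.range t, run.reward k u ω ≤ G := by
  intro t ht
  induction ht using Nat.decreasingInduction with
  | self => simpa [M.value_of_ge _ le_rfl] using hG
  | of_succ t ht ih =>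
    have hY1 := run.isDiff_state hk ht (f := fun ω => run.valFn ω k t)
      (fun y => run.measurable_valFn hk ht y) (C := M.H) (fun ω y => by
        rw [abs_of_nonneg (run.valFn_nonneg ω k t y)]; exact run.valFn_le ω k t y)
    have hY2 := run.isDiff_reward hk ht (φ := fun y => y) continuous_id
    have hmean : Measurable[run.info k t] fun ω => run.nextMean ω (run.valFn ω) k t :=
      Finset.measurable_sum _ fun x _ =>
        (run.measurable_pair hk ht (fun s a => M.p s a x)).mul (run.measurable_valFn hk ht x)
    have hr := run.measurable_pair hk ht M.r
    have hRm : ∀ u ∈ Finset.range t, Measurable[run.info k t] (run.reward k u) := fun u hu =>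
      (run.reward_meas k hk u ((Finset.mem_range.1 hu).trans ht)).mono
        (run.info_mono_step k (Finset.mem_range.1 hu) ht.le) le_rfl
    have hY : run.IsDiff k t (fun ω => (run.valFn ω k t (run.state k (t + 1) ω)
        - run.nextMean ω (run.valFn ω) k t) + (run.reward k t ω
        - M.r (run.state k t ω) (run.action k t ω))) := by
      have h := IsDiff.sum (s := Finset.univ) (Y := fun (b : Bool) ω => if b then
        (run.valFn ω k t (run.state k (t + 1) ω) - run.nextMean ω (run.valFn ω) k t) else
        (run.reward k t ω - M.r (run.state k t ω) (run.action k t ω)))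
        (fun b _ => by cases b; exacts [hY2, hY1])
      simpa using h
    have h := hY.le_of_ae_add_le (Z := fun ω => (M.r (run.state k t ω) (run.action k t ω)
      + run.nextMean ω (run.valFn ω) k t) + ∑ u ∈ Finset.range t, run.reward k u ω) (G := G)
      ((hr.add hmean).add (Finset.measurable_sum _ hRm))
      (((run.integrable_pair hk ht M.r).add (Integrable.of_bound
        (hmean.mono (run.info_le k t) le_rfl).aestronglyMeasurable (M.H : ℝ)
        (Filter.Eventually.of_forall fun ω => by
          rw [Real.norm_eq_abs, abs_of_nonneg (run.nextMean_nonneg ω (run.valFn_nonneg ω k t))]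
          exact run.nextMean_le ω (Nat.cast_nonneg _) (run.valFn_le ω k t)))).add
        (integrable_finsetSum _ fun u hu => Integrable.of_bound
          ((hRm u hu).mono (run.info_le k t) le_rfl).aestronglyMeasurable 1
          ((run.reward_mem hk ((Finset.mem_range.1 hu).trans ht)).mono fun ω hω => by
            rw [Real.norm_eq_abs, abs_of_nonneg hω.1]; exact hω.2)))
      (by
        filter_upwards [ih] with ω hω
        rw [Finset.sum_range_succ] at hω
        change run.valFn ω k t (run.state k (t + 1) ω) + _ ≤ G at hω
        linarith)
    filter_upwards [h] with ω hω
    rw [run.value_state_eq ω k ht]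
    exact hω

/-- Almost surely, the values along the path are bounded by the total reward bound. -/
lemma ae_value_le (run : EulerGPRun M K δ P) {G : ℝ}
    (hG : ∀ k < K, ∀ᵐ ω ∂P, ∑ t ∈ Finset.range M.H, run.reward k t ω ≤ G) : ∀ᵐ ω ∂P,
    ∀ k < K, ∀ t < M.H, M.value (run.policy k ω) t (run.state k t ω) ≤ G := by
  have : ∀ᵐ ω ∂P, ∀ k ∈ Finset.range K, ∀ t ∈ Finset.range M.H,
      M.value (run.policy k ω) t (run.state k t ω) ≤ G :=
    (Finset.eventually_all _).2 fun k hk => (Finset.eventually_all _).2 fun t ht => by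
      have hk' := Finset.mem_range.1 hk
      have ht' := Finset.mem_range.1 ht
      filter_upwards [run.ae_value_add_sum_le hk' (hG k hk') t ht'.le, run.ae_reward_mem]
        with ω h1 h2
      have : 0 ≤ ∑ u ∈ Finset.range t, run.reward k u ω := Finset.sum_nonneg fun u hu =>
        (h2 k hk' u ((Finset.mem_range.1 hu).trans ht')).1
      linarith
  simpa using this

end AlmostSure

end EulerGPRun

/-! ### The failure probability -/

lemma exp_logFactor {S A : Type*} [Fintype S] [Fintype A] [Nonempty S] [Nonempty A] {H K : ℕ}
    (hH : 0 < H) (hK : 0 < K) {δ : ℝ} (hδ : 0 < δ) : Real.exp (logFactor S A H K δ) =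
      36 * (Fintype.card S * Fintype.card A * K * H) / δ := by
  have hS : (0 : ℝ) < Fintype.card S := by exact_mod_cast Fintype.card_pos
  have hA : (0 : ℝ) < Fintype.card A := by exact_mod_cast Fintype.card_pos
  have hH' : (0 : ℝ) < H := by exact_mod_cast hH
  have hK' : (0 : ℝ) < K := by exact_mod_cast hK
  rw [logFactor, Real.exp_log (by push_cast; positivity)]
  push_cast
  field_simp
  ring

lemma three_le_logFactor {S A : Type*} [Fintype S] [Fintype A] [Nonempty S] [Nonempty A] {H K : ℕ}
    (hH : 0 < H) (hK : 0 < K) {δ : ℝ} (hδ : 0 < δ) (hδ1 : δ < 1) : 3 ≤ logFactor S A H K δ := by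
  rw [← Real.exp_le_exp, exp_logFactor hH hK hδ, le_div_iff₀ hδ]
  have hS : (1 : ℝ) ≤ Fintype.card S := by exact_mod_cast Fintype.card_pos
  have hA : (1 : ℝ) ≤ Fintype.card A := by exact_mod_cast Fintype.card_pos
  have hH' : (1 : ℝ) ≤ H := by exact_mod_cast hH
  have hK' : (1 : ℝ) ≤ K := by exact_mod_cast hK
  have h1 : (1 : ℝ) ≤ Fintype.card S * Fintype.card A * K * H :=
    one_le_mul_of_one_le_of_one_le (one_le_mul_of_one_le_of_one_le
      (one_le_mul_of_one_le_of_one_le hS hA) hK') hH'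
  have h2 : Real.exp 3 ≤ 27 := by
    have : Real.exp 3 = Real.exp 1 ^ 3 := by rw [← Real.exp_nat_mul]; norm_num
    rw [this]
    calc Real.exp 1 ^ 3 ≤ 3 ^ 3 :=
          pow_le_pow_left₀ (Real.exp_pos 1).le (by linarith [Real.exp_one_lt_d9]) 3
      _ = 27 := by norm_num
  have h3 : Real.exp 3 * δ ≤ 27 * 1 := mul_le_mul h2 hδ1.le hδ.le (by norm_num)
  linarith

lemma sq_le_lowerOrder {S A : Type*} [Fintype S] [Fintype A] [Nonempty S] [Nonempty A] (H : ℕ) :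
    (H : ℝ) ^ 2 ≤ lowerOrder S A H := by
  have hS : (1 : ℝ) ≤ Fintype.card S := by exact_mod_cast Fintype.card_pos
  have hA : (1 : ℝ) ≤ Fintype.card A := by exact_mod_cast Fintype.card_pos
  have hS' : 1 ≤ √(Fintype.card S : ℝ) := Real.one_le_sqrt.2 hS
  have h1 : (1 : ℝ) ≤ √(Fintype.card S : ℝ) * Fintype.card S * Fintype.card A :=
    one_le_mul_of_one_le_of_one_le (one_le_mul_of_one_le_of_one_le hS' hS) hA
  have h2 : 1 ≤ √(Fintype.card S : ℝ) + √(H : ℝ) := by linarith [Real.sqrt_nonneg (H : ℝ)]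
  unfold lowerOrder
  calc (H : ℝ) ^ 2 = 1 * (H : ℝ) ^ 2 * 1 := by ring
    _ ≤ _ := by gcongr

/-- The union bound over all the concentration inequalities, evaluated. -/
lemma failure_le {c α H K ε δ N : ℝ} (hc : 1 ≤ c) (hα : 1 ≤ α) (hH : 1 ≤ H) (hK : 27 ≤ K)
    (hδ : 0 ≤ δ) (hε : ε = δ / (36 * (c * α * K * H))) (hδ1 : δ ≤ 1) (hN0 : 0 ≤ N)
    (hN : N + 1 ≤ K / 2) :
    (c * α + c * α * H) * (2 * ((N + 1) * (ε * Real.exp 1)))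
      + (c * α + c * α * H + c * α * c + (H + 1) + (H + 1) + 4) * ε ^ 3 ≤ δ := by
  have hcα : 1 ≤ c * α := one_le_mul_of_one_le_of_one_le hc hα
  have hW : 0 < c * α * K * H := by positivity
  have hε0 : 0 ≤ ε := by rw [hε]; positivity
  have hprod : c * α * K * H * ε = δ / 36 := by rw [hε]; field_simp
  have hcαH : c * α ≤ c * α * H := le_mul_of_one_le_right (by linarith) hH
  -- The factor `exp 1 ≤ 3` is the price of `L - 1` in the grid bounds, and the `K` in `exp (-ℓ) = δ
  -- / (36 S A K H)` pays for the grid.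
  have h1 : (c * α + c * α * H) * (2 * ((N + 1) * (ε * Real.exp 1))) ≤ δ / 6 := by
    have he : Real.exp 1 ≤ 3 := by linarith [Real.exp_one_lt_d9]
    calc (c * α + c * α * H) * (2 * ((N + 1) * (ε * Real.exp 1))) ≤
          (2 * (c * α * H)) * (2 * (K / 2 * (ε * 3))) := by
            gcongr
            linarith
      _ = 6 * (c * α * K * H * ε) := by ring
      _ = δ / 6 := by rw [hprod]; ring
  have hKs : c * α * H ≤ c * α * K * H := by
    have : 0 ≤ c * α * H * (K - 1) := mul_nonneg (by positivity) (by linarith)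
    linarith
  have h2 : c * α * H * ε ≤ δ / 36 := (mul_le_mul_of_nonneg_right hKs hε0).trans_eq hprod
  have h3 : c * α * H * ε ≤ 1 := by linarith
  have hcW : c ≤ c * α * H := by
    calc c = c * 1 * 1 := by ring
      _ ≤ c * α * H := by gcongr
  have h4 : c * ε ≤ 1 := (mul_le_mul_of_nonneg_right hcW hε0).trans h3
  have h1W : 1 ≤ c * α * H := one_le_mul_of_one_le_of_one_le hcα hH
  have h5 : ε ≤ δ / 36 := by
    have := mul_le_mul_of_nonneg_right h1W hε0
    linarith
  have h6 : c * α + c * α * H + c * α * c + (H + 1) + (H + 1) + 4 ≤ 11 * (c * α * H) * c := by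
    have a1 : c * α * H ≤ c * α * H * c := le_mul_of_one_le_right (by positivity) hc
    have a2 : c * α * c ≤ c * α * H * c := mul_le_mul_of_nonneg_right hcαH (by linarith)
    have a3 : H ≤ c * α * H := le_mul_of_one_le_left (by linarith) hcα
    linarith
  -- Of the three factors `ε`, one cancels `S A H`, one cancels the extra `S`, and the last supplies
  -- `δ / 36`.
  have h7 : (c * α + c * α * H + c * α * c + (H + 1) + (H + 1) + 4) * ε ^ 3 ≤ 11 * (δ / 36) := by
    calc _ ≤ 11 * (c * α * H) * c * ε ^ 3 := mul_le_mul_of_nonneg_right h6 (by positivity)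
      _ = 11 * (c * α * H * ε) * (c * ε) * ε := by ring
      _ ≤ 11 * 1 * 1 * (δ / 36) := by gcongr
      _ = _ := by ring
  linarith

namespace EulerGPRun

variable {S A Ω : Type*} [Fintype S] [DecidableEq S] [Fintype A] [DecidableEq A]
  [mΩ : MeasurableSpace Ω] {M : FiniteMDP S A} {K : ℕ} {δ : ℝ} {P : Measure Ω}

lemma regret_le_card [Nonempty A] (run : EulerGPRun M K δ P) (k : ℕ) (ω : Ω) :
    run.regret k ω ≤ k * M.H := by
  calc run.regret k ω ≤ ∑ _j ∈ Finset.range k, (M.H : ℝ) := Finset.sum_le_sum fun j _ => by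
        linarith [M.optValue_le 0 (run.state j 0 ω),
          M.value_nonneg (run.policy j ω) 0 (run.state j 0 ω)]
    _ = _ := by simp

/-- The grid needs `N ≥ √(K H ℓ)`. The assumption on `K` makes this root at most `K / 3`, and `K ≥
27` then gives `N + 1 ≤ K / 2`. -/
theorem measureReal_not_goodEvent_le_delta [Nonempty S] [Nonempty A] [IsProbabilityMeasure P]
    (run : EulerGPRun M K δ P) (hδ : 0 < δ) (hδ1 : δ < 1) (hK0 : 0 < K)
    (hK : 9 * M.H * logFactor S A M.H K δ ≤ K) :
    P.real {ω | ¬run.GoodEvent (logFactor S A M.H K δ) ω} ≤ δ := by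
  have hH : (1 : ℝ) ≤ M.H := by exact_mod_cast M.H_pos
  have hS : (1 : ℝ) ≤ Fintype.card S := by exact_mod_cast Fintype.card_pos
  have hA : (1 : ℝ) ≤ Fintype.card A := by exact_mod_cast Fintype.card_pos
  have hℓ3 := three_le_logFactor (S := S) (A := A) M.H_pos hK0 hδ hδ1
  have hexp := exp_logFactor (S := S) (A := A) M.H_pos hK0 hδ
  set ℓ := logFactor S A M.H K δ
  have hK27 : (27 : ℝ) ≤ K := by nlinarith
  set N := ⌈√((K * M.H : ℕ) * ℓ)⌉₊
  have hN1 : (N : ℝ) + 1 ≤ K / 2 := by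
    have h1 : (N : ℝ) < √((K * M.H : ℕ) * ℓ) + 1 := Nat.ceil_lt_add_one (Real.sqrt_nonneg _)
    have h2 : √((K * M.H : ℕ) * ℓ) ≤ K / 3 := by
      rw [Real.sqrt_le_left (by positivity)]
      push_cast
      nlinarith
    linarith
  have hN2 : ((K * M.H : ℕ) : ℝ) * ℓ ≤ (N : ℝ) ^ 2 := by
    rw [← Real.sqrt_le_left (Nat.cast_nonneg N)]
    exact Nat.le_ceil _
  have hacc := measureReal_not_mono (q := fun ω => ∀ k ≤ K, EulerGP.IsAccurate M ℓ (run.hist ω) k)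
    (fun ω h k hk => (h k hk).isAccurate (by linarith)
      (le_trans (mul_le_mul_of_nonneg_right (by exact_mod_cast Nat.mul_le_mul_right _ hk)
        (by linarith)) hN2)) (run.measureReal_not_gridAccurate_le N ℓ)
  refine (run.measureReal_not_goodEvent_le (by linarith) hacc).trans ?_
  have hε : Real.exp (-ℓ) = δ / (36 * (Fintype.card S * Fintype.card A * K * M.H)) := by
    rw [Real.exp_neg, hexp, inv_div]
  have h := failure_le hS hA hH hK27 hδ.le hε hδ1.le (Nat.cast_nonneg N) hN1
  rw [← Real.exp_add, ← Real.exp_nat_mul] at h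
  rwa [show -ℓ + 1 = -(ℓ - 1) by ring, show ((3 : ℕ) : ℝ) * -ℓ = -(3 * ℓ) by push_cast; ring] at h

/-- On the good event both regret bounds hold. -/
lemma GoodEvent.regret_le_and {run : EulerGPRun M K δ P} {ω : Ω} {ℓ : ℝ} [Nonempty A]
    (hg : run.GoodEvent ℓ ω) (hL : logFactor S A M.H K δ = ℓ) (hℓ : 2 ≤ ℓ)
    (hK : (K * M.H : ℕ) ≤ Real.exp ℓ) {k : ℕ} (hk0 : 0 < k) (hk : k ≤ K) {G : ℝ}
    (hG : ∀ j < K, ∑ t ∈ Finset.range M.H, run.reward j t ω ≤ G)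
    (hVG : ∀ j < K, ∀ t < M.H, M.value (run.policy j ω) t (run.state j t ω) ≤ G) :
    run.regret k ω ≤ 7000000000 * ℓ ^ 3 * (√(M.hEff G * Fintype.card S * Fintype.card A
      * (k * M.H : ℕ)) + lowerOrder S A M.H) ∧
    run.regret k ω ≤ 7000000000 * ℓ ^ 3 * (√(M.H * Fintype.card S * Fintype.card A
      * (k * M.H : ℕ)) + lowerOrder S A M.H) := by
  simp only [mul_assoc (7000000000 : ℝ)]
  have hH : (0 : ℝ) < M.H := by exact_mod_cast M.H_pos
  have hG0 : 0 ≤ G :=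
    (M.value_nonneg _ _ _).trans (hVG 0 (hk0.trans_le hk) 0 M.H_pos)
  -- The variance budgets are `ℚ* T` and `k G² = (G² / H) T` for the first bound, and `H T` for the
  -- second, with `T = k H`.
  constructor
  · have hQ := run.epSum_variances_le_qStar ω k
    have hQ0 : 0 ≤ M.qStar * (k * M.H : ℕ) :=
      (epSum_nonneg fun j _ t _ => varRAt_nonneg (run := run) (ω := ω) j t).trans hQ.1
    rcases min_choice M.qStar (G ^ 2 / M.H) with h | h
    · have h1 := hg.regret_le hL hℓ hK hk hQ0 (by linarith [hQ.1]) (Or.inl (by linarith [hQ.2]))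
      rw [FiniteMDP.hEff, h]
      convert h1 using 5
      ring
    · have h1 := hg.regret_le hL hℓ hK hk (V := k * G ^ 2) (by positivity)
        (hg.epSum_varRAt_le_sq hk hG)
        (Or.inr (hg.epSum_rewardValAt_le_sq (by linarith) hk hG0 hG hVG))
      rw [FiniteMDP.hEff, h]
      convert h1 using 5
      push_cast
      field_simp
  · have h1 := run.epSum_varRAt_le_card ω k
    have h2 := run.epSum_rewardValAt_le_card ω k
    have h3 : ((k * M.H : ℕ) : ℝ) ≤ M.H * (k * M.H : ℕ) :=
      le_mul_of_one_le_left (Nat.cast_nonneg _) (by exact_mod_cast M.H_pos)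
    have h4 : 0 ≤ (M.H : ℝ) * (k * M.H : ℕ) := by positivity
    have h5 : 0 ≤ (M.H : ℝ) * ℓ := by positivity
    have h6 := hg.regret_le hL hℓ hK hk h4 (by linarith) (Or.inr (by linarith))
    convert h6 using 5
    ring

end EulerGPRun

end

theorem mainTheorem6 :
    ∃ (C : ℝ) (d : ℕ), 0 < C ∧
      ∀ (S A Ω : Type*) [Fintype S] [DecidableEq S] [Nonempty S]
        [Fintype A] [DecidableEq A] [Nonempty A] [MeasurableSpace Ω]
        (P : Measure Ω) [IsProbabilityMeasure P]
        (M : FiniteMDP S A) (K : ℕ) (δ : ℝ), 0 < δ → δ < 1 →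
        ∀ (run : EulerGPRun M K δ P) (G : ℝ),
          (∀ k < K, ∀ᵐ ω ∂P, ∑ t ∈ Finset.range M.H, run.reward k t ω ≤ G) →
          1 - δ ≤ P.real {ω | ∀ k ∈ Finset.Icc 1 K,
            run.regret k ω ≤ C * logFactor S A M.H K δ ^ d *
              (√(M.hEff G * Fintype.card S * Fintype.card A * (k * M.H : ℕ))
                + lowerOrder S A M.H) ∧
            run.regret k ω ≤ C * logFactor S A M.H K δ ^ d *
              (√(M.H * Fintype.card S * Fintype.card A * (k * M.H : ℕ))
                + lowerOrder S A M.H)} := by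
  refine ⟨7000000000, 3, by norm_num, ?_⟩
  intro S A Ω _ _ _ _ _ _ _ P _ M K δ hδ hδ1 run G hG
  set p : Ω → Prop := fun ω => ∀ k ∈ Finset.Icc 1 K,
            run.regret k ω ≤ 7000000000 * logFactor S A M.H K δ ^ 3 *
              (√(M.hEff G * Fintype.card S * Fintype.card A * (k * M.H : ℕ))
                + lowerOrder S A M.H) ∧
            run.regret k ω ≤ 7000000000 * logFactor S A M.H K δ ^ 3 *
              (√(M.H * Fintype.card S * Fintype.card A * (k * M.H : ℕ))
                + lowerOrder S A M.H) with hp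
  -- Subadditivity is enough here, so the event need not be measurable.
  suffices h : P.real {ω | ¬p ω} ≤ δ by
    have h1 : (1 : ℝ) ≤ P.real {ω | p ω} + P.real {ω | ¬p ω} := by
      refine le_trans (le_of_eq ?_) (measureReal_union_le _ _)
      rw [← probReal_univ (μ := P)]
      congr 1
      ext ω
      simpa using Classical.em (p ω)
    linarith
  rcases Nat.eq_zero_or_pos K with hK0 | hK0
  · have : {ω | ¬p ω} = ∅ := by
      ext ω; simp [hp, hK0]
    rw [this]; simpa using hδ.le
  have hℓ3 := three_le_logFactor (S := S) (A := A) M.H_pos hK0 hδ hδ1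
  have hexp := exp_logFactor (S := S) (A := A) M.H_pos hK0 hδ
  obtain ⟨ℓ, hL⟩ : ∃ ℓ, logFactor S A M.H K δ = ℓ := ⟨_, rfl⟩
  rw [hL] at hℓ3 hexp
  -- For few episodes the grid cannot be paid for, but then the regret is at most `K H ≤ 9 H² ℓ`,
  -- which the lower-order term covers for every outcome.
  rcases lt_or_ge (K : ℝ) (9 * M.H * ℓ) with hlt | hge
  · have : {ω | ¬p ω} = ∅ := by
      ext ω
      simp only [Set.mem_ofPred_eq, Set.mem_empty_iff_false, iff_false, not_not]
      intro k hk
      have hk2 : (k : ℝ) ≤ K := by exact_mod_cast (Finset.mem_Icc.1 hk).2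
      have h1 := run.regret_le_card k ω
      have h2 := sq_le_lowerOrder (S := S) (A := A) M.H
      have h3 : (k : ℝ) * M.H ≤ 9 * M.H * ℓ * M.H :=
        mul_le_mul_of_nonneg_right (by linarith) (Nat.cast_nonneg _)
      have h4 : ℓ ≤ ℓ ^ 3 := le_self_pow₀ (by linarith) (by norm_num)
      have h5 : ℓ * (M.H : ℝ) ^ 2 ≤ ℓ ^ 3 * lowerOrder S A M.H := by gcongr
      have h6 : 0 ≤ ℓ ^ 3 * lowerOrder S A M.H := le_trans (by positivity) h5
      rw [hL]
      have h7 : ∀ y : ℝ, run.regret k ω ≤ 7000000000 * ℓ ^ 3 * (√y + lowerOrder S A M.H) := by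
        intro y
        have : 0 ≤ ℓ ^ 3 * √y := by positivity
        rw [mul_add]
        linarith
      exact ⟨h7 _, h7 _⟩
    rw [this]; simpa using hδ.le
  · have hgood := run.measureReal_not_goodEvent_le_delta hδ hδ1 hK0 (by rw [hL]; exact hge)
    rw [hL] at hgood
    have hKexp : ((K * M.H : ℕ) : ℝ) ≤ Real.exp ℓ := by
      have hS : (1 : ℝ) ≤ Fintype.card S := by exact_mod_cast Fintype.card_pos
      have hA : (1 : ℝ) ≤ Fintype.card A := by exact_mod_cast Fintype.card_pos
      rw [hexp, le_div_iff₀ hδ]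
      push_cast
      calc (K : ℝ) * M.H * δ ≤ K * M.H * 1 := by gcongr
        _ = 1 * (1 * 1 * K * M.H) := by ring
        _ ≤ 36 * (Fintype.card S * Fintype.card A * K * M.H) := by gcongr; norm_num
    have hG' : ∀ᵐ ω ∂P, ∀ j ∈ Finset.range K, ∑ t ∈ Finset.range M.H, run.reward j t ω ≤ G :=
      (Finset.eventually_all _).2 fun j hj => hG j (Finset.mem_range.1 hj)
    refine measureReal_not_mono_ae ?_ hgood
    filter_upwards [hG', run.ae_value_le hG] with ω h1 h2 hg k hk
    rw [hL]
    exact hg.regret_le_and hL (by linarith) hKexp (Finset.mem_Icc.1 hk).1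
      (Finset.mem_Icc.1 hk).2 (fun j hj => h1 j (Finset.mem_range.2 hj)) h2
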